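/- **Setting.** For $(\alpha,\beta)\in\mathbb F_2^n\times\mathbb F_2^n$ let $W(\alpha,\beta)=\bigotimes_{q=1}^n i^{-\alpha_q\beta_q}Z^{\alpha_q}X^{\beta_q}$ be the $n$-qubit Pauli operator with symplectic representation $\mathrm{symp}(W(\alpha,\beta))=(\alpha,\beta)\in\mathbb F_2^{2n}$. Let $H=\sum_{i=1}^m c_iP_i$, $m\ge 1$, with $c_i\in\mathbb R$ and distinct $n$-qubit Pauli operators $P_i\neq I$ of this form (not necessarily commuting), and let $B^\top\in\mathbb F_2^{2n\times m}$ be the matrix with columns $\mathrm{symp}(P_i)$. A *weight-$l$ decoding oracle* for $H$ is a unitary $\mathcal D$ with $\mathcal D|\mathbf y\rangle|B^\top\mathbf y\rangle=|\mathbf 0\rangle|B^\top\mathbf y\rangle$ for all $\mathbf y\in\mathbb F_2^m$ of Hamming weight $1\le|\mathbf y|\le l$. The anticommutation graph of $H$ has vertices $1,\dots,m$ and an edge $ij$ whenever $P_iP_j=-P_jP_i$; $\mathcal M$ is the largest number of vertices of one of its connected components. Let $\mathcal P(x)=\sum_{j=0}^l a_jx^j$ be a real polynomial of degree at most $l$ with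 $\mathrm{Tr}[\mathcal P(H)^2]\ne0$, and let $\rho_{\mathcal P}(H)=\mathcal P(H)^2/\mathrm{Tr}[\mathcal P(H)^2]$. For $\boldsymbol\mu\in\mathbb Z_{\ge0}^m$ let $S(\boldsymbol\mu)$ be the set of strings over $\{1,\dots,m\}$ that contain each $i$ exactly $\mu_i$ times, and for $\pi\in S(\boldsymbol\mu)$ let $\mathrm{sgn}_{\boldsymbol\mu}(\pi)\in\{\pm1\}$ be defined by $(P_m^{\mu_m}\cdots P_1^{\mu_1})(P_{\pi(1)}\cdots P_{\pi(|\boldsymbol\mu|)})=\mathrm{sgn}_{\boldsymbol\mu}(\pi)\,I$. Put $$\beta^{(s)}(\mathbf y,\mathbf c)=\sum_{|\boldsymbol\mu|=s,\ \boldsymbol\mu\equiv\mathbf y\,(\mathrm{mod}\ 2)}\Big(\prod_i c_i^{\mu_i}\Big)\sum_{\pi\in S(\boldsymbol\mu)}\mathrm{sgn}_{\boldsymbol\mu}(\pi),\qquad |R^l_*(H)\rangle=\frac1{\mathcal N}\sum_{s=0}^l a_s\sum_{\mathbf y\in\mathbb F_2^m}\beta^{(s)}(\mathbf y,\mathbf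 c)\,|\mathbf y\rangle,$$ where $\mathcal N>0$ is the normalization factor. **Theorem.** There is a uniform quantum algorithm with the following property. On input $n$, the $c_i$, the $\mathrm{symp}(P_i)$ and $a_0,\dots,a_l$, a fixed classical program computes a number $k$ of ancillas and three quantum circuits $C_0,C_1,C_2$ on registers $A$ ($m$ qubits), $B$, $C$ ($n$ qubits each) and $k$ ancillas such that 1. $C_0$ maps $|0\cdots0\rangle$ to $|R^l_*(H)\rangle_A|0\cdots0\rangle$; 2. for every weight-$l$ decoding oracle $\mathcal D$ for $H$, applying $C_1$, then a single call of $\mathcal D$ on the registers $A$ and $BC$, then $C_2$, to $|R^l_*(H)\rangle_A|0\cdots0\rangle$, and discarding all registers except $B$, yields exactly $\rho_{\mathcal P}(H)$; 3. the total running time is $O\big((l+\mathcal M)^{O(\mathcal M)}+\mathrm{poly}(m,n)\big)$, with absolute constants and an absolute polynomial. The running time counts the steps of the classical program (where elementary arithmetic, including comparisons and square roots of real numbers, and elementary list operations take one step), the number of qubits, the number of gates of $C_0,C_1,C_2$ (arbitrary single-qubit unitaries with at most two control qubits), and the oracle call. -/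

import Mathlib

open scoped BigOperators

noncomputable section

namespace HDQI

/-! ### Pauli operators, Hamiltonians and the state to be prepared -/

/-- The Pauli matrix `X` in the computational basis `|0⟩, |1⟩`. -/
def pauliX : Matrix (ZMod 2) (ZMod 2) ℂ := Matrix.of fun x y => if x = y then 0 else 1

/-- The Pauli matrix `Z` in the computational basis `|0⟩, |1⟩`. -/
def pauliZ : Matrix (ZMod 2) (ZMod 2) ℂ := Matrix.diagonal fun x => if x = 0 then 1 else -1

/-- The single-qubit Pauli operator `W(α, β) = i ^ (-αβ) Z ^ α X ^ β`. -/
def pauliW (α β : ZMod 2) : Matrix (ZMod 2) (ZMod 2) ℂ :=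
  (Complex.I ^ (-((α.val * β.val : ℕ) : ℤ))) • (pauliZ ^ α.val * pauliX ^ β.val)

/-- The `n`-qubit Pauli operator `W(α₁, β₁) ⊗ ⋯ ⊗ W(αₙ, βₙ)`, where `v = (α, β)`; the `α`-part of
the symplectic vector `v` is indexed by `Sum.inl` and its `β`-part by `Sum.inr`. -/
def pauli {n : ℕ} (v : Fin n ⊕ Fin n → ZMod 2) :
    Matrix (Fin n → ZMod 2) (Fin n → ZMod 2) ℂ :=
  Matrix.of fun x y => ∏ q, pauliW (v (Sum.inl q)) (v (Sum.inr q)) (x q) (y q)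

/-- A Hamiltonian `H = ∑ᵢ cᵢ Pᵢ` on `n` qubits with `m` distinct Pauli terms, each given by its
symplectic representation. -/
structure PauliHamiltonian (n m : ℕ) where
  /-- the symplectic representations of the Pauli terms -/
  symp : Fin m → Fin n ⊕ Fin n → ZMod 2
  /-- the real coefficients -/
  coeff : Fin m → ℝ
  distinct : Function.Injective symp

namespace PauliHamiltonian

variable {n m : ℕ} (H : PauliHamiltonian n m)

/-- The `i`-th Pauli term `Pᵢ`. -/
def term (i : Fin m) : Matrix (Fin n → ZMod 2) (Fin n → ZMod 2) ℂ := pauli (H.symp i)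

/-- The operator `∑ᵢ cᵢ Pᵢ`. -/
def toMatrix : Matrix (Fin n → ZMod 2) (Fin n → ZMod 2) ℂ := ∑ i, H.coeff i • H.term i

/-- The matrix `Bᵀ`, whose columns are the symplectic representations of the Pauli terms. -/
def symplecticCode : Matrix (Fin n ⊕ Fin n) (Fin m) (ZMod 2) := Matrix.of fun a i => H.symp i a

/-- The anticommutation graph. -/
def anticommGraph : SimpleGraph (Fin m) where
  Adj i j := i ≠ j ∧ H.term i * H.term j = -(H.term j * H.term i)
  symm := ⟨fun i j h => ⟨h.1.symm, by rw [h.2, neg_neg]⟩⟩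
  loopless := ⟨fun _ h => h.1 rfl⟩

/-- The largest number of vertices of a connected component of the anticommutation graph. -/
def maxComponent : ℕ :=
  Finset.univ.sup fun i : Fin m => (H.anticommGraph.connectedComponentMk i).supp.ncard

/-- The operator `P(H)`. -/
def polyOp (P : Polynomial ℝ) : Matrix (Fin n → ZMod 2) (Fin n → ZMod 2) ℂ :=
  Polynomial.aeval H.toMatrix P

/-- The state `ρ_P(H) = P(H)² / Tr[P(H)²]`. -/
def rho (P : Polynomial ℝ) : Matrix (Fin n → ZMod 2) (Fin n → ZMod 2) ℂ :=
  (Matrix.trace (H.polyOp P ^ 2))⁻¹ • H.polyOp P ^ 2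

end PauliHamiltonian

/-! ### The weighted β-function and the reference state -/

open Classical in
/-- For elements `zᵢ` with `zᵢ² = 1` that commute or anticommute pairwise, and a string `π` that
contains each `i` exactly `μᵢ` times, the product
`(z_m ^ μ_m ⋯ z_1 ^ μ_1) (z_{π(1)} ⋯ z_{π(s)})` is `1` or `-1`; this is that sign. -/
def wordSign {R : Type*} [Ring R] {m s : ℕ} (z : Fin m → R) (μ : Fin m → ℕ)
    (π : Fin s → Fin m) : ℝ :=
  if ((List.finRange m).reverse.map fun i => z i ^ μ i).prod *
      (List.ofFn fun t => z (π t)).prod = 1 then 1 else -1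

/-- The weighted β-function of order `s`: the sum over the counting vectors `μ` with `|μ| = s` and
`μ ≡ y (mod 2)` of `c ^ μ` times the sum of the signs of the strings with counting vector `μ`. -/
def weightedBeta {R : Type*} [Ring R] {m : ℕ} (z : Fin m → R) (c : Fin m → ℝ) (s : ℕ)
    (y : Fin m → ZMod 2) : ℝ :=
  ∑ μ ∈ (Finset.piAntidiag (Finset.univ : Finset (Fin m)) s).filter
      (fun μ => ∀ i, ((μ i : ℕ) : ZMod 2) = y i),
    (∏ i, c i ^ μ i) *
      ∑ π ∈ (Finset.univ : Finset (Fin s → Fin m)).filter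
          (fun π => ∀ i, (Finset.univ.filter fun t => π t = i).card = μ i),
        wordSign z μ π

namespace PauliHamiltonian

variable {n m : ℕ} (H : PauliHamiltonian n m)

/-- The unnormalized amplitudes `∑_{s ≤ l} a_s β^{(s)}(y, c)`. -/
def refAmplitude (l : ℕ) (P : Polynomial ℝ) (y : Fin m → ZMod 2) : ℝ :=
  ∑ s ∈ Finset.range (l + 1), P.coeff s * weightedBeta H.term H.coeff s y

/-- The normalized reference state `|R^l_*(H)⟩`. -/
def refState (l : ℕ) (P : Polynomial ℝ) (y : Fin m → ZMod 2) : ℂ :=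
  ((H.refAmplitude l P y / Real.sqrt (∑ y', H.refAmplitude l P y' ^ 2) : ℝ) : ℂ)

/-- A weight-`l` decoding oracle: a unitary `D` with
`D |y⟩ |Bᵀ y⟩ = |0⟩ |Bᵀ y⟩` for all `y` with `1 ≤ |y| ≤ l`. -/
def IsDecodingOracle (l : ℕ)
    (D : Matrix ((Fin m → ZMod 2) × (Fin n ⊕ Fin n → ZMod 2))
      ((Fin m → ZMod 2) × (Fin n ⊕ Fin n → ZMod 2)) ℂ) : Prop :=
  D ∈ Matrix.unitaryGroup ((Fin m → ZMod 2) × (Fin n ⊕ Fin n → ZMod 2)) ℂ ∧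
    ∀ y : Fin m → ZMod 2, 1 ≤ hammingNorm y → hammingNorm y ≤ l →
      D.mulVec (Pi.single (y, H.symplecticCode.mulVec y) 1) =
        Pi.single (0, H.symplecticCode.mulVec y) 1

end PauliHamiltonian

/-! ### Quantum circuits -/

/-- An elementary gate on the qubits `ω`: a single-qubit unitary with at most two control qubits. -/
structure Gate (ω : Type) where
  ctrl : List ω
  target : ω
  U : Matrix (ZMod 2) (ZMod 2) ℂ
  ctrl_length : ctrl.length ≤ 2
  target_notMem : target ∉ ctrl
  unitary : U ∈ Matrix.unitaryGroup (ZMod 2) ℂ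

/-- The gate as an operator: it applies `U` to the target if all controls are in the state `|1⟩`,
and acts as the identity otherwise. -/
def Gate.matrix {ω : Type} [Fintype ω] [DecidableEq ω] (g : Gate ω) :
    Matrix (ω → ZMod 2) (ω → ZMod 2) ℂ :=
  Matrix.of fun x y =>
    if ∀ w, w ≠ g.target → x w = y w then
      if ∀ c ∈ g.ctrl, y c = 1 then g.U (x g.target) (y g.target)
      else if x g.target = y g.target then 1 else 0
    else 0

/-- The operator of a circuit; the first gate of the list is applied first. -/
def circuitMatrix {ω : Type} [Fintype ω] [DecidableEq ω] (C : List (Gate ω)) :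
    Matrix (ω → ZMod 2) (ω → ZMod 2) ℂ :=
  C.foldl (fun M g => g.matrix * M) 1

/-- The qubits of the algorithm: register `A` (`m` qubits), registers `B` and `C` (`n` qubits each)
and `k` ancillas. -/
abbrev Wire (n m k : ℕ) : Type := Fin m ⊕ ((Fin n ⊕ Fin n) ⊕ Fin k)

/-- The basis state with contents `a` of `A`, `bc` of `BC` and `e` of the ancillas. -/
abbrev join {n m k : ℕ} (a : Fin m → ZMod 2) (bc : Fin n ⊕ Fin n → ZMod 2) (e : Fin k → ZMod 2) :
    Wire n m k → ZMod 2 :=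
  Sum.elim a (Sum.elim bc e)

/-- The state `|0⟩` of all qubits. -/
def zeroState (n m k : ℕ) : (Wire n m k → ZMod 2) → ℂ := Pi.single 0 1

/-- The state `|ψ⟩_A |0⟩` with all qubits outside `A` in the state `|0⟩`. -/
def withZeros {n m k : ℕ} (ψ : (Fin m → ZMod 2) → ℂ) : (Wire n m k → ZMod 2) → ℂ :=
  fun x => if ∀ w, x (Sum.inr w) = 0 then ψ fun i => x (Sum.inl i) else 0

/-- The call of the oracle `D` on the registers `A` and `BC`. -/
def oracleMatrix {n m k : ℕ}
    (D : Matrix ((Fin m → ZMod 2) × (Fin n ⊕ Fin n → ZMod 2))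
      ((Fin m → ZMod 2) × (Fin n ⊕ Fin n → ZMod 2)) ℂ) :
    Matrix (Wire n m k → ZMod 2) (Wire n m k → ZMod 2) ℂ :=
  Matrix.of fun x y =>
    if ∀ e, x (Sum.inr (Sum.inr e)) = y (Sum.inr (Sum.inr e)) then
      D (fun i => x (Sum.inl i), fun a => x (Sum.inr (Sum.inl a)))
        (fun i => y (Sum.inl i), fun a => y (Sum.inr (Sum.inl a)))
    else 0

/-- The reduced state on register `B`: the partial trace of `|ψ⟩⟨ψ|` over all other qubits. -/
def reducedB {n m k : ℕ} (ψ : (Wire n m k → ZMod 2) → ℂ) :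
    Matrix (Fin n → ZMod 2) (Fin n → ZMod 2) ℂ :=
  Matrix.of fun b b' =>
    ∑ a : Fin m → ZMod 2, ∑ c : Fin n → ZMod 2, ∑ e : Fin k → ZMod 2,
      ψ (join a (Sum.elim b c) e) * star (ψ (join a (Sum.elim b' c) e))

/-! ### Classical programs with a step count

A first-order list-processing language over booleans, natural numbers and real numbers. Every
elementary operation takes one step: arithmetic (on real numbers `+`, `-`, `*`, `/`, square root
and comparison; on natural numbers only `+`, truncated `-` and comparison), and building or taking
apart pairs and lists. The only numerical constants are natural numbers and the reals `0`, `1`.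
Values are immutable and can be shared through pointers, so a program runs on a
real-number random access machine with constant overhead per step. -/

/-- The data types of the language. -/
inductive Ty : Type
  | bool : Ty
  | nat : Ty
  | real : Ty
  | prod : Ty → Ty → Ty
  | list : Ty → Ty

/-- The values of a data type. -/
@[reducible] def Ty.Val : Ty → Type
  | .bool => Bool
  | .nat => ℕ
  | .real => ℝ
  | .prod a b => a.Val × b.Val
  | .list a => List a.Val

/-- Programs with an input of the first type and an output of the second. -/
inductive Prog : Ty → Ty → Type
  | id {a : Ty} : Prog a a
  | comp {a b c : Ty} : Prog a b → Prog b c → Prog a c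
  | pair {a b c : Ty} : Prog a b → Prog a c → Prog a (.prod b c)
  | fst {a b : Ty} : Prog (.prod a b) a
  | snd {a b : Ty} : Prog (.prod a b) b
  | boolConst {a : Ty} : Bool → Prog a .bool
  | ite {a b : Ty} : Prog a .bool → Prog a b → Prog a b → Prog a b
  | natConst {a : Ty} : ℕ → Prog a .nat
  | natAdd : Prog (.prod .nat .nat) .nat
  | natSub : Prog (.prod .nat .nat) .nat
  | natLt : Prog (.prod .nat .nat) .bool
  | realZero {a : Ty} : Prog a .real
  | realOne {a : Ty} : Prog a .real
  | realAdd : Prog (.prod .real .real) .real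
  | realSub : Prog (.prod .real .real) .real
  | realMul : Prog (.prod .real .real) .real
  | realDiv : Prog (.prod .real .real) .real
  | realSqrt : Prog .real .real
  | realLt : Prog (.prod .real .real) .bool
  | nil {a b : Ty} : Prog a (.list b)
  | cons {a : Ty} : Prog (.prod a (.list a)) (.list a)
  /-- case distinction on a list, with an environment of type `c` -/
  | listCase {a b c : Ty} : Prog c b → Prog (.prod (.prod a (.list a)) c) b →
      Prog (.prod (.list a) c) b
  /-- left fold over a list -/
  | foldl {a b : Ty} : Prog (.prod b a) b → Prog (.prod b (.list a)) b
  /-- a loop with a given number of rounds -/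
  | iter {a : Ty} : Prog a a → Prog (.prod .nat a) a

/-- The output of a program. -/
def Prog.eval : {a b : Ty} → Prog a b → a.Val → b.Val
  | _, _, .id, x => x
  | _, _, .comp f g, x => g.eval (f.eval x)
  | _, _, .pair f g, x => (f.eval x, g.eval x)
  | _, _, .fst, x => x.1
  | _, _, .snd, x => x.2
  | _, _, .boolConst b, _ => b
  | _, _, .ite c t e, x => bif c.eval x then t.eval x else e.eval x
  | _, _, .natConst k, _ => k
  | _, _, .natAdd, x => x.1 + x.2
  | _, _, .natSub, x => x.1 - x.2
  | _, _, .natLt, x => decide (x.1 < x.2)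
  | _, _, .realZero, _ => (0 : ℝ)
  | _, _, .realOne, _ => (1 : ℝ)
  | _, _, .realAdd, x => x.1 + x.2
  | _, _, .realSub, x => x.1 - x.2
  | _, _, .realMul, x => x.1 * x.2
  | _, _, .realDiv, x => x.1 / x.2
  | _, _, .realSqrt, x => Real.sqrt x
  | _, _, .realLt, x => decide (x.1 < x.2)
  | _, _, .nil, _ => []
  | _, _, .cons, x => x.1 :: x.2
  | _, _, .listCase f g, x =>
      match x.1 with
      | [] => f.eval x.2
      | h :: t => g.eval ((h, t), x.2)
  | _, _, .foldl f, x => x.2.foldl (fun s h => f.eval (s, h)) x.1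
  | _, _, .iter f, x => f.eval^[x.1] x.2

/-- The number of steps of a left fold with body `f`, where one round takes `c + 1` steps. -/
def foldCost {α β : Type} (f : β → α → β) (c : β → α → ℕ) : β → List α → ℕ
  | _, [] => 1
  | s, h :: t => c s h + 1 + foldCost f c (f s h) t

/-- The number of steps that a program takes on a given input. -/
def Prog.steps : {a b : Ty} → Prog a b → a.Val → ℕ
  | _, _, .comp f g, x => f.steps x + g.steps (f.eval x) + 1
  | _, _, .pair f g, x => f.steps x + g.steps x + 1
  | _, _, .ite c t e, x => c.steps x + (bif c.eval x then t.steps x else e.steps x) + 1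
  | _, _, .listCase f g, x =>
      match x.1 with
      | [] => f.steps x.2 + 1
      | h :: t => g.steps ((h, t), x.2) + 1
  | _, _, .foldl f, x => foldCost (fun s h => f.eval (s, h)) (fun s h => f.steps (s, h)) x.1 x.2
  | _, _, .iter f, x => (∑ j ∈ Finset.range x.1, (f.steps (f.eval^[j] x.2) + 1)) + 1
  | _, _, _, _ => 1

/-! ### Input and output of the classical part -/

/-- The number of qubits, the list of the Pauli terms (each a coefficient together with the list of
the pairs of bits of its symplectic representation), and the coefficients of the polynomial. -/
abbrev inputTy : Ty :=
  .prod .nat (.prod (.list (.prod .real (.list (.prod .bool .bool)))) (.list .real))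

/-- A complex number as the pair of its real and imaginary parts. -/
abbrev complexTy : Ty := .prod .real .real

/-- Controls, target and the four matrix entries of a gate. -/
abbrev gateTy : Ty :=
  .prod (.list .nat)
    (.prod .nat (.prod (.prod complexTy complexTy) (.prod complexTy complexTy)))

/-- The number of ancillas and three circuits. -/
abbrev outputTy : Ty :=
  .prod .nat (.prod (.list gateTy) (.prod (.list gateTy) (.list gateTy)))

/-- The input that describes `H` and the coefficients `a₀, …, a_l` of `P`. -/
def encodeInput {n m : ℕ} (H : PauliHamiltonian n m) (l : ℕ) (P : Polynomial ℝ) : inputTy.Val :=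
  (n,
    List.ofFn fun i : Fin m =>
      (H.coeff i, List.ofFn fun q : Fin n =>
        (decide (H.symp i (Sum.inl q) = 1), decide (H.symp i (Sum.inr q) = 1))),
    List.ofFn fun j : Fin (l + 1) => P.coeff j)

/-- The consecutive numbering of the qubits: first `A`, then `B`, `C` and the ancillas. -/
def wireNum {n m k : ℕ} : Wire n m k → ℕ
  | .inl i => i
  | .inr (.inl (.inl i)) => m + i
  | .inr (.inl (.inr i)) => m + n + i
  | .inr (.inr i) => m + n + n + i

/-- A complex number as output data. -/
def encodeComplex (z : ℂ) : complexTy.Val := (z.re, z.im)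

/-- A gate as output data. -/
def encodeGate {n m k : ℕ} (g : Gate (Wire n m k)) : gateTy.Val :=
  (g.ctrl.map wireNum, wireNum g.target,
    ((encodeComplex (g.U 0 0), encodeComplex (g.U 0 1)),
      (encodeComplex (g.U 1 0), encodeComplex (g.U 1 1))))

/-- The output that describes `k` ancillas and three circuits. -/
def encodeOutput {n m k : ℕ} (C₀ C₁ C₂ : List (Gate (Wire n m k))) : outputTy.Val :=
  (k, C₀.map encodeGate, C₁.map encodeGate, C₂.map encodeGate)

/-- The total running time on the given input: the steps of the classical program, the qubits to be
initialized, the gates of the three circuits, and the oracle call. -/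
def totalTime {n m k : ℕ} (p : Prog inputTy outputTy) (H : PauliHamiltonian n m) (l : ℕ)
    (P : Polynomial ℝ) (C₀ C₁ C₂ : List (Gate (Wire n m k))) : ℕ :=
  p.steps (encodeInput H l P) + Fintype.card (Wire n m k) +
    (C₀.length + C₁.length + C₂.length) + 1

end HDQI

end

noncomputable section

namespace HDQI

/-! Reordering words in the Pauli terms turns multiplication by `H` into an operator `totalOp` on
the free vector space over the strings `y`, the signs `insSign` recording the anticommutations. The
unnormalized reference state is the polynomial in `totalOp` applied to the zero string
(`sum_totalOp_pow`), and the linear map `evalMap`, which sends a string to its ordered product,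
sends this vector to the polynomial in `H` (`polyOp_eq`). Ordered products may be linearly dependent
as matrices; the free space does not see this.

Preparation. The components of the anticommutation graph contribute commuting summands to `totalOp`.
If `T` is the sum over the components treated so far and `C` a further one, then `(C + T)^t / t!` is
the sum over `u` of `C^u / u!` times `T^(t-u) / (t-u)!`. So only the `l + 1` vectors `T^t |0⟩ / t!`
with `t ≤ l` have to be remembered: the reference state is a matrix product state of bond dimension
`l + 1`. The construction keeps a circuit, fed with a particle in one of several modes, and a real
matrix with one column per mode, such that combining the outputs of the circuit with the entries of
row `t` gives `T^t |0⟩ / t!` (`combo`). A component of size `r` multiplies the number of modes by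
`2^r`, one block for each of its subsets; `emit` writes the subset to the wires of the component and
`conv` multiplies the generating polynomials. Plane rotations of the columns make the matrix
triangular, so that `l + 1` modes suffice again, and three gates per rotation keep the combinations
unchanged (`combo_rotStep`, `combo_compStep`). At the end the single row that combines the powers
with the coefficients of the polynomial is rotated into one mode, and the surviving entry is the
norm (`prepCircuit_spec`, `prepGates_spec`).

From the reference state to `ρ`. The operator `Z^α X^β` is encoded by the basis state `|α, β⟩` of
`BC`. Controlled multiplications attach to `|y⟩` the syndrome together with exactly the phase of the
ordered product (`run_codeGates`); the oracle erases `y`; Hadamard and controlled `X` gates replace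
the label by the matrix entries (`run_bellGates_bcv`). The final state is the vectorization of a
multiple of the Hermitian matrix `P(H)`, so the partial trace is a multiple of `P(H)²`
(`reducedB_of_matrix`), and the multiple is fixed by unitarity (`trace_final`). The string `0` is
outside the promise of the oracle; it is replaced by a unit vector under a flag, which is cleared
afterwards because no other string of weight at most `l` has syndrome `0` (`syndrome_ne_zero`). For
`l = 0` there is no promise at all, but `ρ` is maximally mixed, and maximally entangling all
registers with ancillas makes the output independent of the oracle (`reducedB_bell`).

Running time. The combinators `Cpt` build one program together with a polynomial bound in `n + m +
(l + 1) 2^M`, where `M` is the largest component size; `time_bound` converts this into the required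
form. -/

/-! ### Polynomially bounded quantities and computability in polynomial time -/

/-- `f` is bounded by a polynomial in the size `sz`. -/
def PolyBdd {ι : Type} (sz f : ι → ℕ) : Prop := ∃ K, ∀ i, f i ≤ (sz i + 2) ^ K

namespace PolyBdd

variable {ι κ : Type} {sz f g : ι → ℕ}

theorem mono (hg : PolyBdd sz g) (h : ∀ i, f i ≤ g i) : PolyBdd sz f :=
  hg.imp fun _ hK i => (h i).trans (hK i)

theorem const (c : ℕ) : PolyBdd sz fun _ => c :=
  ⟨c, fun i => (Nat.lt_two_pow_self).le.trans (Nat.pow_le_pow_left (by omega) c)⟩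

theorem self : PolyBdd sz sz := ⟨1, fun i => by simp⟩

theorem mul (hf : PolyBdd sz f) (hg : PolyBdd sz g) : PolyBdd sz fun i => f i * g i := by
  obtain ⟨K, hK⟩ := hf
  obtain ⟨K', hK'⟩ := hg
  exact ⟨K + K', fun i => by rw [pow_add]; exact Nat.mul_le_mul (hK i) (hK' i)⟩

theorem add (hf : PolyBdd sz f) (hg : PolyBdd sz g) : PolyBdd sz fun i => f i + g i := by
  obtain ⟨K, hK⟩ := hf
  obtain ⟨K', hK'⟩ := hg
  refine ⟨max K K' + 1, fun i => ?_⟩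
  have h1 := (hK i).trans (Nat.pow_le_pow_right (by omega) (le_max_left K K'))
  have h2 := (hK' i).trans (Nat.pow_le_pow_right (by omega) (le_max_right K K'))
  have h3 : (sz i + 2) ^ max K K' * 2 ≤ (sz i + 2) ^ max K K' * (sz i + 2) :=
    Nat.mul_le_mul_left _ (by omega)
  beta_reduce
  rw [pow_succ]
  omega

theorem pow (hf : PolyBdd sz f) (c : ℕ) : PolyBdd sz fun i => f i ^ c := by
  induction c with
  | zero => simpa using const 1
  | succ c ih => simpa only [pow_succ] using ih.mul hf

theorem comap (hf : PolyBdd sz f) (π : κ → ι) :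
    PolyBdd (fun k => sz (π k)) fun k => f (π k) :=
  hf.imp fun _ hK k => hK (π k)

end PolyBdd

/-- All lists in a value have length at most `N`, and all natural numbers in it are at most `N`. -/
def Ty.Bdd : (b : Ty) → ℕ → b.Val → Prop
  | .bool, _, _ => True
  | .nat, N, x => x ≤ N
  | .real, _, _ => True
  | .prod a b, N, x => a.Bdd N x.1 ∧ b.Bdd N x.2
  | .list a, N, x => x.length ≤ N ∧ ∀ y ∈ x, a.Bdd N y

theorem Ty.Bdd.mono : ∀ {b : Ty} {N N' : ℕ} {x : b.Val}, b.Bdd N x → N ≤ N' → b.Bdd N' x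
  | .bool, _, _, _, _, _ => trivial
  | .nat, _, _, _, h, hN => le_trans h hN
  | .real, _, _, _, _, _ => trivial
  | .prod _ _, _, _, _, h, hN => ⟨h.1.mono hN, h.2.mono hN⟩
  | .list _, _, _, _, h, hN => ⟨h.1.trans hN, fun y hy => (h.2 y hy).mono hN⟩

/-- From the data `e i` a program computes `g i` within a number of steps that is polynomial in the
size of the instance `i`, and the lists and numbers in `g i` are polynomially bounded. -/
def Cpt {ι : Type} (sz : ι → ℕ) {a : Ty} (e : ι → a.Val) (b : Ty) (g : ι → b.Val) : Prop :=
  ∃ (p : Prog a b) (S : ι → ℕ), PolyBdd sz S ∧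
    ∀ i, p.eval (e i) = g i ∧ p.steps (e i) ≤ S i ∧ b.Bdd (S i) (g i)

namespace Cpt

variable {ι κ : Type} {sz : ι → ℕ} {E : Ty} {e : ι → E.Val} {A B D : Ty}

theorem bdd {g : ι → B.Val} (h : Cpt sz e B g) : ∃ S, PolyBdd sz S ∧ ∀ i, B.Bdd (S i) (g i) :=
  let ⟨_, S, hS, h⟩ := h
  ⟨S, hS, fun i => (h i).2.2⟩

theorem length_bdd {g : ι → List A.Val} (h : Cpt sz e (.list A) g) :
    PolyBdd sz fun i => (g i).length :=
  let ⟨_, hS, h⟩ := h.bdd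
  hS.mono fun i => (h i).1

theorem nat_bdd {g : ι → ℕ} (h : Cpt sz e .nat g) : PolyBdd sz g :=
  let ⟨_, hS, h⟩ := h.bdd
  hS.mono fun i => h i

theorem congr {g g' : ι → B.Val} (h : Cpt sz e B g) (hg : ∀ i, g i = g' i) : Cpt sz e B g' :=
  (funext hg : g = g') ▸ h

/-- If `g i` can be computed from `e i`, it can be computed from any data containing `e i`. -/
theorem reindex {g : ι → B.Val} (h : Cpt sz e B g) (π : κ → ι) {E' : Ty} {e' : κ → E'.Val}
    (p : Prog E' E) (c : ℕ) (hp : ∀ k, p.eval (e' k) = e (π k) ∧ p.steps (e' k) ≤ c) :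
    Cpt (fun k => sz (π k)) e' B fun k => g (π k) := by
  obtain ⟨q, S, hS, hq⟩ := h
  refine ⟨.comp p q, fun k => c + S (π k) + 1,
    (((PolyBdd.const c).add (hS.comap π)).add (.const 1)), fun k => ?_⟩
  refine ⟨by simp only [Prog.eval, hp, hq], ?_, (hq (π k)).2.2.mono (by beta_reduce; omega)⟩
  simp only [Prog.steps, (hp k).1]
  have := (hp k).2
  have := (hq (π k)).2.1
  omega

/-- Inside a loop the data are the loop variable paired with the outer data. This moves an outer
quantity one level inwards; nested loops use it repeatedly. -/
theorem up {X : Ty} {g : ι → B.Val} (h : Cpt sz e B g) {π : κ → ι} {x : κ → X.Val} :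
    Cpt (fun k => sz (π k)) (a := .prod X E) (fun k => (x k, e (π k))) B fun k => g (π k) :=
  h.reindex π .snd 1 fun _ => ⟨rfl, le_rfl⟩

/-- The output of a program that takes a bounded number of steps. -/
theorem of_prog {g : ι → A.Val} (h : Cpt sz e A g) (p : Prog A B) {g' : ι → B.Val}
    {S : ι → ℕ} (hS : PolyBdd sz S)
    (hp : ∀ i, p.eval (g i) = g' i ∧ p.steps (g i) ≤ S i ∧ B.Bdd (S i) (g' i)) :
    Cpt sz e B g' := by
  obtain ⟨q, T, hT, hq⟩ := h
  refine ⟨.comp q p, fun i => T i + S i + 1, (hT.add hS).add (.const 1), fun i => ⟨?_, ?_, ?_⟩⟩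
  · simp only [Prog.eval, hq, hp]
  · simp only [Prog.steps, (hq i).1]
    have := (hq i).2.1
    have := (hp i).2.1
    omega
  · exact (hp i).2.2.mono (by beta_reduce; omega)

theorem fst {g : ι → (Ty.prod A B).Val} (h : Cpt sz e (.prod A B) g) :
    Cpt sz e A fun i => (g i).1 := by
  obtain ⟨S, hS, hb⟩ := h.bdd
  exact h.of_prog .fst (hS.add (.const 1)) fun i =>
    ⟨rfl, by simp [Prog.steps], (hb i).1.mono (by omega)⟩

theorem snd {g : ι → (Ty.prod A B).Val} (h : Cpt sz e (.prod A B) g) :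
    Cpt sz e B fun i => (g i).2 := by
  obtain ⟨S, hS, hb⟩ := h.bdd
  exact h.of_prog .snd (hS.add (.const 1)) fun i =>
    ⟨rfl, by simp [Prog.steps], (hb i).2.mono (by omega)⟩

theorem pair {g : ι → A.Val} {g' : ι → B.Val} (h : Cpt sz e A g) (h' : Cpt sz e B g') :
    Cpt sz e (.prod A B) fun i => (g i, g' i) := by
  obtain ⟨p, S, hS, hp⟩ := h
  obtain ⟨q, T, hT, hq⟩ := h'
  refine ⟨.pair p q, fun i => S i + T i + 1, (hS.add hT).add (.const 1), fun i => ⟨?_, ?_, ?_, ?_⟩⟩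
  · simp only [Prog.eval, hp, hq]
  · simp only [Prog.steps]
    have := (hp i).2.1
    have := (hq i).2.1
    omega
  · exact (hp i).2.2.mono (by beta_reduce; omega)
  · exact (hq i).2.2.mono (by beta_reduce; omega)

theorem const_of_prog (p : Prog E B) (v : B.Val) (N : ℕ) (hv : B.Bdd N v)
    (hp : ∀ x, p.eval x = v ∧ p.steps x ≤ N) : Cpt sz e B fun _ => v :=
  ⟨p, fun _ => N, .const N, fun _ => ⟨(hp _).1, (hp _).2, hv⟩⟩

theorem nat (k : ℕ) : Cpt sz e .nat fun _ => k :=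
  const_of_prog (.natConst k) k (k + 1) (Nat.le_succ k) fun _ => ⟨rfl, by simp [Prog.steps]⟩

theorem bool (k : Bool) : Cpt sz e .bool fun _ => k :=
  const_of_prog (.boolConst k) k 1 trivial fun _ => ⟨rfl, by simp [Prog.steps]⟩

theorem zero : Cpt sz e .real fun _ => (0 : ℝ) :=
  const_of_prog .realZero (0 : ℝ) 1 trivial fun _ => ⟨rfl, by simp [Prog.steps]⟩

theorem one : Cpt sz e .real fun _ => (1 : ℝ) :=
  const_of_prog .realOne (1 : ℝ) 1 trivial fun _ => ⟨rfl, by simp [Prog.steps]⟩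

theorem nil (A : Ty) : Cpt sz e (.list A) fun _ => ([] : List A.Val) :=
  const_of_prog .nil ([] : List A.Val) 1 (by simp [Ty.Bdd]) fun _ => ⟨rfl, by simp [Prog.steps]⟩

theorem cons {g : ι → A.Val} {L : ι → List A.Val} (h : Cpt sz e A g) (hL : Cpt sz e (.list A) L) :
    Cpt sz e (.list A) fun i => g i :: L i := by
  obtain ⟨S, hS, hb⟩ := (h.pair hL).bdd
  refine (h.pair hL).of_prog .cons (hS.add (.const 1)) fun i => ⟨rfl, by simp [Prog.steps], ?_, ?_⟩
  · have := (hb i).2.1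
    simp only [List.length_cons]
    simp only at this
    omega
  · intro y hy
    rcases List.mem_cons.1 hy with rfl | hy
    · exact (hb i).1.mono (by omega)
    · exact ((hb i).2.2 y hy).mono (by omega)

theorem add {f g : ι → ℕ} (hf : Cpt sz e .nat f) (hg : Cpt sz e .nat g) :
    Cpt sz e .nat fun i => f i + g i :=
  (hf.pair hg).of_prog .natAdd ((hf.nat_bdd.add hg.nat_bdd).add (.const 1)) fun i =>
    ⟨rfl, by simp [Prog.steps], Nat.le_succ _⟩

theorem sub {f g : ι → ℕ} (hf : Cpt sz e .nat f) (hg : Cpt sz e .nat g) :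
    Cpt sz e .nat fun i => f i - g i :=
  (hf.pair hg).of_prog .natSub (hf.nat_bdd.add (.const 1)) fun _ =>
    ⟨rfl, by simp [Prog.steps], (Nat.sub_le _ _).trans (Nat.le_succ _)⟩

theorem lt {f g : ι → ℕ} (hf : Cpt sz e .nat f) (hg : Cpt sz e .nat g) :
    Cpt sz e .bool fun i => decide (f i < g i) :=
  (hf.pair hg).of_prog .natLt (.const 1) fun i => ⟨rfl, by simp [Prog.steps], trivial⟩

theorem radd {f g : ι → ℝ} (hf : Cpt sz e .real f) (hg : Cpt sz e .real g) :
    Cpt sz e .real fun i => f i + g i :=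
  (hf.pair hg).of_prog .realAdd (.const 1) fun i => ⟨rfl, by simp [Prog.steps], trivial⟩

theorem rsub {f g : ι → ℝ} (hf : Cpt sz e .real f) (hg : Cpt sz e .real g) :
    Cpt sz e .real fun i => f i - g i :=
  (hf.pair hg).of_prog .realSub (.const 1) fun i => ⟨rfl, by simp [Prog.steps], trivial⟩

theorem rmul {f g : ι → ℝ} (hf : Cpt sz e .real f) (hg : Cpt sz e .real g) :
    Cpt sz e .real fun i => f i * g i :=
  (hf.pair hg).of_prog .realMul (.const 1) fun i => ⟨rfl, by simp [Prog.steps], trivial⟩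

theorem rdiv {f g : ι → ℝ} (hf : Cpt sz e .real f) (hg : Cpt sz e .real g) :
    Cpt sz e .real fun i => f i / g i :=
  (hf.pair hg).of_prog .realDiv (.const 1) fun i => ⟨rfl, by simp [Prog.steps], trivial⟩

theorem rneg {f : ι → ℝ} (hf : Cpt sz e .real f) : Cpt sz e .real fun i => -f i :=
  (zero.rsub hf).congr fun i => zero_sub (f i)

theorem sqrt {f : ι → ℝ} (hf : Cpt sz e .real f) : Cpt sz e .real fun i => Real.sqrt (f i) :=
  hf.of_prog .realSqrt (.const 1) fun i => ⟨rfl, by simp [Prog.steps], trivial⟩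

open Classical in
theorem rlt {f g : ι → ℝ} (hf : Cpt sz e .real f) (hg : Cpt sz e .real g) :
    Cpt sz e .bool fun i => decide (f i < g i) :=
  (hf.pair hg).of_prog .realLt (.const 1) fun i =>
    ⟨by simp only [Prog.eval], by simp [Prog.steps], trivial⟩

theorem cond {c : ι → Bool} {f g : ι → B.Val} (hc : Cpt sz e .bool c) (hf : Cpt sz e B f)
    (hg : Cpt sz e B g) : Cpt sz e B fun i => bif c i then f i else g i := by
  obtain ⟨pc, S, hS, hpc⟩ := hc
  obtain ⟨p, T, hT, hp⟩ := hf
  obtain ⟨q, U, hU, hq⟩ := hg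
  refine ⟨.ite pc p q, fun i => S i + (T i + U i) + 1, (hS.add (hT.add hU)).add (.const 1),
    fun i => ?_⟩
  have h1 := (hpc i).2.1
  have h2 := (hp i).2.1
  have h3 := (hq i).2.1
  refine ⟨?_, ?_, ?_⟩
  · simp only [Prog.eval, hpc, hp, hq]
  · simp only [Prog.steps, (hpc i).1]
    cases c i <;> simp only [cond_true, cond_false] <;> omega
  · have h4 : B.Bdd (S i + (T i + U i) + 1) (f i) := (hp i).2.2.mono (by omega)
    have h5 : B.Bdd (S i + (T i + U i) + 1) (g i) := (hq i).2.2.mono (by omega)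
    beta_reduce
    cases c i
    · exact h5
    · exact h4

theorem ite {P : ι → Prop} [∀ i, Decidable (P i)] {f g : ι → B.Val}
    (hc : Cpt sz e .bool fun i => decide (P i)) (hf : Cpt sz e B f) (hg : Cpt sz e B g) :
    Cpt sz e B fun i => if P i then f i else g i :=
  (hc.cond hf hg).congr fun i => by by_cases h : P i <;> simp [h]

theorem and {P Q : ι → Prop} [∀ i, Decidable (P i)] [∀ i, Decidable (Q i)]
    (hP : Cpt sz e .bool fun i => decide (P i)) (hQ : Cpt sz e .bool fun i => decide (Q i)) :
    Cpt sz e .bool fun i => decide (P i ∧ Q i) :=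
  (hP.cond hQ (bool false)).congr fun i => by by_cases h : P i <;> simp [h]

theorem not {P : ι → Prop} [∀ i, Decidable (P i)]
    (hP : Cpt sz e .bool fun i => decide (P i)) : Cpt sz e .bool fun i => decide (¬ P i) :=
  (hP.cond (bool false) (bool true)).congr fun i => by by_cases h : P i <;> simp [h]

theorem iff {P Q : ι → Prop} [∀ i, Decidable (P i)] [∀ i, Decidable (Q i)]
    (hP : Cpt sz e .bool fun i => decide (P i)) (hQ : Cpt sz e .bool fun i => decide (Q i)) :
    Cpt sz e .bool fun i => decide (P i ↔ Q i) :=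
  (hP.cond hQ hQ.not).congr fun i => by by_cases h : P i <;> simp [h]

theorem isTrue {c : ι → Bool} (hc : Cpt sz e .bool c) :
    Cpt sz e .bool fun i => decide (c i = true) :=
  hc.congr fun i => by simp

theorem eq {f g : ι → ℕ} (hf : Cpt sz e .nat f) (hg : Cpt sz e .nat g) :
    Cpt sz e .bool fun i => decide (f i = g i) :=
  ((hf.lt hg).not.and (hg.lt hf).not).congr fun i =>
    decide_eq_decide.2 (by omega)

end Cpt

/-! ### Loops: folds, maps, ranges and list access. -/

/-- The instances on which the body of a left fold is run. -/
structure FoldIdx {ι : Type} {S A : Ty} (L : ι → List A.Val) (Inv : ι → ℕ → S.Val → Prop) where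
  i : ι
  j : ℕ
  s : S.Val
  a : A.Val
  lt : j < (L i).length
  inv : Inv i j s
  mem : a ∈ L i

/-- The instances on which a function is applied to an element of a list. -/
structure MapIdx {ι : Type} {A : Ty} (L : ι → List A.Val) where
  i : ι
  a : A.Val
  mem : a ∈ L i

namespace Cpt

variable {ι κ : Type} {sz : ι → ℕ} {E : Ty} {e : ι → E.Val} {A B D S : Ty}

/-- The body is treated as a computation over all loop states that satisfy `Inv`, so one program and
one exponent serve every round. The invariant has to bound the states independently of the body,
since iterated polynomial growth need not be polynomial. The premise `body` takes the computability
of the loop variables as arguments, so that applications read like ordinary functions. -/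
theorem foldl {g0 : ι → S.Val} {L : ι → List A.Val} (F : ι → S.Val → A.Val → S.Val)
    (Inv : ι → ℕ → S.Val → Prop) (h0 : Cpt sz e S g0) (hL : Cpt sz e (.list A) L)
    (inv0 : ∀ i, Inv i 0 (g0 i))
    (step : ∀ i j s a, j < (L i).length → a ∈ L i → Inv i j s → Inv i (j + 1) (F i s a))
    {T : ι → ℕ} (hT : PolyBdd sz T) (bdd : ∀ i j s, j ≤ (L i).length → Inv i j s → S.Bdd (T i) s)
    (body : Cpt (fun t : FoldIdx L Inv => sz t.i) (a := .prod (.prod S A) E)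
        (fun t => ((t.s, t.a), e t.i)) S (fun t => t.s) →
      Cpt (fun t : FoldIdx L Inv => sz t.i) (a := .prod (.prod S A) E)
        (fun t => ((t.s, t.a), e t.i)) A (fun t => t.a) →
      Cpt (fun t : FoldIdx L Inv => sz t.i) (a := .prod (.prod S A) E)
        (fun t => ((t.s, t.a), e t.i)) S (fun t => F t.i t.s t.a)) :
    Cpt sz e S fun i => (L i).foldl (F i) (g0 i) := by
  obtain ⟨UL, hUL, hbL⟩ := hL.bdd
  have hs := body
    ⟨.comp .fst .fst, fun t => T t.i + 3, ((hT.add (.const 3)).comap FoldIdx.i), fun t =>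
      ⟨rfl, by simp [Prog.steps], (bdd t.i t.j t.s t.lt.le t.inv).mono (by beta_reduce; omega)⟩⟩
    ⟨.comp .fst .snd, fun t => UL t.i + 3, ((hUL.add (.const 3)).comap FoldIdx.i), fun t =>
      ⟨rfl, by simp [Prog.steps], ((hbL t.i).2 t.a t.mem).mono (by beta_reduce; omega)⟩⟩
  -- The size of a loop instance is that of the outer instance `t.i`, so `K` does not depend on the
  -- round.
  obtain ⟨pb, Sb, ⟨K, hK⟩, hb⟩ := hs
  obtain ⟨p0, S0, hS0, hp0⟩ := h0
  obtain ⟨pL, SL, hSL, hpL⟩ := hL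
  -- The body of a fold sees only state and element; the environment is therefore carried along in
  -- the state.
  let q : Prog (.prod (.prod S E) A) (.prod S E) :=
    .pair (.comp (.pair (.pair (.comp .fst .fst) .snd) (.comp .fst .snd)) pb) (.comp .fst .snd)
  -- The constant 20 covers the fixed overhead of `q` and the step charged per round.
  have key : ∀ i (L' : List A.Val) j s, (∀ a ∈ L', a ∈ L i) → j + L'.length = (L i).length →
      Inv i j s →
      L'.foldl (fun s h => q.eval (s, h)) (s, e i) = (L'.foldl (F i) s, e i) ∧
      foldCost (fun s h => q.eval (s, h)) (fun s h => q.steps (s, h)) (s, e i) L' ≤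
        L'.length * ((sz i + 2) ^ K + 20) + 1 ∧ Inv i (L i).length (L'.foldl (F i) s) := by
    intro i L'
    induction L' with
    | nil =>
      intro j s _ hj hi
      simp only [List.length_nil, add_zero] at hj
      exact ⟨rfl, by simp [foldCost], hj ▸ hi⟩
    | cons a L' ih =>
      intro j s hm hj hi
      simp only [List.length_cons] at hj
      have ha := hm a (by simp)
      have hbt := hb ⟨i, j, s, a, by omega, hi, ha⟩
      have hq : q.eval ((s, e i), a) = (F i s a, e i) := by
        simp only [q, Prog.eval]
        exact congrArg (·, e i) hbt.1
      have hc : q.steps ((s, e i), a) ≤ (sz i + 2) ^ K + 19 := by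
        have h2 := hbt.2.1.trans (hK ⟨i, j, s, a, by omega, hi, ha⟩)
        simp only [q, Prog.steps, Prog.eval]
        simp only at h2
        omega
      obtain ⟨h1, h2, h3⟩ := ih (j + 1) (F i s a) (fun a ha => hm a (by simp [ha])) (by omega)
        (step i j s a (by omega) ha hi)
      refine ⟨?_, ?_, h3⟩
      · simp only [List.foldl_cons]
        rw [hq, h1]
      · simp only [foldCost, List.length_cons]
        rw [hq]
        rw [Nat.succ_mul]
        omega
  refine ⟨.comp (.pair (.pair p0 .id) pL) (.comp (.foldl q) .fst),
    fun i => S0 i + SL i + (UL i * ((sz i + 2) ^ K + 20) + 1) + T i + 20,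
    ?_, fun i => ?_⟩
  · exact (((hS0.add hSL).add ((hUL.mul ((((PolyBdd.self).add (.const 2)).pow K).add
      (.const 20))).add (.const 1))).add hT).add (.const 20)
  · obtain ⟨h1, h2, h3⟩ := key i (L i) 0 (g0 i) (fun _ h => h) (by simp) (inv0 i)
    have h4 := (hp0 i).2.1
    have h5 := (hpL i).2.1
    have h6 : (L i).length * ((sz i + 2) ^ K + 20) ≤ UL i * ((sz i + 2) ^ K + 20) :=
      Nat.mul_le_mul_right _ (hbL i).1
    refine ⟨?_, ?_, (bdd _ _ _ le_rfl h3).mono (by beta_reduce; omega)⟩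
    · simp only [Prog.eval, hp0, hpL, h1]
    · simp only [Prog.eval, Prog.steps, (hp0 i).1, (hpL i).1]
      omega

/-- Folds whose states need no bound. -/
theorem foldl' {g0 : ι → S.Val} {L : ι → List A.Val} (F : ι → S.Val → A.Val → S.Val)
    (h0 : Cpt sz e S g0) (hL : Cpt sz e (.list A) L) (bdd : ∀ s, S.Bdd 0 s)
    (body : Cpt (fun t : FoldIdx L (fun _ _ (_ : S.Val) => True) => sz t.i)
        (a := .prod (.prod S A) E) (fun t => ((t.s, t.a), e t.i)) S (fun t => t.s) →
      Cpt (fun t : FoldIdx L (fun _ _ (_ : S.Val) => True) => sz t.i)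
        (a := .prod (.prod S A) E) (fun t => ((t.s, t.a), e t.i)) A (fun t => t.a) →
      Cpt (fun t : FoldIdx L (fun _ _ (_ : S.Val) => True) => sz t.i)
        (a := .prod (.prod S A) E) (fun t => ((t.s, t.a), e t.i)) S (fun t => F t.i t.s t.a)) :
    Cpt sz e S fun i => (L i).foldl (F i) (g0 i) :=
  foldl F (fun _ _ _ => True) h0 hL (fun _ => trivial) (fun _ _ _ _ _ _ _ => trivial)
    (.const 0) (fun _ _ s _ _ => bdd s) body

theorem reverse {L : ι → List A.Val} (hL : Cpt sz e (.list A) L) :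
    Cpt sz e (.list A) fun i => (L i).reverse := by
  obtain ⟨U, hU, hb⟩ := hL.bdd
  refine (foldl (S := .list A) (fun _ s a => a :: s)
    (fun i j s => s.length = j ∧ ∀ a ∈ s, a ∈ L i) (nil A) hL (fun i => by simp) ?_ hU ?_ ?_).congr
    fun i => ?_
  · rintro i j s a - ha ⟨rfl, h2⟩
    exact ⟨rfl, fun b hb => (List.mem_cons.1 hb).elim (· ▸ ha) (h2 b)⟩
  · rintro i j s hj ⟨rfl, h2⟩
    exact ⟨hj.trans (hb i).1, fun a ha => (hb i).2 a (h2 a ha)⟩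
  · exact fun hs ha => ha.cons hs
  · simp

theorem append {L M : ι → List A.Val} (hL : Cpt sz e (.list A) L) (hM : Cpt sz e (.list A) M) :
    Cpt sz e (.list A) fun i => L i ++ M i := by
  obtain ⟨U, hU, hb⟩ := hL.reverse.bdd
  obtain ⟨V, hV, hc⟩ := hM.bdd
  refine (foldl (S := .list A) (fun _ s a => a :: s)
    (fun i j s => s.length = j + (M i).length ∧ ∀ a ∈ s, a ∈ (L i).reverse ∨ a ∈ M i) hM hL.reverse
    (fun i => ⟨by simp, fun a ha => .inr ha⟩) ?_ (hU.add hV) ?_ ?_).congr fun i => ?_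
  · rintro i j s a - ha ⟨h1, h2⟩
    refine ⟨by simp [h1]; omega, fun b hb => (List.mem_cons.1 hb).elim (· ▸ .inl ha) (h2 b)⟩
  · rintro i j s hj ⟨h1, h2⟩
    have h3 := (hb i).1
    have h4 := (hc i).1
    refine ⟨by omega, fun a ha => ?_⟩
    rcases h2 a ha with h | h
    · exact ((hb i).2 a h).mono (by omega)
    · exact ((hc i).2 a h).mono (by omega)
  · exact fun hs ha => ha.cons hs
  · simp

theorem map {L : ι → List A.Val} (f : ι → A.Val → B.Val) (hL : Cpt sz e (.list A) L)
    (body : Cpt (fun t : MapIdx L => sz t.i) (a := .prod A E) (fun t => (t.a, e t.i)) A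
        (fun t => t.a) →
      Cpt (fun t : MapIdx L => sz t.i) (a := .prod A E) (fun t => (t.a, e t.i)) B
        (fun t => f t.i t.a)) :
    Cpt sz e (.list B) fun i => (L i).map (f i) := by
  obtain ⟨U, hU, hb⟩ := hL.bdd
  have hbody := body ⟨.fst, fun t => U t.i + 1, ((hU.add (.const 1)).comap MapIdx.i), fun t =>
      ⟨rfl, by simp [Prog.steps], ((hb t.i).2 t.a t.mem).mono (by beta_reduce; omega)⟩⟩
  -- `W` may depend on the list element, whereas the invariant of the fold needs a bound depending
  -- on `i` only; the power of the size is such a bound.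
  obtain ⟨W, ⟨K, hK⟩, hW⟩ := hbody.bdd
  have hpow : PolyBdd sz fun i => (sz i + 2) ^ K := ((PolyBdd.self).add (.const 2)).pow K
  have h := foldl (S := .list B) (fun i s a => f i a :: s)
    (fun i j s => s.length = j ∧ ∀ b ∈ s, B.Bdd ((sz i + 2) ^ K) b) (nil B) hL
    (fun i => by simp) ?_ (hU.add hpow) ?_ ?_
  · refine h.reverse.congr fun i => ?_
    have : ∀ (l : List A.Val) (s : List B.Val),
        l.foldl (fun s a => f i a :: s) s = (l.map (f i)).reverse ++ s := by
      intro l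
      induction l with
      | nil => simp
      | cons a l ih => simp [ih]
    simp [this]
  · rintro i j s a - ha ⟨rfl, h2⟩
    refine ⟨rfl, fun b hb => (List.mem_cons.1 hb).elim (fun h => ?_) (h2 b)⟩
    rw [h]
    exact (hW ⟨i, a, ha⟩).mono (hK ⟨i, a, ha⟩)
  · rintro i j s hj ⟨rfl, h2⟩
    exact ⟨(hj.trans (hb i).1).trans (by omega), fun a ha => (h2 a ha).mono (by omega)⟩
  · intro hs ha
    refine .cons ?_ hs
    exact hbody.reindex (κ := FoldIdx L _) (fun t => ⟨t.i, t.a, t.mem⟩)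
      (.pair (.comp .fst .snd) .snd) 5 fun t => ⟨rfl, by simp [Prog.steps]⟩

theorem length {L : ι → List A.Val} (hL : Cpt sz e (.list A) L) :
    Cpt sz e .nat fun i => (L i).length := by
  refine (foldl (S := .nat) (fun _ s _ => s + 1) (fun i j s => s = j) (nat 0) hL (fun i => rfl) ?_
    hL.length_bdd ?_ ?_).congr fun i => ?_
  · rintro i j s a - - rfl
    rfl
  · rintro i j s hj rfl
    exact hj
  · exact fun hs _ => hs.add (nat 1)
  · have : ∀ (l : List A.Val) (s : ℕ), l.foldl (fun s _ => s + 1) s = s + l.length := by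
      intro l
      induction l with
      | nil => simp
      | cons a l ih => intro s; simp only [List.foldl_cons, ih, List.length_cons]; omega
    simp [this]

/-- The loop counts down from `N` and prepends, so the list comes out increasing. -/
theorem range {N : ι → ℕ} (hN : Cpt sz e .nat N) : Cpt sz e (.list .nat) fun i => List.range (N i) := by
  let q : Prog (.prod .nat (.list .nat)) (.prod .nat (.list .nat)) :=
    .pair (.comp (.pair .fst (.natConst 1)) .natSub)
      (.comp (.pair (.comp (.pair .fst (.natConst 1)) .natSub) .snd) .cons)
  have hq : ∀ (k j : ℕ), q.eval^[j] (k + j, List.map (k + j + ·) []) =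
      (k, (List.range j).map (k + ·)) := by
    intro k j
    induction j generalizing k with
    | zero => simp
    | succ j ih =>
      rw [Function.iterate_succ_apply', show k + (j + 1) = k + 1 + j by ring]
      have := ih (k + 1)
      simp only [List.map_nil] at this ⊢
      rw [this]
      simp only [q, Prog.eval, Nat.add_sub_cancel]
      rw [List.range_succ_eq_map]
      simp [List.map_map, Function.comp_def, Nat.add_assoc, Nat.add_comm 1]
  refine hN.of_prog (.comp (.pair .id (.pair .id .nil)) (.comp (.iter q) .snd))
    (S := fun i => N i * 16 + 15) ((hN.nat_bdd.mul (.const 16)).add (.const 15)) fun i => ⟨?_, ?_, ?_⟩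
  · have := hq 0 (N i)
    simp only [List.map_nil, Nat.zero_add] at this
    simp only [Prog.eval, this]
    simp
  · have h2 : ∀ x, q.steps x = 15 := fun _ => by simp [q, Prog.steps]
    simp only [Prog.steps, Prog.eval, h2]
    simp
    omega
  · refine ⟨by simp; omega, fun y hy => ?_⟩
    have := List.mem_range.1 hy
    exact (Nat.le_of_lt this).trans (by omega)

/-- The tail is taken `j` times. The tail of the empty list is empty, so an index out of range ends
in the default branch. -/
theorem getD {L : ι → List A.Val} {j : ι → ℕ} {d : ι → A.Val} (hL : Cpt sz e (.list A) L)
    (hj : Cpt sz e .nat j) (hd : Cpt sz e A d) : Cpt sz e A fun i => (L i).getD (j i) (d i) := by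
  let tl : Prog (.list A) (.list A) :=
    .comp (.pair .id .id) (.listCase .nil (.comp .fst .snd))
  have htl : ∀ (k : ℕ) (l : List A.Val), tl.eval^[k] l = l.drop k := by
    intro k
    induction k with
    | zero => simp
    | succ k ih =>
      intro l
      rw [Function.iterate_succ_apply]
      cases l with
      | nil => simpa [tl, Prog.eval] using ih []
      | cons a l => simpa [tl, Prog.eval] using ih l
  have htls : ∀ l, tl.steps l ≤ 9 := by
    intro l
    cases l <;> simp [tl, Prog.steps, Prog.eval]
  let p : Prog (.prod (.prod .nat (.list A)) A) A :=
    .comp (.pair (.comp .fst (.iter tl)) .snd) (.listCase .id (.comp .fst .fst))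
  obtain ⟨U, hU, hbL⟩ := hL.bdd
  obtain ⟨V, hV, hbd⟩ := hd.bdd
  refine ((hj.pair hL).pair hd).of_prog p (S := fun i => j i * 10 + U i + V i + 20)
    ((((hj.nat_bdd.mul (.const 10)).add hU).add hV).add (.const 20)) fun i => ⟨?_, ?_, ?_⟩
  · simp only [p, Prog.eval, htl]
    rw [List.getD_eq_getElem?_getD, ← List.head?_drop]
    cases (L i).drop (j i) <;> simp
  · have h1 : ∑ k ∈ Finset.range (j i), (tl.steps (tl.eval^[k] (L i)) + 1) ≤ j i * 10 := by
      refine (Finset.sum_le_card_nsmul _ _ 10 fun k _ => ?_).trans (by simp)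
      have := htls (tl.eval^[k] (L i))
      omega
    simp only [p, Prog.steps, Prog.eval, htl] at h1 ⊢
    generalize List.drop (j i) (L i) = l
    cases l <;> simp only <;> omega
  · rw [List.getD_eq_getElem?_getD]
    cases h : (L i)[j i]? with
    | none => exact (hbd i).mono (by omega)
    | some a => exact ((hbL i).2 a (List.mem_of_getElem? h)).mono (by omega)

end Cpt

/-! ### Derived operations: list comprehension, finite sums and products, multiplication of natural
numbers. -/

namespace Cpt

variable {ι κ : Type} {sz : ι → ℕ} {E : Ty} {e : ι → E.Val} {A B D S : Ty}

theorem flatMap {L : ι → List A.Val} (f : ι → A.Val → List B.Val) (hL : Cpt sz e (.list A) L)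
    (body : Cpt (fun t : MapIdx L => sz t.i) (a := .prod A E) (fun t => (t.a, e t.i)) A
        (fun t => t.a) →
      Cpt (fun t : MapIdx L => sz t.i) (a := .prod A E) (fun t => (t.a, e t.i)) (.list B)
        (fun t => f t.i t.a)) :
    Cpt sz e (.list B) fun i => (L i).flatMap (f i) := by
  have hM := hL.map (B := .list B) f body
  obtain ⟨U, hU, hb⟩ := hM.reverse.bdd
  have h := foldl (S := .list B) (fun _ s a => a ++ s)
    (fun i j s => s.length ≤ j * U i ∧ ∀ b ∈ s, B.Bdd (U i) b) (nil B) hM.reverse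
    (fun i => by simp) ?_ ((hM.reverse.length_bdd.mul hU).add hU) ?_ ?_
  · refine h.congr fun i => ?_
    have : ∀ (l : List (List B.Val)) (s : List B.Val),
        l.foldl (fun s a => a ++ s) s = l.reverse.flatten ++ s := by
      intro l
      induction l with
      | nil => simp
      | cons a l ih => simp [ih]
    simp [this, List.flatMap]
  · rintro i j s a - ha ⟨h1, h2⟩
    have h3 := (hb i).2 a ha
    refine ⟨?_, fun b hb => (List.mem_append.1 hb).elim (h3.2 b) (h2 b)⟩
    rw [List.length_append, Nat.succ_mul]
    have := h3.1
    omega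
  · rintro i j s hj ⟨h1, h2⟩
    refine ⟨h1.trans ?_, fun b hb => (h2 b hb).mono (by omega)⟩
    exact (Nat.mul_le_mul_right _ hj).trans (Nat.le_add_right _ _)
  · exact fun hs ha => ha.append hs

theorem filter {L : ι → List A.Val} (P : ι → A.Val → Prop) [∀ i a, Decidable (P i a)]
    (hL : Cpt sz e (.list A) L)
    (body : Cpt (fun t : MapIdx L => sz t.i) (a := .prod A E) (fun t => (t.a, e t.i)) A
        (fun t => t.a) →
      Cpt (fun t : MapIdx L => sz t.i) (a := .prod A E) (fun t => (t.a, e t.i)) .bool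
        (fun t => decide (P t.i t.a))) :
    Cpt sz e (.list A) fun i => (L i).filter fun a => P i a := by
  refine (flatMap (fun i a => if P i a then [a] else []) hL fun ha =>
    (body ha).ite (ha.cons (nil A)) (nil A)).congr fun i => ?_
  induction L i with
  | nil => simp
  | cons a l ih => by_cases h : P i a <;> simp [h, ih]

theorem listSum {L : ι → List ℝ} (hL : Cpt sz e (.list .real) L) :
    Cpt sz e .real fun i => (L i).sum :=
  (foldl' (S := .real) (fun _ s a => s + a) zero hL (fun _ => trivial) fun hs ha =>
    hs.radd ha).congr fun _ => List.sum_eq_foldl.symm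

theorem listProd {L : ι → List ℝ} (hL : Cpt sz e (.list .real) L) :
    Cpt sz e .real fun i => (L i).prod :=
  (foldl' (S := .real) (fun _ s a => s * a) one hL (fun _ => trivial) fun hs ha =>
    hs.rmul ha).congr fun _ => List.prod_eq_foldl.symm

theorem all {L : ι → List A.Val} (P : ι → A.Val → Prop) [∀ i a, Decidable (P i a)]
    [∀ i, Decidable (∀ a ∈ L i, P i a)] (hL : Cpt sz e (.list A) L)
    (body : Cpt (fun t : MapIdx L => sz t.i) (a := .prod A E) (fun t => (t.a, e t.i)) A
        (fun t => t.a) →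
      Cpt (fun t : MapIdx L => sz t.i) (a := .prod A E) (fun t => (t.a, e t.i)) .bool
        (fun t => decide (P t.i t.a))) :
    Cpt sz e .bool fun i => decide (∀ a ∈ L i, P i a) := by
  refine (foldl' (S := .bool) (fun _ s a => _root_.cond s a false) (bool true)
    (hL.map (B := .bool) (fun i a => decide (P i a)) body) (fun _ => trivial)
    fun hs ha => hs.cond ha (bool false)).congr fun i => ?_
  have : ∀ (l : List A.Val) (s : Bool), (l.map fun a => decide (P i a)).foldl
      (fun s a => _root_.cond s a false) s = (s && l.all fun a => P i a) := by
    intro l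
    induction l with
    | nil => simp
    | cons a l ih => intro s; rw [List.map_cons, List.foldl_cons, ih]; cases s <;> simp
  rw [this, Bool.true_and, Bool.eq_iff_iff]
  simp

theorem mem {L : ι → List ℕ} {x : ι → ℕ} (hL : Cpt sz e (.list .nat) L) (hx : Cpt sz e .nat x) :
    Cpt sz e .bool fun i => decide (x i ∈ L i) :=
  (all (A := .nat) (fun i a => ¬ x i = a) hL fun ha => (hx.up.eq ha).not).not.congr fun i => by
    simp

theorem sumRange {N : ι → ℕ} (f : ι → ℕ → ℝ) (hN : Cpt sz e .nat N)
    (body : Cpt (fun t : MapIdx (A := .nat) (fun i => List.range (N i)) => sz t.i) (a := .prod .nat E)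
        (fun t => (t.a, e t.i)) .nat (fun t => t.a) →
      Cpt (fun t : MapIdx (A := .nat) (fun i => List.range (N i)) => sz t.i) (a := .prod .nat E)
        (fun t => (t.a, e t.i)) .real (fun t => f t.i t.a)) :
    Cpt sz e .real fun i => ∑ j ∈ Finset.range (N i), f i j :=
  (hN.range.map (B := .real) f body).listSum.congr fun i => by
    rw [← List.sum_toFinset _ List.nodup_range, List.toFinset_range]

theorem prodRange {N : ι → ℕ} (f : ι → ℕ → ℝ) (hN : Cpt sz e .nat N)
    (body : Cpt (fun t : MapIdx (A := .nat) (fun i => List.range (N i)) => sz t.i) (a := .prod .nat E)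
        (fun t => (t.a, e t.i)) .nat (fun t => t.a) →
      Cpt (fun t : MapIdx (A := .nat) (fun i => List.range (N i)) => sz t.i) (a := .prod .nat E)
        (fun t => (t.a, e t.i)) .real (fun t => f t.i t.a)) :
    Cpt sz e .real fun i => ∏ j ∈ Finset.range (N i), f i j :=
  (hN.range.map (B := .real) f body).listProd.congr fun i => by
    rw [← List.prod_toFinset _ List.nodup_range, List.toFinset_range]

theorem natCast {N : ι → ℕ} (hN : Cpt sz e .nat N) : Cpt sz e .real fun i => ((N i : ℕ) : ℝ) :=
  (sumRange (fun _ _ => 1) hN fun _ => one).congr fun i => by simp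

/-- Natural numbers can only be added, so the product is obtained as the length of a list; this is
affordable because both values, not merely their digits, are polynomially bounded. -/
theorem mul {f g : ι → ℕ} (hf : Cpt sz e .nat f) (hg : Cpt sz e .nat g) :
    Cpt sz e .nat fun i => f i * g i :=
  (hf.range.flatMap (B := .nat) (fun i _ => List.range (g i)) fun _ => hg.up.range).length.congr
    fun i => by simp [List.length_flatMap]

/-- Repeated doubling. The bound `h` on the final value also bounds all intermediate ones. -/
theorem two_pow {f : ι → ℕ} (hf : Cpt sz e .nat f) (h : PolyBdd sz fun i => 2 ^ f i) :
    Cpt sz e .nat fun i => 2 ^ f i := by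
  refine (foldl (S := .nat) (fun _ s _ => s + s) (fun _ j s => s = 2 ^ j) (nat 1) hf.range
    (fun _ => rfl) (fun i j s _ _ _ hs => ?_) h (fun i j s hj hs => ?_)
    fun hs _ => hs.add hs).congr fun i => ?_
  · rw [hs, pow_succ]; ring
  · rw [hs]
    exact Nat.pow_le_pow_right (by omega) (by simpa using hj)
  · have : ∀ n : ℕ, (List.range n).foldl (fun s _ => s + s) 1 = 2 ^ n := by
      intro n
      induction n with
      | zero => rfl
      | succ n ih => rw [List.range_succ, List.foldl_append, ih, pow_succ]; simp; ring
    exact this (f i)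

end Cpt

/-! ### Circuits on numbered wires -/

/-- Contents of all numbered wires. -/
abbrev Cfg : Type := ℕ → ZMod 2

/-- States of the numbered wires. -/
abbrev Sta : Type := Cfg →₀ ℂ

/-- The basis state with contents `x`. -/
def ket (x : Cfg) : Sta := Finsupp.single x 1

/-- The translation of the basis states by `v`. -/
def shift (v : Cfg) : Sta →ₗ[ℂ] Sta := Finsupp.lmapDomain ℂ ℂ fun x => x + v

@[simp] theorem shift_ket (v x : Cfg) : shift v (ket x) = ket (x + v) := by
  simp [shift, ket, Finsupp.mapDomain_single]

theorem sta_hom_ext {M : Type*} [AddCommMonoid M] [Module ℂ M] {f g : Sta →ₗ[ℂ] M}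
    (h : ∀ x, f (ket x) = g (ket x)) : f = g :=
  Finsupp.lhom_ext' fun x => LinearMap.ext_ring (h x)

theorem shift_shift (v w : Cfg) (ψ : Sta) : shift v (shift w ψ) = shift (w + v) ψ := by
  have : shift v ∘ₗ shift w = shift (w + v) := sta_hom_ext fun x => by simp [add_assoc]
  exact LinearMap.congr_fun this ψ

@[simp] theorem shift_zero (ψ : Sta) : shift 0 ψ = ψ := by
  have : shift 0 = LinearMap.id := sta_hom_ext fun x => by simp
  exact LinearMap.congr_fun this ψ

/-- A gate as output data. -/
abbrev RawGate : Type :=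
  List ℕ × ℕ × ((ℝ × ℝ) × (ℝ × ℝ)) × ((ℝ × ℝ) × (ℝ × ℝ))

/-- A complex number given as output data. -/
def decodeComplex (z : ℝ × ℝ) : ℂ := ⟨z.1, z.2⟩

@[simp] theorem decodeComplex_real (a : ℝ) : decodeComplex (a, 0) = a := rfl

/-- The single-qubit operator of a gate. -/
def RawGate.U (g : RawGate) : Matrix (ZMod 2) (ZMod 2) ℂ :=
  Matrix.of fun a b =>
    if a = 0 then if b = 0 then decodeComplex g.2.2.1.1 else decodeComplex g.2.2.1.2
    else if b = 0 then decodeComplex g.2.2.2.1 else decodeComplex g.2.2.2.2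

/-- The action of a gate on the states of the numbered wires. -/
def act (g : RawGate) : Sta →ₗ[ℂ] Sta :=
  Finsupp.linearCombination ℂ fun x : Cfg =>
    if ∀ c ∈ g.1, x c = 1 then ∑ b, RawGate.U g b (x g.2.1) • ket (Function.update x g.2.1 b)
    else ket x

theorem act_ket (g : RawGate) (x : Cfg) :
    act g (ket x) = if ∀ c ∈ g.1, x c = 1 then
      ∑ b, RawGate.U g b (x g.2.1) • ket (Function.update x g.2.1 b) else ket x := by
  simp [act, ket]

/-- The action of a circuit; the first gate of the list is applied first. -/
def run : List RawGate → Sta →ₗ[ℂ] Sta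
  | [] => LinearMap.id
  | g :: C => run C ∘ₗ act g

@[simp] theorem run_nil (ψ : Sta) : run [] ψ = ψ := rfl

@[simp] theorem run_cons (g : RawGate) (C : List RawGate) (ψ : Sta) :
    run (g :: C) ψ = run C (act g ψ) := rfl

@[simp] theorem run_append (C D : List RawGate) (ψ : Sta) :
    run (C ++ D) ψ = run D (run C ψ) := by
  induction C generalizing ψ with
  | nil => rfl
  | cons g C ih => simp [ih]

/-- The gate does not use the wires on which `v` is nonzero. -/
def Avoids (g : RawGate) (v : Cfg) : Prop := (∀ c ∈ g.1, v c = 0) ∧ v g.2.1 = 0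

/-- A gate reads and changes only its own wires, so translating the others commutes with it. This
lets bits already written to the wires of a component pass through the rest of the circuit. -/
theorem act_shift {g : RawGate} {v : Cfg} (h : Avoids g v) (ψ : Sta) :
    act g (shift v ψ) = shift v (act g ψ) := by
  have : act g ∘ₗ shift v = shift v ∘ₗ act g := sta_hom_ext fun x => by
    simp only [LinearMap.comp_apply, shift_ket, act_ket]
    have h1 : (∀ c ∈ g.1, (x + v) c = 1) ↔ ∀ c ∈ g.1, x c = 1 :=
      forall₂_congr fun c hc => by simp [h.1 c hc]
    rw [if_congr h1 rfl rfl]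
    split_ifs
    · simp only [map_sum, map_smul, shift_ket]
      refine Finset.sum_congr rfl fun b _ => ?_
      congr 2
      · simp [h.2]
      · funext w
        by_cases hw : w = g.2.1
        · subst hw; simp [h.2]
        · simp [hw]
    · simp
  exact LinearMap.congr_fun this ψ

theorem run_shift {C : List RawGate} {v : Cfg} (h : ∀ g ∈ C, Avoids g v) (ψ : Sta) :
    run C (shift v ψ) = shift v (run C ψ) := by
  induction C generalizing ψ with
  | nil => rfl
  | cons g C ih =>
    rw [run_cons, act_shift (h g (by simp)), ih (fun g' hg' => h g' (by simp [hg'])), run_cons]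

/-- The controlled `X` gate. -/
def rX (cs : List ℕ) (t : ℕ) : RawGate := (cs, t, ((0, 0), (1, 0)), ((1, 0), (0, 0)))

theorem zmod_two_cases (a : ZMod 2) : a = 0 ∨ a = 1 := by
  revert a; decide

theorem sum_zmod_two {M : Type*} [AddCommMonoid M] (f : ZMod 2 → M) : ∑ b, f b = f 0 + f 1 :=
  Fin.sum_univ_two f

/-- The product of the control bits is `1` exactly when all of them are, which makes a controlled
`X` a translation without case distinction. -/
theorem act_rX (cs : List ℕ) (t : ℕ) (x : Cfg) :
    act (rX cs t) (ket x) = ket (x + Pi.single t ((cs.map x).prod)) := by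
  rw [act_ket]
  by_cases h : ∀ c ∈ (rX cs t).1, x c = 1
  · rw [if_pos h]
    have h1 : (cs.map x).prod = 1 := by
      refine List.prod_eq_one fun a ha => ?_
      obtain ⟨c, hc, rfl⟩ := List.mem_map.1 ha
      exact h c hc
    rw [h1, sum_zmod_two]
    have h2 : ∀ b, Function.update x t b = x + Pi.single t (x t + b) := fun b => by
      funext w
      by_cases hw : w = t
      · subst hw
        simp [← add_assoc, CharTwo.add_self_eq_zero]
      · simp [hw]
    have h3 : (rX cs t).2.1 = t := rfl
    rw [h3]
    rcases zmod_two_cases (x t) with h0 | h0 <;>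
      simp [h0, RawGate.U, rX, h2, CharTwo.add_self_eq_zero]
  · rw [if_neg h]
    have h1 : (cs.map x).prod = 0 := by
      push Not at h
      obtain ⟨c, hc, hx⟩ := h
      refine List.prod_eq_zero (List.mem_map.2 ⟨c, hc, ?_⟩)
      exact (zmod_two_cases (x c)).resolve_right hx
    simp [h1]

/-! ### Transport to the registers of the algorithm -/

section

variable {n m k : ℕ}

theorem wireNum_lt (w : Wire n m k) : wireNum w < m + n + n + k := by
  rcases w with i | (i | i) | i <;> simp only [wireNum] <;> have := i.2 <;> omega

theorem wireNum_injective : Function.Injective (wireNum : Wire n m k → ℕ) := by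
  rintro (i | (i | i) | i) (j | (j | j) | j) h <;> simp only [wireNum] at h <;>
    have := i.2 <;> have := j.2 <;> first | omega | (congr; apply Fin.ext; omega)

theorem exists_wireNum {w : ℕ} (h : w < m + n + n + k) : ∃ v : Wire n m k, wireNum v = w := by
  by_cases h1 : w < m
  · exact ⟨.inl ⟨w, h1⟩, rfl⟩
  by_cases h2 : w < m + n
  · exact ⟨.inr (.inl (.inl ⟨w - m, by omega⟩)), by simp only [wireNum]; omega⟩
  by_cases h3 : w < m + n + n
  · exact ⟨.inr (.inl (.inr ⟨w - (m + n), by omega⟩)), by simp only [wireNum]; omega⟩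
  · exact ⟨.inr (.inr ⟨w - (m + n + n), by omega⟩), by simp only [wireNum]; omega⟩

/-- The contents of the wires of the algorithm. -/
def restrict (x : Cfg) : Wire n m k → ZMod 2 := fun w => x (wireNum w)

/-- The state of the registers of the algorithm given by a state of the numbered wires. -/
def toState : Sta →ₗ[ℂ] ((Wire n m k → ZMod 2) → ℂ) :=
  Finsupp.linearCombination ℂ fun x => Pi.single (restrict x) 1

@[simp] theorem toState_ket (x : Cfg) :
    (toState (ket x) : (Wire n m k → ZMod 2) → ℂ) = Pi.single (restrict x) 1 := by
  simp [toState, ket]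

/-- A well-formed gate on the first `N` wires. -/
structure Valid (N : ℕ) (g : RawGate) : Prop where
  length : g.1.length ≤ 2
  ctrl : ∀ c ∈ g.1, c < N
  target : g.2.1 < N
  notMem : g.2.1 ∉ g.1
  unitary : RawGate.U g ∈ Matrix.unitaryGroup (ZMod 2) ℂ

/-- The program emits gates on numbered wires, while the theorem speaks of gates on the registers.
For valid gates both have the same encoding, and `toState` intertwines their actions. -/
theorem exists_gate {g : RawGate} (hg : Valid (m + n + n + k) g) :
    ∃ G : Gate (Wire n m k), encodeGate G = g ∧
      ∀ ψ, G.matrix.mulVec (toState ψ) = toState (act g ψ) := by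
  obtain ⟨t, ht⟩ := exists_wireNum hg.target
  have : ∃ cs : List (Wire n m k), cs.map wireNum = g.1 := by
    have h := hg.ctrl
    generalize g.1 = l at h
    induction l with
    | nil => exact ⟨[], rfl⟩
    | cons c l ih =>
      obtain ⟨cs, hcs⟩ := ih fun c hc => h c (by simp [hc])
      obtain ⟨v, hv⟩ := exists_wireNum (h c (by simp))
      exact ⟨v :: cs, by simp [hcs, hv]⟩
  obtain ⟨cs, hcs⟩ := this
  have hmem : ∀ {v : Wire n m k}, v ∈ cs ↔ wireNum v ∈ g.1 := fun {v} => by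
    rw [← hcs, List.mem_map_of_injective wireNum_injective]
  let G : Gate (Wire n m k) := ⟨cs, t, RawGate.U g, by
    have := hg.length
    rw [← hcs] at this
    simpa using this, by rw [hmem, ht]; exact hg.notMem, hg.unitary⟩
  refine ⟨G, ?_, fun ψ => ?_⟩
  · obtain ⟨l, t', ⟨⟨a1, a2⟩, b1, b2⟩, ⟨c1, c2⟩, d1, d2⟩ := g
    simp only [encodeGate, G, hcs, ht, RawGate.U, encodeComplex, decodeComplex]
    simp
  · have : Matrix.mulVecLin G.matrix ∘ₗ toState = toState ∘ₗ act g := sta_hom_ext fun x => by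
      simp only [LinearMap.comp_apply, toState_ket, Matrix.mulVecLin_apply, Matrix.mulVec_single_one,
        act_ket]
      have h1 : (∀ c ∈ g.1, x c = 1) ↔ ∀ c ∈ cs, restrict x c = 1 := by
        rw [← hcs]; simp only [List.forall_mem_map, restrict]
      rw [if_congr h1 rfl rfl]
      funext z
      simp only [Matrix.col_apply, Gate.matrix, Matrix.of_apply]
      have h2 : ∀ b, (restrict (Function.update x g.2.1 b) : Wire n m k → ZMod 2) =
          Function.update (restrict x) t b := fun b => by
        funext w
        by_cases hw : w = t
        · subst hw; simp [restrict, ht]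
        · have : wireNum w ≠ g.2.1 := fun h => hw (wireNum_injective (h.trans ht.symm))
          simp [restrict, this, hw]
      have h3 : (restrict x : Wire n m k → ZMod 2) t = x g.2.1 := by simp [restrict, ht]
      by_cases hz : ∀ w, w ≠ t → z w = restrict x w
      · rw [if_pos hz]
        have h4 : ∀ b, z = Function.update (restrict x) t b ↔ z t = b := fun b =>
          ⟨fun h => by rw [h]; simp, fun h => funext fun w => by
            by_cases hw : w = t
            · subst hw; simp [h]
            · simp [hw, hz w hw]⟩
        split_ifs with hc h5
        · simp only [map_sum, map_smul, toState_ket, h2, Finset.sum_apply, Pi.smul_apply,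
            Pi.single_apply, h4, smul_eq_mul, mul_ite, mul_one, mul_zero, Finset.sum_ite_eq,
            Finset.mem_univ, if_true, G, h3]
        · rw [toState_ket, Pi.single_apply, if_pos]
          simpa using (h4 (restrict x t)).2 h5
        · rw [toState_ket, Pi.single_apply, if_neg]
          rintro rfl
          exact h5 rfl
      · rw [if_neg hz]
        push Not at hz
        obtain ⟨w, hw, hz⟩ := hz
        split_ifs
        · simp only [map_sum, map_smul, toState_ket, h2, Finset.sum_apply, Pi.smul_apply,
            Pi.single_apply]
          refine (Finset.sum_eq_zero fun b _ => ?_).symm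
          rw [if_neg, smul_zero]
          rintro rfl
          simp [hw] at hz
        · rw [toState_ket, Pi.single_apply, if_neg]
          rintro rfl
          exact hz rfl
    exact LinearMap.congr_fun this ψ

theorem circuitMatrix_eq {ω : Type} [Fintype ω] [DecidableEq ω] (C : List (Gate ω))
    (M : Matrix (ω → ZMod 2) (ω → ZMod 2) ℂ) :
    C.foldl (fun M g => g.matrix * M) M = circuitMatrix C * M := by
  induction C generalizing M with
  | nil => simp [circuitMatrix]
  | cons g C ih =>
    simp only [circuitMatrix, List.foldl_cons] at ih ⊢
    rw [ih, ih (g.matrix * 1), Matrix.mul_one, Matrix.mul_assoc]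

theorem exists_circuit (C : List RawGate) (hC : ∀ g ∈ C, Valid (m + n + n + k) g) :
    ∃ C' : List (Gate (Wire n m k)), C'.map encodeGate = C ∧
      ∀ ψ, (circuitMatrix C').mulVec (toState ψ) = toState (run C ψ) := by
  induction C with
  | nil => exact ⟨[], rfl, fun ψ => by simp [circuitMatrix]⟩
  | cons g C ih =>
    obtain ⟨C', h1, h2⟩ := ih fun g hg => hC g (by simp [hg])
    obtain ⟨G, h3, h4⟩ := exists_gate (hC g (by simp))
    refine ⟨G :: C', by simp [h1, h3], fun ψ => ?_⟩
    have : circuitMatrix (G :: C') = circuitMatrix C' * G.matrix := by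
      rw [circuitMatrix, List.foldl_cons, circuitMatrix_eq, Matrix.mul_one]
    rw [this, ← Matrix.mulVec_mulVec, h4, h2, run_cons]

theorem Gate.matrix_mem_unitaryGroup {ω : Type} [Fintype ω] [DecidableEq ω] (g : Gate ω) :
    g.matrix ∈ Matrix.unitaryGroup (ω → ZMod 2) ℂ := by
  rw [Matrix.mem_unitaryGroup_iff]
  ext x z
  rw [Matrix.mul_apply]
  simp only [Matrix.star_apply]
  have hU := g.unitary
  rw [Matrix.mem_unitaryGroup_iff] at hU
  -- Row `x` of the gate vanishes except at configurations that agree with `x` away from the target,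
  -- so the sum reduces to the two values of the target.
  have key : ∀ f : (ω → ZMod 2) → ℂ, (∀ y, (¬ ∀ w, w ≠ g.target → x w = y w) → f y = 0) →
      ∑ y, f y = ∑ b, f (Function.update x g.target b) := by
    intro f hf
    rw [← Finset.sum_image (s := Finset.univ) (g := fun b => Function.update x g.target b)
      (f := f) fun a _ b _ h => by simpa using congrFun h g.target]
    refine (Finset.sum_subset (Finset.subset_univ _) fun y _ hy => hf y fun h => hy ?_).symm
    refine Finset.mem_image.2 ⟨y g.target, Finset.mem_univ _, funext fun w => ?_⟩
    by_cases hw : w = g.target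
    · subst hw; simp
    · simp [hw, h w hw]
  rw [key _ fun y hy => by simp [Gate.matrix, hy]]
  have hne : ∀ c ∈ g.ctrl, c ≠ g.target := fun c hc h => g.target_notMem (h ▸ hc)
  have h1 : ∀ b, (∀ c ∈ g.ctrl, Function.update x g.target b c = 1) ↔ ∀ c ∈ g.ctrl, x c = 1 :=
    fun b => forall₂_congr fun c hc => by simp [hne c hc]
  have h2 : ∀ b, (∀ w, w ≠ g.target → x w = Function.update x g.target b w) :=
    fun b w hw => by simp [hw]
  have h3 : ∀ b, (∀ w, w ≠ g.target → z w = Function.update x g.target b w) ↔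
      ∀ w, w ≠ g.target → z w = x w := fun b => forall₂_congr fun w hw => by simp [hw]
  simp only [Gate.matrix, Matrix.of_apply, h1, h3, Function.update_self, if_pos (h2 _)]
  have hxz : (∀ w, w ≠ g.target → z w = x w) → (x = z ↔ x g.target = z g.target) := fun h =>
    ⟨fun h => h ▸ rfl, fun h' => funext fun w => by
      by_cases hw : w = g.target
      · rw [hw, h']
      · exact (h w hw).symm⟩
  by_cases hz : ∀ w, w ≠ g.target → z w = x w
  · simp only [if_pos hz, Matrix.one_apply, hxz hz]
    split_ifs with hc h4 h4
    · have := congrFun (congrFun hU (x g.target)) (z g.target)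
      rw [Matrix.mul_apply, Matrix.one_apply, if_pos h4] at this
      simpa using this
    · have := congrFun (congrFun hU (x g.target)) (z g.target)
      rw [Matrix.mul_apply, Matrix.one_apply, if_neg h4] at this
      simpa using this
    · simp [h4]
    · simp [h4]
  · rw [Matrix.one_apply, if_neg]
    · simp [hz]
    · rintro rfl
      exact hz fun _ _ => rfl

theorem circuitMatrix_mem_unitaryGroup {ω : Type} [Fintype ω] [DecidableEq ω] (C : List (Gate ω)) :
    circuitMatrix C ∈ Matrix.unitaryGroup (ω → ZMod 2) ℂ := by
  induction C with
  | nil => exact one_mem _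
  | cons g C ih =>
    rw [circuitMatrix, List.foldl_cons, circuitMatrix_eq, Matrix.mul_one]
    exact mul_mem ih g.matrix_mem_unitaryGroup

theorem sum_normSq_mulVec {ι : Type} [Fintype ι] [DecidableEq ι] {M : Matrix ι ι ℂ}
    (hM : M ∈ Matrix.unitaryGroup ι ℂ) (ψ : ι → ℂ) :
    ∑ x, Complex.normSq (M.mulVec ψ x) = ∑ x, Complex.normSq (ψ x) := by
  have h : ∀ φ : ι → ℂ, ((∑ x, Complex.normSq (φ x) : ℝ) : ℂ) = dotProduct (star φ) φ := by
    intro φ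
    simp [dotProduct, Complex.normSq_eq_conj_mul_self]
  have : ((∑ x, Complex.normSq (M.mulVec ψ x) : ℝ) : ℂ) = (∑ x, Complex.normSq (ψ x) : ℝ) := by
    rw [h, h, Matrix.star_mulVec, Matrix.dotProduct_mulVec, Matrix.vecMul_vecMul,
      ← Matrix.star_eq_conjTranspose, Matrix.mem_unitaryGroup_iff'.1 hM, Matrix.vecMul_one]
  exact_mod_cast this

end

/-! ### Pauli operators -/

/-- The sign `(-1) ^ a`. -/
def chi (a : ZMod 2) : ℝ := if a = 0 then 1 else -1

@[simp] theorem chi_zero : chi 0 = 1 := rfl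

@[simp] theorem chi_one : chi 1 = -1 := rfl

theorem chi_add (a b : ZMod 2) : chi (a + b) = chi a * chi b := by
  rcases zmod_two_cases a with rfl | rfl <;> rcases zmod_two_cases b with rfl | rfl <;>
    simp [CharTwo.add_self_eq_zero]

theorem chi_sum {ι : Type*} (s : Finset ι) (f : ι → ZMod 2) :
    chi (∑ i ∈ s, f i) = ∏ i ∈ s, chi (f i) := by
  classical
  induction s using Finset.induction_on with
  | empty => simp
  | insert a s ha ih => rw [Finset.sum_insert ha, Finset.prod_insert ha, chi_add, ih]

/-- The nonzero entry of `W(α, β)` in row `x`. -/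
def pauliPhase (α β x : ZMod 2) : ℂ :=
  Complex.I ^ (-((α.val * β.val : ℕ) : ℤ)) * chi (α * x)

theorem val_one_zmod_two : ZMod.val (1 : ZMod 2) = 1 := rfl

theorem pauliW_apply (α β x y : ZMod 2) :
    pauliW α β x y = if y = x + β then pauliPhase α β x else 0 := by
  have h11 : (1 : ZMod 2) + 1 = 0 := rfl
  rcases zmod_two_cases α with rfl | rfl <;> rcases zmod_two_cases β with rfl | rfl <;>
    rcases zmod_two_cases x with rfl | rfl <;> rcases zmod_two_cases y with rfl | rfl <;>
    simp [pauliW, pauliPhase, pauliX, pauliZ, val_one_zmod_two, h11, Matrix.diagonal_mul]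

theorem pauliPhase_comm (α β α' β' x : ZMod 2) :
    pauliPhase α β x * pauliPhase α' β' (x + β) =
      chi (α * β' + α' * β) * (pauliPhase α' β' x * pauliPhase α β (x + β')) := by
  have h11 : (1 : ZMod 2) + 1 = 0 := rfl
  rcases zmod_two_cases α with rfl | rfl <;> rcases zmod_two_cases β with rfl | rfl <;>
    rcases zmod_two_cases α' with rfl | rfl <;> rcases zmod_two_cases β' with rfl | rfl <;>
    rcases zmod_two_cases x with rfl | rfl <;>
    simp [pauliPhase, val_one_zmod_two, h11]

theorem pauliPhase_mul_self (α β x : ZMod 2) :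
    pauliPhase α β x * pauliPhase α β (x + β) = 1 := by
  have h11 : (1 : ZMod 2) + 1 = 0 := rfl
  rcases zmod_two_cases α with rfl | rfl <;> rcases zmod_two_cases β with rfl | rfl <;>
    rcases zmod_two_cases x with rfl | rfl <;>
    simp [pauliPhase, val_one_zmod_two, h11]

theorem star_pauliPhase (α β x : ZMod 2) :
    star (pauliPhase α β (x + β)) = pauliPhase α β x := by
  have h11 : (1 : ZMod 2) + 1 = 0 := rfl
  rcases zmod_two_cases α with rfl | rfl <;> rcases zmod_two_cases β with rfl | rfl <;>
    rcases zmod_two_cases x with rfl | rfl <;>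
    simp [pauliPhase, val_one_zmod_two, h11]

section

variable {n m : ℕ}

/-- The nonzero entry of an `n`-qubit Pauli operator in row `x`. -/
def phase (v : Fin n ⊕ Fin n → ZMod 2) (x : Fin n → ZMod 2) : ℂ :=
  ∏ q, pauliPhase (v (Sum.inl q)) (v (Sum.inr q)) (x q)

/-- The `β`-part of a symplectic vector. -/
def betaPart (v : Fin n ⊕ Fin n → ZMod 2) : Fin n → ZMod 2 := fun q => v (Sum.inr q)

theorem prod_ite_zero_eq {ι : Type*} [Fintype ι] (P : ι → Prop) [DecidablePred P]
    [Decidable (∀ i, P i)] (f : ι → ℂ) :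
    (∏ i, if P i then f i else 0) = if ∀ i, P i then ∏ i, f i else 0 := by
  split_ifs with h
  · exact Finset.prod_congr rfl fun i _ => if_pos (h i)
  · push Not at h
    obtain ⟨i, hi⟩ := h
    exact Finset.prod_eq_zero (Finset.mem_univ i) (if_neg hi)

theorem pauli_apply (v : Fin n ⊕ Fin n → ZMod 2) (x y : Fin n → ZMod 2) :
    pauli v x y = if y = x + betaPart v then phase v x else 0 := by
  simp only [pauli, Matrix.of_apply, pauliW_apply]
  rw [prod_ite_zero_eq]
  exact if_congr (by rw [funext_iff]; rfl) rfl rfl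

theorem pauli_mul_apply {κ : Type*} (v : Fin n ⊕ Fin n → ZMod 2)
    (M : Matrix (Fin n → ZMod 2) κ ℂ) (x : Fin n → ZMod 2) (y : κ) :
    (pauli v * M) x y = phase v x * M (x + betaPart v) y := by
  rw [Matrix.mul_apply]
  simp [pauli_apply]

/-- The sign with which two Pauli operators commute. -/
def sympSign (v w : Fin n ⊕ Fin n → ZMod 2) : ℝ :=
  ∏ q, chi (v (Sum.inl q) * w (Sum.inr q) + w (Sum.inl q) * v (Sum.inr q))

theorem sympSign_eq (v w : Fin n ⊕ Fin n → ZMod 2) : sympSign v w = 1 ∨ sympSign v w = -1 := by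
  rw [sympSign, ← chi_sum]
  unfold chi
  split_ifs <;> simp

theorem pauli_mul_comm (v w : Fin n ⊕ Fin n → ZMod 2) :
    pauli v * pauli w = sympSign v w • (pauli w * pauli v) := by
  ext x y
  rw [Matrix.smul_apply, pauli_mul_apply, pauli_mul_apply, pauli_apply, pauli_apply,
    add_right_comm, mul_ite, mul_ite, mul_zero, mul_zero, smul_ite, smul_zero, Complex.real_smul]
  refine if_congr Iff.rfl ?_ rfl
  rw [phase, phase, phase, phase, sympSign, ← Finset.prod_mul_distrib, ← Finset.prod_mul_distrib,
    Complex.ofReal_prod, ← Finset.prod_mul_distrib]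
  exact Finset.prod_congr rfl fun q _ => pauliPhase_comm _ _ _ _ _

theorem add_self_cfg {ι : Type*} (x : ι → ZMod 2) : x + x = 0 :=
  funext fun i => CharTwo.add_self_eq_zero (x i)

theorem pauli_mul_self (v : Fin n ⊕ Fin n → ZMod 2) : pauli v * pauli v = 1 := by
  ext x y
  rw [pauli_mul_apply, pauli_apply, add_assoc, add_self_cfg, add_zero, Matrix.one_apply, mul_ite,
    mul_zero]
  refine if_congr eq_comm ?_ rfl
  rw [phase, phase, ← Finset.prod_mul_distrib]
  exact Finset.prod_eq_one fun q _ => pauliPhase_mul_self _ _ _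

theorem pauli_conjTranspose (v : Fin n ⊕ Fin n → ZMod 2) : (pauli v).conjTranspose = pauli v := by
  ext x y
  rw [Matrix.conjTranspose_apply, pauli_apply, pauli_apply]
  have h : x = y + betaPart v ↔ y = x + betaPart v := by
    constructor <;> rintro rfl <;> rw [add_assoc, add_self_cfg, add_zero]
  by_cases hy : y = x + betaPart v
  · rw [if_pos (h.2 hy), if_pos hy, hy, phase, star_prod]
    exact Finset.prod_congr rfl fun q _ => star_pauliPhase _ _ _
  · rw [if_neg (mt h.1 hy), if_neg hy, star_zero]

end

/-! ### Ordered products of anticommuting involutions -/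

/-- The unit vector of a wire. -/
abbrev ev (q : ℕ) : Cfg := Pi.single q 1

/-- The sign that arises when the `q`-th generator is moved into the ordered product given by `y`. -/
def insSign (σ : ℕ → ℕ → ℝ) (q : ℕ) (y : Cfg) : ℝ :=
  ∏ j ∈ Finset.range q, if y j = 1 then σ q j else 1

section

variable {R : Type*} [Ring R] (z : ℕ → R)

/-- The ordered product of the generators selected by `y`. -/
def ordProd (N : ℕ) (y : Cfg) : R := ((List.range N).map fun q => z q ^ (y q).val).prod

theorem ordProd_succ (N : ℕ) (y : Cfg) :
    ordProd z (N + 1) y = ordProd z N y * z N ^ (y N).val := by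
  simp [ordProd, List.range_succ]

theorem ordProd_congr {N : ℕ} {y y' : Cfg} (h : ∀ q < N, y q = y' q) :
    ordProd z N y = ordProd z N y' := by
  unfold ordProd
  refine congrArg _ (List.map_congr_left fun q hq => ?_)
  rw [h q (List.mem_range.1 hq)]

variable {z} [Algebra ℝ R] {σ : ℕ → ℕ → ℝ}

theorem mul_ordProd_of_le (hσ : ∀ i j, z i * z j = σ i j • (z j * z i)) {N q : ℕ} (h : N ≤ q)
    (y : Cfg) :
    z q * ordProd z N y =
      (∏ j ∈ Finset.range N, if y j = 1 then σ q j else 1) • (ordProd z N y * z q) := by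
  induction N with
  | zero => simp [ordProd]
  | succ N ih =>
    rw [ordProd_succ, ← mul_assoc, ih (by omega), Finset.prod_range_succ, smul_mul_assoc, mul_assoc]
    rcases zmod_two_cases (y N) with h0 | h0
    · simp [h0]
    · rw [h0, val_one_zmod_two, pow_one, hσ, mul_smul_comm, smul_smul, if_pos rfl, mul_assoc]

/-- The new factor passes those of smaller index, which costs the sign, and meets its own position,
where it creates a factor or cancels one because `z q` is an involution. Addition modulo 2 covers
both cases. -/
theorem mul_ordProd (hz : ∀ i, z i * z i = 1) (hσ : ∀ i j, z i * z j = σ i j • (z j * z i))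
    {N q : ℕ} (h : q < N) (y : Cfg) :
    z q * ordProd z N y = insSign σ q y • ordProd z N (y + ev q) := by
  induction N with
  | zero => omega
  | succ N ih =>
    rw [ordProd_succ, ordProd_succ, ← mul_assoc]
    rcases Nat.lt_succ_iff_lt_or_eq.1 h with h | rfl
    · rw [ih h, smul_mul_assoc]
      simp [ev, h.ne']
    · rw [mul_ordProd_of_le hσ le_rfl, smul_mul_assoc, mul_assoc,
        ordProd_congr z (y' := y + ev q) fun j hj => by simp [hj.ne], insSign]
      congr 2
      rcases zmod_two_cases (y q) with h0 | h0
      · simp [h0, val_one_zmod_two]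
      · have h11 : (1 : ZMod 2) + 1 = 0 := rfl
        simp [h0, val_one_zmod_two, hz, h11]

end

/-- For each `q` the sign is a character of the group of strings; this is why the signs of different
components separate. -/
theorem insSign_add {σ : ℕ → ℕ → ℝ} (h1 : ∀ i j, σ i j * σ i j = 1) (q : ℕ) (y w : Cfg) :
    insSign σ q (y + w) = insSign σ q y * insSign σ q w := by
  rw [insSign, insSign, insSign, ← Finset.prod_mul_distrib]
  refine Finset.prod_congr rfl fun j _ => ?_
  have h11 : (1 : ZMod 2) + 1 = 0 := rfl
  rcases zmod_two_cases (y j) with h | h <;> rcases zmod_two_cases (w j) with h' | h' <;>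
    simp [h, h', h1, h11]

@[simp] theorem insSign_zero (σ : ℕ → ℕ → ℝ) (q : ℕ) : insSign σ q 0 = 1 := by simp [insSign]

theorem insSign_ev (σ : ℕ → ℕ → ℝ) (q j : ℕ) :
    insSign σ q (ev j) = if j < q then σ q j else 1 := by
  rw [insSign]
  split_ifs with h
  · rw [Finset.prod_eq_single j]
    · simp
    · intro b _ hb
      simp [hb]
    · intro h'
      exact absurd (Finset.mem_range.2 h) h'
  · refine Finset.prod_eq_one fun b hb => ?_
    have : b ≠ j := fun hbj => h (hbj ▸ Finset.mem_range.1 hb)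
    simp [this]

/-! ### Multiplication operators on states -/

/-- Multiplication by `c q` times the `q`-th generator, on states that stand for linear combinations
of ordered products. -/
def mulOp (c : ℕ → ℝ) (σ : ℕ → ℕ → ℝ) (q : ℕ) : Sta →ₗ[ℂ] Sta :=
  Finsupp.linearCombination ℂ fun y => ((c q * insSign σ q y : ℝ) : ℂ) • ket (y + ev q)

@[simp] theorem mulOp_ket (c : ℕ → ℝ) (σ : ℕ → ℕ → ℝ) (q : ℕ) (y : Cfg) :
    mulOp c σ q (ket y) = ((c q * insSign σ q y : ℝ) : ℂ) • ket (y + ev q) := by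
  simp [mulOp, ket]

theorem mulOp_commute {c : ℕ → ℝ} {σ : ℕ → ℕ → ℝ} (h1 : ∀ i j, σ i j * σ i j = 1) {i j : ℕ}
    (hij : σ i j = 1) (hji : σ j i = 1) : Commute (mulOp c σ i) (mulOp c σ j) := by
  refine sta_hom_ext fun y => ?_
  simp only [Module.End.mul_apply, mulOp_ket, map_smul, smul_smul, insSign_add h1, insSign_ev, hij,
    hji, ite_self, mul_one]
  rw [add_right_comm, mul_comm]

/-- The sign of a word relative to the ordered product. -/
def wordEps (σ : ℕ → ℕ → ℝ) : List ℕ → ℝ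
  | [] => 1
  | q :: w => insSign σ q ((w.map ev).sum) * wordEps σ w

theorem wordEps_eq {σ : ℕ → ℕ → ℝ} (h1 : ∀ i j, σ i j = 1 ∨ σ i j = -1) (w : List ℕ) :
    wordEps σ w = 1 ∨ wordEps σ w = -1 := by
  have h : ∀ q y, insSign σ q y = 1 ∨ insSign σ q y = -1 := by
    intro q y
    unfold insSign
    refine Finset.prod_induction _ (fun x : ℝ => x = 1 ∨ x = -1) ?_ (.inl rfl) fun j _ => ?_
    · rintro a b (rfl | rfl) (rfl | rfl) <;> simp
    · split_ifs
      · exact h1 q j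
      · exact .inl rfl
  induction w with
  | nil => exact .inl rfl
  | cons q w ih =>
    rcases ih with h' | h' <;> rcases h q (w.map ev).sum with h'' | h'' <;>
      simp [wordEps, h', h'']

theorem prod_word {R : Type*} [Ring R] [Algebra ℝ R] {z : ℕ → R} {σ : ℕ → ℕ → ℝ}
    (hz : ∀ i, z i * z i = 1) (hσ : ∀ i j, z i * z j = σ i j • (z j * z i)) {N : ℕ} (w : List ℕ)
    (hw : ∀ q ∈ w, q < N) :
    (w.map z).prod = wordEps σ w • ordProd z N (w.map ev).sum := by
  induction w with
  | nil => simp [wordEps, ordProd]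
  | cons q w ih =>
    rw [List.map_cons, List.prod_cons, ih fun q hq => hw q (by simp [hq]), mul_smul_comm,
      mul_ordProd hz hσ (hw q (by simp)), smul_smul, wordEps, List.map_cons, List.sum_cons,
      add_comm (ev q), mul_comm]

theorem sum_fin_cons {M : Type*} [AddCommMonoid M] {s : ℕ} {α : Type*} [Fintype α]
    (f : (Fin (s + 1) → α) → M) :
    ∑ π, f π = ∑ i, ∑ π : Fin s → α, f (Fin.cons i π) := by
  rw [← Fintype.sum_prod_type' (f := fun i (π : Fin s → α) => f (Fin.cons i π))]
  exact (Fintype.sum_equiv (Fin.consEquiv fun _ => α) _ _ fun _ => rfl).symm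

/-- Each further application puts one letter in front of the word, which matches the recursion of
`wordEps` on the head. -/
theorem mulOp_pow (c : ℕ → ℝ) (σ : ℕ → ℕ → ℝ) (m s : ℕ) :
    ((∑ q ∈ Finset.range m, mulOp c σ q) ^ s) (ket 0) =
      ∑ π : Fin s → Fin m, (((∏ t, c (π t)) * wordEps σ (List.ofFn fun t => (π t : ℕ)) : ℝ) : ℂ) •
        ket ((List.ofFn fun t => ev (π t)).sum) := by
  induction s with
  | zero => simp [wordEps]
  | succ s ih =>
    rw [pow_succ', Module.End.mul_apply, ih, sum_fin_cons, LinearMap.sum_apply,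
      Finset.sum_range fun q => mulOp c σ q _]
    refine Finset.sum_congr rfl fun i _ => ?_
    rw [map_sum]
    refine Finset.sum_congr rfl fun π _ => ?_
    rw [map_smul, mulOp_ket, smul_smul]
    simp only [List.ofFn_succ, Fin.cons_zero, Fin.cons_succ, Fin.prod_univ_succ, wordEps,
      List.sum_cons, List.map_ofFn, Function.comp_def]
    rw [add_comm (ev i)]
    congr 1
    rw [← Complex.ofReal_mul]
    congr 1
    ring

namespace PauliHamiltonian

/-! ### The reference state as an element of the algebra generated by the Pauli terms -/

variable {n m : ℕ} (H : PauliHamiltonian n m)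

/-- The coefficients, extended by `0`. -/
def c (q : ℕ) : ℝ := if h : q < m then H.coeff ⟨q, h⟩ else 0

/-- The Pauli terms, extended by `1`. -/
def z (q : ℕ) : Matrix (Fin n → ZMod 2) (Fin n → ZMod 2) ℂ :=
  if h : q < m then H.term ⟨q, h⟩ else 1

/-- The commutation signs, extended by `1`. -/
def sg (i j : ℕ) : ℝ :=
  if h : i < m ∧ j < m then sympSign (H.symp ⟨i, h.1⟩) (H.symp ⟨j, h.2⟩) else 1

@[simp] theorem c_val (i : Fin m) : H.c i = H.coeff i := by simp [c]

@[simp] theorem z_val (i : Fin m) : H.z i = H.term i := by simp [z]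

theorem z_mul_self (i : ℕ) : H.z i * H.z i = 1 := by
  unfold z
  split_ifs
  · exact pauli_mul_self _
  · exact mul_one 1

theorem z_mul_comm (i j : ℕ) : H.z i * H.z j = H.sg i j • (H.z j * H.z i) := by
  unfold z sg
  by_cases hi : i < m <;> by_cases hj : j < m <;> simp [hi, hj]
  exact pauli_mul_comm _ _

theorem sg_eq (i j : ℕ) : H.sg i j = 1 ∨ H.sg i j = -1 := by
  unfold sg
  split_ifs
  · exact sympSign_eq _ _
  · exact .inl rfl

end PauliHamiltonian

/-- The contents of the wires with `y` on register `A` and zeros elsewhere. -/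
def emb {m : ℕ} (y : Fin m → ZMod 2) : Cfg := fun q => if h : q < m then y ⟨q, h⟩ else 0

@[simp] theorem emb_val {m : ℕ} (y : Fin m → ZMod 2) (i : Fin m) : emb y i = y i := by simp [emb]

/-- The parities of the numbers of occurrences in a string. -/
def parity {m s : ℕ} (π : Fin s → Fin m) : Fin m → ZMod 2 :=
  fun i => ((Finset.univ.filter fun t => π t = i).card : ZMod 2)

theorem emb_parity {m s : ℕ} (π : Fin s → Fin m) :
    emb (parity π) = (List.ofFn fun t => ev (π t)).sum := by
  funext q
  rw [List.sum_ofFn, Finset.sum_apply]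
  by_cases h : q < m
  · simp only [emb, h, dite_true, parity, Finset.card_filter, Nat.cast_sum, Nat.cast_ite,
      Nat.cast_one, Nat.cast_zero, ev, Pi.single_apply, Fin.ext_iff, eq_comm]
  · simp only [emb, h, dite_false, ev]
    refine (Finset.sum_eq_zero fun t _ => ?_).symm
    rw [Pi.single_apply, if_neg]
    have := (π t).2
    omega

theorem prod_reverse_mul_prod {α R : Type*} [Monoid R] (L : List α) (a b : α → R)
    (h : ∀ x, a x * b x = 1) : (L.reverse.map a).prod * (L.map b).prod = 1 := by
  induction L with
  | nil => simp
  | cons x L ih =>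
    rw [List.reverse_cons, List.map_append, List.prod_append, List.map_singleton,
      List.prod_singleton, List.map_cons, List.prod_cons, mul_assoc, ← mul_assoc (a x), h, one_mul, ih]

theorem pow_mul_pow_val {R : Type*} [Monoid R] {x : R} (hx : x * x = 1) (k : ℕ) :
    x ^ k * x ^ (k : ZMod 2).val = 1 := by
  rw [ZMod.val_natCast, ← pow_add]
  obtain ⟨j, hj⟩ : ∃ j, k + k % 2 = 2 * j := ⟨(k + k % 2) / 2, by omega⟩
  rw [hj, pow_mul, sq, hx, one_pow]

namespace PauliHamiltonian

variable {n m : ℕ} (H : PauliHamiltonian n m)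

theorem ordProd_emb (y : Fin m → ZMod 2) :
    ordProd H.z m (emb y) = ((List.finRange m).map fun i => H.term i ^ (y i).val).prod := by
  rw [ordProd, ← List.map_coe_finRange_eq_range, List.map_map]
  simp [Function.comp_def]

/-- The counting vector of a string. -/
def _root_.HDQI.counts {m s : ℕ} (π : Fin s → Fin m) : Fin m → ℕ :=
  fun i => (Finset.univ.filter fun t => π t = i).card

/-- The word is its sign times the ordered product of the parities, and the reversed product of
powers cancels that ordered product. What remains is the sign times the identity. -/
theorem wordSign_eq {s : ℕ} (π : Fin s → Fin m) :
    wordSign H.term (counts π) π = wordEps H.sg (List.ofFn fun t => (π t : ℕ)) := by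
  have h1 : (List.ofFn fun t => H.term (π t)).prod =
      wordEps H.sg (List.ofFn fun t => (π t : ℕ)) • ordProd H.z m (emb (parity π)) := by
    have := prod_word H.z_mul_self H.z_mul_comm (N := m) (List.ofFn fun t => (π t : ℕ)) fun q hq => by
      obtain ⟨t, rfl⟩ := (List.mem_ofFn' _ _).1 hq
      exact (π t).2
    simpa [List.map_ofFn, Function.comp_def, emb_parity] using this
  have h2 := prod_reverse_mul_prod (List.finRange m) (fun i => H.term i ^ counts π i)
    (fun i => H.term i ^ (parity π i).val) fun i => pow_mul_pow_val (pauli_mul_self _) _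
  rw [wordSign, h1, mul_smul_comm, ordProd_emb, h2]
  rcases wordEps_eq H.sg_eq (List.ofFn fun t => (π t : ℕ)) with h | h
  · rw [h, one_smul, if_pos rfl]
  · rw [h, if_neg]
    -- Minus the identity differs from the identity, as a diagonal entry shows.
    intro h0
    have h3 := congrFun (congrFun h0 0) 0
    simp at h3
    norm_num at h3

/-- Strings are regrouped by counting vector; the monomial in the coefficients depends on the string
through that vector only. -/
theorem weightedBeta_eq (s : ℕ) (y : Fin m → ZMod 2) :
    weightedBeta H.term H.coeff s y = ∑ π : Fin s → Fin m, if parity π = y then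
      (∏ t, H.c (π t)) * wordEps H.sg (List.ofFn fun t => (π t : ℕ)) else 0 := by
  classical
  rw [← Finset.sum_filter, weightedBeta]
  rw [← Finset.sum_fiberwise_of_maps_to (g := counts)
    (t := (Finset.piAntidiag (Finset.univ : Finset (Fin m)) s).filter
      (fun μ => ∀ i, ((μ i : ℕ) : ZMod 2) = y i))]
  · refine Finset.sum_congr rfl fun μ hμ => ?_
    rw [Finset.mul_sum, Finset.filter_filter]
    refine Finset.sum_congr ?_ fun π hπ => ?_
    · ext π
      simp only [Finset.mem_filter, Finset.mem_univ, true_and, funext_iff, counts]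
      refine ⟨fun h => ⟨fun i => ?_, h⟩, fun h => h.2⟩
      rw [parity, h i]
      exact (Finset.mem_filter.1 hμ).2 i
    · simp only [Finset.mem_filter, Finset.mem_univ, true_and] at hπ
      rw [← hπ.2, wordSign_eq]
      congr 1
      simp only [c_val, counts]
      rw [← Finset.prod_fiberwise_of_maps_to (g := π) (t := Finset.univ) fun _ _ => Finset.mem_univ _]
      refine Finset.prod_congr rfl fun i _ => ?_
      rw [Finset.prod_congr rfl fun t ht => by rw [(Finset.mem_filter.1 ht).2], Finset.prod_const]
  · intro π hπ
    simp only [Finset.mem_filter, Finset.mem_univ, true_and, Finset.mem_piAntidiag] at hπ ⊢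
    refine ⟨⟨?_, fun _ _ => trivial⟩, fun i => congrFun hπ i⟩
    have := Finset.card_eq_sum_card_fiberwise (f := π) (s := Finset.univ) (t := Finset.univ)
      fun _ _ => Finset.mem_coe.2 (Finset.mem_univ _)
    change ∑ i, counts π i = s
    simpa [counts] using this.symm

/-- An odd multiplicity is at least `1`, so a string of length `s` has at most `s` odd ones. This
confines the reference state to the weights covered by the oracle. -/
theorem weightedBeta_eq_zero {s : ℕ} {y : Fin m → ZMod 2} (h : s < hammingNorm y) :
    weightedBeta H.term H.coeff s y = 0 := by
  classical
  refine Finset.sum_eq_zero fun μ hμ => ?_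
  simp only [Finset.mem_filter, Finset.mem_piAntidiag] at hμ
  exfalso
  have : hammingNorm y ≤ ∑ i, μ i := by
    rw [hammingNorm, Finset.card_filter]
    refine Finset.sum_le_sum fun i _ => ?_
    split_ifs with h0
    · rw [← hμ.2 i] at h0
      exact Nat.one_le_iff_ne_zero.2 fun h1 => h0 (by simp [h1])
    · exact Nat.zero_le _
  have h2 : ∑ i, μ i = s := hμ.1.1
  omega

theorem refAmplitude_eq_zero {l : ℕ} (P : Polynomial ℝ) {y : Fin m → ZMod 2}
    (h : l < hammingNorm y) : H.refAmplitude l P y = 0 :=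
  Finset.sum_eq_zero fun s hs => by
    rw [H.weightedBeta_eq_zero (by have := Finset.mem_range.1 hs; omega), mul_zero]

/-- Multiplication by the Hamiltonian. -/
def totalOp : Sta →ₗ[ℂ] Sta := ∑ q ∈ Finset.range m, mulOp H.c H.sg q

theorem totalOp_pow (s : ℕ) :
    (H.totalOp ^ s) (ket 0) =
      ∑ y, ((weightedBeta H.term H.coeff s y : ℝ) : ℂ) • ket (emb y) := by
  rw [totalOp, mulOp_pow]
  simp only [weightedBeta_eq, Complex.ofReal_sum, Finset.sum_smul]
  rw [Finset.sum_comm]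
  refine Finset.sum_congr rfl fun π _ => ?_
  rw [Finset.sum_eq_single (parity π), if_pos rfl, emb_parity]
  · intro y _ hy
    rw [if_neg hy.symm, Complex.ofReal_zero, zero_smul]
  · exact fun h => absurd (Finset.mem_univ _) h

theorem sum_totalOp_pow (l : ℕ) (P : Polynomial ℝ) :
    ∑ s ∈ Finset.range (l + 1), (P.coeff s : ℂ) • (H.totalOp ^ s) (ket 0) =
      ∑ y, ((H.refAmplitude l P y : ℝ) : ℂ) • ket (emb y) := by
  simp only [totalOp_pow, Finset.smul_sum, refAmplitude, Complex.ofReal_sum, Finset.sum_smul,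
    smul_smul, Complex.ofReal_mul]
  rw [Finset.sum_comm]

/-- The operator represented by a state. -/
def evalMap : Sta →ₗ[ℂ] Matrix (Fin n → ZMod 2) (Fin n → ZMod 2) ℂ :=
  Finsupp.linearCombination ℂ fun y => ordProd H.z m y

@[simp] theorem evalMap_ket (y : Cfg) : H.evalMap (ket y) = ordProd H.z m y := by
  simp [evalMap, ket]

/-- On basis states this is `mul_ordProd` summed over the terms: `evalMap` intertwines the formal
multiplication with the matrix product. -/
theorem evalMap_totalOp (ψ : Sta) : H.evalMap (H.totalOp ψ) = H.toMatrix * H.evalMap ψ := by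
  have : H.evalMap ∘ₗ H.totalOp = LinearMap.mulLeft ℂ H.toMatrix ∘ₗ H.evalMap :=
    sta_hom_ext fun y => by
      simp only [LinearMap.comp_apply, totalOp, LinearMap.sum_apply, mulOp_ket, map_sum, map_smul,
        evalMap_ket, LinearMap.mulLeft_apply, toMatrix, Finset.sum_mul]
      rw [Finset.sum_range]
      refine Finset.sum_congr rfl fun i _ => ?_
      have h := mul_ordProd H.z_mul_self H.z_mul_comm i.2 y
      rw [z_val] at h
      rw [smul_mul_assoc, h, smul_smul, c_val, Complex.coe_smul]
  exact LinearMap.congr_fun this ψ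

theorem polyOp_eq {l : ℕ} {P : Polynomial ℝ} (hP : P.natDegree ≤ l) :
    H.polyOp P = ∑ y, ((H.refAmplitude l P y : ℝ) : ℂ) • ordProd H.z m (emb y) := by
  have h : ∀ s, H.evalMap ((H.totalOp ^ s) (ket 0)) = H.toMatrix ^ s := by
    intro s
    induction s with
    | zero => simp [ordProd]
    | succ s ih => rw [pow_succ', Module.End.mul_apply, evalMap_totalOp, ih, pow_succ']
  have := congrArg H.evalMap (H.sum_totalOp_pow l P)
  simp only [map_sum, map_smul, h, evalMap_ket] at this
  rw [← this, polyOp, Polynomial.aeval_eq_sum_range' (Nat.lt_succ_of_le hP)]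
  exact Finset.sum_congr rfl fun s _ => (Complex.coe_smul _ _).symm

theorem toMatrix_isHermitian : H.toMatrix.IsHermitian := by
  rw [Matrix.IsHermitian, toMatrix, Matrix.conjTranspose_sum]
  refine Finset.sum_congr rfl fun i _ => ?_
  rw [Matrix.conjTranspose_smul, star_trivial]
  exact congrArg _ (pauli_conjTranspose _)

theorem polyOp_isHermitian (P : Polynomial ℝ) : (H.polyOp P).IsHermitian := by
  rw [Matrix.IsHermitian, polyOp, Polynomial.aeval_eq_sum_range, Matrix.conjTranspose_sum]
  refine Finset.sum_congr rfl fun i _ => ?_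
  rw [Matrix.conjTranspose_smul, star_trivial, (H.toMatrix_isHermitian.pow i).eq]

end PauliHamiltonian

/-! ### Rotations between modes

A unit vector on the wires `b, b + 1, …` stands for a particle in one of the modes `0, 1, …`. -/

/-- The rotation with cosine `c` and sine `s` on wire `j`, controlled by wire `i`. -/
def rRot (i j : ℕ) (c s : ℝ) : RawGate := ([i], j, ((c, 0), (-s, 0)), ((s, 0), (c, 0)))

/-- The rotation of the modes `i` and `j`. -/
def rotGates (b i j : ℕ) (c s : ℝ) : List RawGate :=
  [rX [b + j] (b + i), rRot (b + i) (b + j) c s, rX [b + j] (b + i)]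

theorem cfg_add_self (v : Cfg) : v + v = 0 := add_self_cfg v

theorem cfg_add_add_self (v w : Cfg) : v + w + w = v := by rw [add_assoc, cfg_add_self, add_zero]

theorem act_rRot_of_ne {i j : ℕ} {c s : ℝ} {x : Cfg} (h : x i ≠ 1) :
    act (rRot i j c s) (ket x) = ket x := by
  rw [act_ket, if_neg]
  simpa [rRot] using h

theorem act_rRot {i j : ℕ} {c s : ℝ} {x : Cfg} (h : x i = 1) :
    act (rRot i j c s) (ket x) =
      if x j = 0 then (c : ℂ) • ket x + (s : ℂ) • ket (x + ev j)
      else -(s : ℂ) • ket (x + ev j) + (c : ℂ) • ket x := by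
  rw [act_ket, if_pos (by simpa [rRot] using h), sum_zmod_two]
  have hj : (rRot i j c s).2.1 = j := rfl
  have h2 : ∀ a, Function.update x j a = x + Pi.single j (x j + a) := fun a => by
    funext w
    by_cases hw : w = j
    · subst hw
      simp [← add_assoc, CharTwo.add_self_eq_zero]
    · simp [hw]
  have h11 : (1 : ZMod 2) + 1 = 0 := rfl
  rw [hj, h2, h2]
  have h3 : decodeComplex (-s, 0) = -(s : ℂ) := by rw [decodeComplex_real, Complex.ofReal_neg]
  rcases zmod_two_cases (x j) with h0 | h0 <;> simp [h0, RawGate.U, rRot, h11, h3]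

theorem act_cx_of_zero {a t : ℕ} {x : Cfg} (h : x a = 0) : act (rX [a] t) (ket x) = ket x := by
  rw [act_rX, List.map_singleton, List.prod_singleton, h, Pi.single_zero, add_zero]

theorem act_cx_of_one {a t : ℕ} {x : Cfg} (h : x a = 1) :
    act (rX [a] t) (ket x) = ket (x + ev t) := by
  rw [act_rX, List.map_singleton, List.prod_singleton, h]

theorem ev_self (q : ℕ) : ev q q = 1 := Pi.single_eq_same q 1

theorem ev_of_ne {q w : ℕ} (h : w ≠ q) : ev q w = 0 := Pi.single_eq_of_ne h 1

/-- The outer gates set and clear wire `i` when the particle is in mode `j`. In between, wire `i` is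
set precisely if the particle is in one of the two modes, and wire `j` tells which, so a controlled
single-qubit rotation acts on their span and on nothing else. -/
theorem run_rotGates {b i j : ℕ} (hij : i ≠ j) (c s : ℝ) (acc : List RawGate) (v : ℕ) :
    run (rotGates b i j c s ++ acc) (ket (ev (b + v))) =
      if v = i then (c : ℂ) • run acc (ket (ev (b + i))) + (s : ℂ) • run acc (ket (ev (b + j)))
      else if v = j then
        -(s : ℂ) • run acc (ket (ev (b + i))) + (c : ℂ) • run acc (ket (ev (b + j)))
      else run acc (ket (ev (b + v))) := by
  have hij' : b + j ≠ b + i := by omega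
  have e1 : ev (b + i) (b + j) = 0 := ev_of_ne hij'
  have e2 : ev (b + j) (b + i) = 0 := ev_of_ne hij'.symm
  have e3 : (ev (b + i) + ev (b + j) : Cfg) (b + j) = 1 := by
    rw [Pi.add_apply, e1, ev_self, zero_add]
  have e4 : (ev (b + j) + ev (b + i) : Cfg) (b + i) = 1 := by
    rw [Pi.add_apply, e2, ev_self, zero_add]
  have e5 : (ev (b + j) + ev (b + i) : Cfg) (b + j) = 1 := by rw [add_comm, e3]
  rw [run_append, rotGates]
  simp only [run_cons, run_nil]
  split_ifs with h1 h2
  · subst h1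
    rw [act_cx_of_zero e1, act_rRot (ev_self _), if_pos e1, map_add, map_smul, map_smul,
      act_cx_of_zero e1, act_cx_of_one e3, add_comm (ev (b + v)), cfg_add_add_self, map_add,
      map_smul, map_smul]
  · subst h2
    rw [act_cx_of_one (ev_self _), act_rRot e4, if_neg (by rw [e5]; exact one_ne_zero), map_add,
      map_smul, map_smul, act_cx_of_one e5, cfg_add_add_self, add_comm (ev (b + v)),
      cfg_add_add_self, act_cx_of_zero e1, map_add, map_smul, map_smul]
  · rw [act_cx_of_zero (ev_of_ne (by omega)), act_rRot_of_ne
      (by rw [ev_of_ne (by omega)]; exact zero_ne_one), act_cx_of_zero (ev_of_ne (by omega))]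

/-- The columns of a matrix, indexed by the modes, and a circuit. -/
abbrev ColState : Type := List (List ℝ) × List RawGate

/-- The entry in column `v` and row `t`. -/
def ent (cols : List (List ℝ)) (v t : ℕ) : ℝ := (cols.getD v []).getD t 0

/-- The combination of the states produced by the circuit from the modes, with the coefficients in
row `t`. -/
def combo (b t : ℕ) (cols : List (List ℝ)) (acc : List RawGate) : Sta :=
  ∑ v ∈ Finset.range cols.length, (ent cols v t : ℂ) • run acc (ket (ev (b + v)))

/-- The cosine of the rotation that annihilates the second coordinate of `(a, a')`. -/
def rotCos (a a' : ℝ) : ℝ :=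
  if 0 < Real.sqrt (a * a + a' * a') then a / Real.sqrt (a * a + a' * a') else 1

/-- The sine of the rotation that annihilates the second coordinate of `(a, a')`. -/
def rotSin (a a' : ℝ) : ℝ :=
  if 0 < Real.sqrt (a * a + a' * a') then a' / Real.sqrt (a * a + a' * a') else 0

/-- If both coordinates vanish, the default values give the identity rotation and no division by
zero occurs. -/
theorem rot_spec (a a' : ℝ) :
    rotCos a a' * rotCos a a' + rotSin a a' * rotSin a a' = 1 ∧
    rotCos a a' * a + rotSin a a' * a' = Real.sqrt (a * a + a' * a') ∧
    rotCos a a' * a' - rotSin a a' * a = 0 := by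
  unfold rotCos rotSin
  have h0 : 0 ≤ a * a + a' * a' := add_nonneg (mul_self_nonneg a) (mul_self_nonneg a')
  have hs := Real.mul_self_sqrt h0
  split_ifs with h
  · generalize Real.sqrt (a * a + a' * a') = r at hs h
    refine ⟨?_, ?_, ?_⟩
    · field_simp
      linarith
    · field_simp
      linarith
    · field_simp
      ring
  · have h1 : Real.sqrt (a * a + a' * a') = 0 := le_antisymm (not_lt.1 h) (Real.sqrt_nonneg _)
    rw [h1] at hs ⊢
    have ha : a = 0 := by nlinarith [mul_self_nonneg a, mul_self_nonneg a']
    have ha' : a' = 0 := by nlinarith [mul_self_nonneg a, mul_self_nonneg a']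
    simp [ha, ha']

/-- The rotation of the columns `i` and `j` that annihilates the entry of column `j` in row `i`. -/
def rotStep (rows b i j : ℕ) (S : ColState) : ColState :=
  ((List.range S.1.length).map fun v =>
    if v = i then (List.range rows).map fun t =>
      rotCos (ent S.1 i i) (ent S.1 j i) * ent S.1 i t +
        rotSin (ent S.1 i i) (ent S.1 j i) * ent S.1 j t
    else if v = j then (List.range rows).map fun t =>
      rotCos (ent S.1 i i) (ent S.1 j i) * ent S.1 j t -
        rotSin (ent S.1 i i) (ent S.1 j i) * ent S.1 i t
    else S.1.getD v [],
  rotGates b i j (rotCos (ent S.1 i i) (ent S.1 j i)) (rotSin (ent S.1 i i) (ent S.1 j i)) ++ S.2)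

theorem getD_map_range {α : Type*} (f : ℕ → α) (N v : ℕ) (d : α) :
    ((List.range N).map f).getD v d = if v < N then f v else d := by
  rw [List.getD_eq_getElem?_getD]
  split_ifs with h
  · simp [h]
  · simp [not_lt.1 h]

theorem ent_rotStep {rows b i j : ℕ} {S : ColState} {v t : ℕ} (hv : v < S.1.length)
    (ht : t < rows) : ent (rotStep rows b i j S).1 v t =
      if v = i then rotCos (ent S.1 i i) (ent S.1 j i) * ent S.1 i t +
        rotSin (ent S.1 i i) (ent S.1 j i) * ent S.1 j t
      else if v = j then rotCos (ent S.1 i i) (ent S.1 j i) * ent S.1 j t -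
        rotSin (ent S.1 i i) (ent S.1 j i) * ent S.1 i t
      else ent S.1 v t := by
  rw [ent, rotStep, getD_map_range, if_pos hv]
  split_ifs
  · rw [getD_map_range, if_pos ht]
  · rw [getD_map_range, if_pos ht]
  · rfl

theorem sum_eq_of_pair {M : Type*} [AddCommMonoid M] {s : Finset ℕ} {i j : ℕ} (hi : i ∈ s)
    (hj : j ∈ s) (hij : i ≠ j) {F G : ℕ → M} (h : ∀ v, v ≠ i → v ≠ j → F v = G v)
    (h' : F i + F j = G i + G j) : ∑ v ∈ s, F v = ∑ v ∈ s, G v := by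
  have hs : {i, j} ⊆ s := by
    intro x hx
    rcases Finset.mem_insert.1 hx with rfl | hx
    · exact hi
    · exact Finset.mem_singleton.1 hx ▸ hj
  rw [← Finset.sum_sdiff hs, ← Finset.sum_sdiff hs, Finset.sum_pair hij, Finset.sum_pair hij, h']
  refine congrArg (· + _) (Finset.sum_congr rfl fun v hv => ?_)
  have := (Finset.mem_sdiff.1 hv).2
  simp only [Finset.mem_insert, Finset.mem_singleton, not_or] at this
  exact h v this.1 this.2

/-- Coefficients and vectors are rotated by the same orthogonal matrix, and the sum of their
products is invariant under that; only `c² + s² = 1` is used. -/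
theorem combo_rotStep {rows b i j : ℕ} {S : ColState} (hi : i < S.1.length) (hj : j < S.1.length)
    (hij : i ≠ j) {t : ℕ} (ht : t < rows) :
    combo b t (rotStep rows b i j S).1 (rotStep rows b i j S).2 = combo b t S.1 S.2 := by
  have hlen : (rotStep rows b i j S).1.length = S.1.length := by simp [rotStep]
  rw [combo, combo, hlen]
  have hc := (rot_spec (ent S.1 i i) (ent S.1 j i)).1
  have hent := fun v (hv : v < S.1.length) => ent_rotStep (b := b) (i := i) (j := j) hv ht
  have hrun : ∀ v, run (rotStep rows b i j S).2 (ket (ev (b + v))) = _ := fun v =>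
    run_rotGates hij (rotCos (ent S.1 i i) (ent S.1 j i)) (rotSin (ent S.1 i i) (ent S.1 j i)) S.2 v
  rw [Finset.sum_congr rfl fun v hv => by rw [hent v (Finset.mem_range.1 hv), hrun v]]
  refine sum_eq_of_pair (Finset.mem_range.2 hi) (Finset.mem_range.2 hj) hij (fun v h1 h2 => ?_) ?_
  · simp [h1, h2]
  · simp only [if_pos, if_neg hij.symm]
    generalize rotCos (ent S.1 i i) (ent S.1 j i) = c at hc ⊢
    generalize rotSin (ent S.1 i i) (ent S.1 j i) = s at hc ⊢
    generalize run S.2 (ket (ev (b + i))) = A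
    generalize run S.2 (ket (ev (b + j))) = B
    have hc' : (c : ℂ) * c + s * s = 1 := by exact_mod_cast hc
    push_cast
    match_scalars
    · linear_combination (ent S.1 i t : ℂ) * hc'
    · linear_combination (ent S.1 j t : ℂ) * hc'

/-- Annihilation of the entries in row `i` of the columns `i + 1, …, j - 1`. -/
def elimRow (rows b i j : ℕ) (S : ColState) : ColState :=
  (List.range j).foldl (fun S j => if i < j then rotStep rows b i j S else S) S

/-- Elimination of the entries above the diagonal in the first `r` rows of `N` columns. -/
def elim (rows b N r : ℕ) (S : ColState) : ColState :=
  (List.range r).foldl (fun S i => elimRow rows b i N S) S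

/-- The state of the elimination during the processing of row `i`. -/
structure ElimInv (rows b N i j : ℕ) (S₀ S : ColState) : Prop where
  len : S.1.length = N
  combo_eq : ∀ t < rows, combo b t S.1 S.2 = combo b t S₀.1 S₀.2
  zero : ∀ t < i, ∀ v < N, t < v → ent S.1 v t = 0
  row : ∀ v < j, i < v → ent S.1 v i = 0
  pos : i + 1 < j → 0 ≤ ent S.1 i i
  gates : ∀ Q : RawGate → Prop, (∀ g ∈ S₀.2, Q g) → (∀ i < N, ∀ j < N, i ≠ j → ∀ c s : ℝ,
    c * c + s * s = 1 → ∀ g ∈ rotGates b i j c s, Q g) → ∀ g ∈ S.2, Q g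

/-- Earlier rows survive because both rotated columns already vanish there. In row `i` every
rotation clears one more entry and touches only the pivot besides, which becomes a square root and
is therefore nonnegative after at least one rotation. -/
theorem ElimInv.elimRow {rows b N i : ℕ} {S₀ S : ColState} (hi : i < rows)
    (h : ElimInv rows b N i 0 S₀ S) {j : ℕ} (hj : j ≤ N) :
    ElimInv rows b N i j S₀ (elimRow rows b i j S) := by
  induction j with
  | zero => simpa [HDQI.elimRow] using h
  | succ j ih =>
    have h := ih (by omega)
    rw [HDQI.elimRow, List.range_succ, List.foldl_append, List.foldl_cons, List.foldl_nil]
    rw [HDQI.elimRow] at h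
    generalize List.foldl _ S _ = S' at h ⊢
    split_ifs with hij
    · have hjl : j < S'.1.length := by rw [h.len]; omega
      have hil : i < S'.1.length := by rw [h.len]; omega
      obtain ⟨h1, h2, h3⟩ := rot_spec (ent S'.1 i i) (ent S'.1 j i)
      refine ⟨by simp [rotStep, h.len], fun t ht => ?_, fun t ht v hv htv => ?_, fun v hv hiv => ?_,
        fun _ => ?_, fun Q h0 hQ g hg => ?_⟩
      · rw [combo_rotStep hil hjl hij.ne ht, h.combo_eq t ht]
      · rw [ent_rotStep (by rw [h.len]; exact hv) (by omega), h.zero t ht i (by omega) ht,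
          h.zero t ht j (by omega) (by omega), h.zero t ht v hv htv]
        simp
      · rw [ent_rotStep (by rw [h.len]; omega) hi, if_neg (by omega)]
        split_ifs with hvj
        · exact h3
        · exact h.row v (by omega) hiv
      · rw [ent_rotStep hil hi, if_pos rfl, h2]
        exact Real.sqrt_nonneg _
      · rcases List.mem_append.1 hg with hg | hg
        · exact hQ i (by omega) j (by omega) hij.ne _ _ h1 g hg
        · exact h.gates Q h0 hQ g hg
    · exact ⟨h.len, h.combo_eq, h.zero, fun v hv hiv => h.row v (by omega) hiv,
        fun hi => h.pos (by omega), h.gates⟩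

theorem ElimInv.elim {rows b N r : ℕ} {S : ColState} (hN : S.1.length = N) (hr : r ≤ rows) :
    ElimInv rows b N r 0 S (elim rows b N r S) := by
  induction r with
  | zero => exact ⟨hN, fun _ _ => rfl, fun _ h => absurd h (by omega), fun _ h => absurd h (by omega),
      fun h => absurd h (by omega), fun Q h _ => h⟩
  | succ r ih =>
    rw [HDQI.elim, List.range_succ, List.foldl_append, List.foldl_cons, List.foldl_nil]
    have h := (ih (by omega)).elimRow (by omega) le_rfl
    rw [HDQI.elim] at h
    refine ⟨h.len, h.combo_eq, fun t ht v hv htv => ?_, fun _ h => absurd h (by omega),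
      fun h => absurd h (by omega), h.gates⟩
    rcases Nat.lt_succ_iff_lt_or_eq.1 ht with ht | rfl
    · exact h.zero t ht v hv htv
    · exact h.row v hv htv

/-! ### Subsets of a component and powers of its Hamiltonian -/

/-- The sublists of a list. -/
def subs (C : List ℕ) : List (List ℕ) := C.foldr (fun q s => s ++ s.map (q :: ·)) [[]]

/-- The configuration selected by a list of wires. -/
def ind (x : List ℕ) : Cfg := (x.map ev).sum

theorem subs_cons (q : ℕ) (C : List ℕ) : subs (q :: C) = subs C ++ (subs C).map (q :: ·) := rfl

@[simp] theorem ind_nil : ind [] = 0 := rfl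

@[simp] theorem ind_cons (q : ℕ) (x : List ℕ) : ind (q :: x) = ev q + ind x := by simp [ind]

theorem sublist_of_mem_subs {C x : List ℕ} (h : x ∈ subs C) : x.Sublist C := by
  induction C generalizing x with
  | nil => simpa [subs] using h
  | cons q C ih =>
    rw [subs_cons, List.mem_append, List.mem_map] at h
    rcases h with h | ⟨y, hy, rfl⟩
    · exact (ih h).cons q
    · exact (ih hy).cons_cons q

theorem ind_apply {x : List ℕ} (hx : x.Nodup) (w : ℕ) : ind x w = if w ∈ x then 1 else 0 := by
  induction x with
  | nil => simp
  | cons q x ih =>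
    rw [List.nodup_cons] at hx
    rw [ind_cons, Pi.add_apply, ih hx.2]
    by_cases hw : w = q
    · subst hw
      simp [hx.1]
    · rw [ev_of_ne hw, zero_add]
      simp [hw]

-- A string supported on `C` is the indicator of exactly one sublist; its bit at the head of `C`
-- tells in which half of `subs` that sublist lies.
open Classical in
theorem sum_subs_ite {M : Type*} [AddCommMonoid M] {C : List ℕ} (hC : C.Nodup) (y : Cfg)
    (hy : ∀ w, w ∉ C → y w = 0) (F : Cfg → M) :
    ((subs C).map fun x => if ind x = y then F (ind x) else 0).sum = F y := by
  induction C generalizing y F with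
  | nil =>
    have : y = 0 := funext fun w => hy w (by simp)
    simp [subs, this]
  | cons q C ih =>
    rw [List.nodup_cons] at hC
    have hq : ∀ x ∈ subs C, ind x q = 0 := fun x hx => by
      rw [ind_apply (hC.2.sublist (sublist_of_mem_subs hx)), if_neg]
      exact fun h => hC.1 ((sublist_of_mem_subs hx).subset h)
    have zero : ∀ (p : List ℕ → Prop) [DecidablePred p] (G : List ℕ → M), (∀ x ∈ subs C, ¬ p x) →
        ((subs C).map fun x => if p x then G x else 0).sum = 0 := fun p _ G hp => by
      refine List.sum_eq_zero fun a ha => ?_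
      obtain ⟨x, hx, rfl⟩ := List.mem_map.1 ha
      exact if_neg (hp x hx)
    rw [subs_cons, List.map_append, List.sum_append, List.map_map]
    simp only [Function.comp_def, ind_cons]
    rcases zmod_two_cases (y q) with h0 | h0
    · rw [ih hC.2 y, zero, add_zero]
      · intro x hx h
        have := congrFun h q
        rw [Pi.add_apply, hq x hx, ev_self, h0] at this
        exact absurd this (by decide)
      · intro w hw
        by_cases hwq : w = q
        · rw [hwq, h0]
        · exact hy w (by simp [hw, hwq])
    · rw [zero, zero_add]
      · have h1 : ∀ x, ev q + ind x = y ↔ ind x = y + ev q := fun x => by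
          constructor
          · rintro rfl
            rw [add_comm (ev q), cfg_add_add_self]
          · intro h
            rw [h, add_comm, cfg_add_add_self]
        simp only [h1]
        rw [ih hC.2 (y + ev q) _ fun v => F (ev q + v), add_comm (ev q), cfg_add_add_self]
        intro w hw
        by_cases hwq : w = q
        · rw [hwq, Pi.add_apply, h0, ev_self]
          rfl
        · rw [Pi.add_apply, hy w (by simp [hw, hwq]), ev_of_ne hwq, add_zero]
      · intro x hx h
        have := hq x hx
        rw [h, h0] at this
        exact absurd this (by decide)

/-- `x` is `x'` with `q` added or removed, where `x` and `x'` are sublists of `C`. -/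
def Toggles (C : List ℕ) (q : ℕ) (x x' : List ℕ) : Prop :=
  ∀ j ∈ C, (((j ∈ x) ↔ ¬ (j ∈ x')) ↔ j = q)

instance (C : List ℕ) (q : ℕ) (x x' : List ℕ) : Decidable (Toggles C q x x') :=
  inferInstanceAs (Decidable (∀ j ∈ C, _))

/-- `Toggles` is the form of this identity of strings that a program can test on lists. -/
theorem toggles_iff {C : List ℕ} (hC : C.Nodup) {q : ℕ} (hq : q ∈ C) {x x' : List ℕ}
    (hx : x.Sublist C) (hx' : x'.Sublist C) : Toggles C q x x' ↔ ind x = ind x' + ev q := by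
  have key : ∀ j, ind x j = (ind x' + ev q) j ↔ (((j ∈ x) ↔ ¬ (j ∈ x')) ↔ j = q) := by
    intro j
    rw [Pi.add_apply, ind_apply (hC.sublist hx), ind_apply (hC.sublist hx')]
    by_cases h1 : j = q
    · subst h1
      rw [ev_self]
      by_cases h2 : j ∈ x <;> by_cases h3 : j ∈ x' <;> simp [h2, h3]
      rfl
    · rw [ev_of_ne h1]
      by_cases h2 : j ∈ x <;> by_cases h3 : j ∈ x' <;> simp [h1, h2, h3]
  constructor
  · intro h
    funext j
    by_cases hj : j ∈ C
    · exact (key j).2 (h j hj)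
    · rw [Pi.add_apply, ind_apply (hC.sublist hx), ind_apply (hC.sublist hx'), if_neg, if_neg,
        ev_of_ne, add_zero]
      · rintro rfl
        exact hj hq
      · exact fun h => hj (hx'.subset h)
      · exact fun h => hj (hx.subset h)
  · intro h j _
    exact (key j).1 (congrFun h j)

/-- The sign that arises when `q` is moved into the ordered product given by the list `x`. -/
def insSignList (σ : ℕ → ℕ → ℝ) (q : ℕ) (x : List ℕ) : ℝ :=
  (x.map fun j => if j < q then σ q j else 1).prod

theorem insSignList_eq {σ : ℕ → ℕ → ℝ} (h1 : ∀ i j, σ i j * σ i j = 1) (q : ℕ) (x : List ℕ) :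
    insSignList σ q x = insSign σ q (ind x) := by
  induction x with
  | nil => simp [insSignList]
  | cons j x ih =>
    rw [ind_cons, insSign_add h1, insSign_ev, ← ih]
    simp [insSignList]

/-- The matrix entry of the multiplication by the Hamiltonian of the component `C`. -/
def compEntry (c : ℕ → ℝ) (σ : ℕ → ℕ → ℝ) (C x x' : List ℕ) : ℝ :=
  (C.map fun q => if Toggles C q x x' then c q * insSignList σ q x' else 0).sum

/-- The coefficients of the `u`-th power of the Hamiltonian of the component `C`, divided by `u!`. -/
def compCoeff (c : ℕ → ℝ) (σ : ℕ → ℕ → ℝ) (C : List ℕ) : ℕ → List ℕ → ℝ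
  | 0, x => if x = [] then 1 else 0
  | u + 1, x => ((subs C).map fun x' => compEntry c σ C x x' * compCoeff c σ C u x').sum / (u + 1)

/-- One step in the computation of the coefficients of the powers. -/
def tabStep (c : ℕ → ℝ) (σ : ℕ → ℕ → ℝ) (C : List ℕ) (tab : List (List ℕ × List ℝ)) (u : ℕ) :
    List (List ℕ × List ℝ) :=
  tab.map fun p =>
    (p.1, (tab.map fun p' => compEntry c σ C p.1 p'.1 * p'.2.getD 0 0).sum / (u + 1) :: p.2)

/-- The table of the coefficients of the first `l` powers, highest power first. -/
def coeffTab (c : ℕ → ℝ) (σ : ℕ → ℕ → ℝ) (C : List ℕ) (l : ℕ) : List (List ℕ × List ℝ) :=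
  (List.range l).foldl (tabStep c σ C) ((subs C).map fun x => (x, [if x.length = 0 then 1 else 0]))

/-- The coefficients for `x`, highest power first. -/
def coeffList (c : ℕ → ℝ) (σ : ℕ → ℕ → ℝ) (C : List ℕ) (x : List ℕ) : ℕ → List ℝ
  | 0 => [compCoeff c σ C 0 x]
  | l + 1 => compCoeff c σ C (l + 1) x :: coeffList c σ C x l

theorem coeffTab_eq (c : ℕ → ℝ) (σ : ℕ → ℕ → ℝ) (C : List ℕ) (l : ℕ) :
    coeffTab c σ C l = (subs C).map fun x => (x, coeffList c σ C x l) := by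
  induction l with
  | zero => simp [coeffTab, coeffList, compCoeff]
  | succ l ih =>
    rw [coeffTab, List.range_succ, List.foldl_append, List.foldl_cons, List.foldl_nil,
      ← coeffTab, ih, tabStep, List.map_map]
    refine List.map_congr_left fun x _ => ?_
    -- The head of each list is the most recently computed power, the only one the next round needs.
    have h : ∀ x', (coeffList c σ C x' l).getD 0 0 = compCoeff c σ C l x' := fun x' => by
      cases l <;> simp [coeffList]
    simp only [List.map_map, Function.comp_def, coeffList, compCoeff, h]

theorem coeffList_getD (c : ℕ → ℝ) (σ : ℕ → ℕ → ℝ) (C : List ℕ) (x : List ℕ) {l u : ℕ}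
    (h : u ≤ l) : (coeffList c σ C x l).getD (l - u) 0 = compCoeff c σ C u x := by
  induction l with
  | zero =>
    obtain rfl : u = 0 := by omega
    simp [coeffList]
  | succ l ih =>
    rcases Nat.le_succ_iff_eq_or_le.1 h with rfl | h
    · simp [coeffList]
    · rw [coeffList, Nat.succ_sub h, List.getD_cons_succ, ih h]

/-- The sum of the multiplication operators of a component. -/
def compOp (c : ℕ → ℝ) (σ : ℕ → ℕ → ℝ) (C : List ℕ) : Sta →ₗ[ℂ] Sta := (C.map (mulOp c σ)).sum

/-- The state `ψ` is not affected by the signs that arise when the generators in `C` are moved into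
ordered products. -/
def SignFree (σ : ℕ → ℕ → ℝ) (C : List ℕ) (ψ : Sta) : Prop :=
  ∀ q ∈ C, ∀ (c : ℕ → ℝ) (v : Cfg), mulOp c σ q (shift v ψ) =
    ((c q * insSign σ q v : ℝ) : ℂ) • shift (v + ev q) ψ

theorem list_sum_apply (L : List (Sta →ₗ[ℂ] Sta)) (ψ : Sta) : L.sum ψ = (L.map fun f => f ψ).sum := by
  induction L with
  | nil => simp
  | cons f L ih => simp [ih]

theorem compOp_apply (c : ℕ → ℝ) (σ : ℕ → ℕ → ℝ) (C : List ℕ) (ψ : Sta) :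
    compOp c σ C ψ = (C.map fun q => mulOp c σ q ψ).sum := by
  rw [compOp, list_sum_apply, List.map_map]
  rfl

theorem map_list_sum_sta {α : Type*} (f : Sta →ₗ[ℂ] Sta) (L : List α) (g : α → Sta) :
    f (L.map g).sum = (L.map fun a => f (g a)).sum := by
  rw [map_list_sum, List.map_map]
  rfl

theorem list_sum_comm {α β M : Type*} [AddCommMonoid M] (L : List α) (L' : List β)
    (f : α → β → M) :
    (L.map fun a => (L'.map fun b => f a b).sum).sum =
      (L'.map fun b => (L.map fun a => f a b).sum).sum := by
  induction L with
  | nil => simp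
  | cons a L ih => simp [ih, List.sum_map_add]

/-- The combination of translates of `ψ` with the coefficients of the `u`-th power. -/
def compSum (c : ℕ → ℝ) (σ : ℕ → ℕ → ℝ) (C : List ℕ) (u : ℕ) (ψ : Sta) : Sta :=
  ((subs C).map fun x => (compCoeff c σ C u x : ℂ) • shift (ind x) ψ).sum

open Classical in
theorem compSum_zero {c : ℕ → ℝ} {σ : ℕ → ℕ → ℝ} {C : List ℕ} (hC : C.Nodup) (ψ : Sta) :
    compSum c σ C 0 ψ = ψ := by
  have h := sum_subs_ite hC 0 (fun _ _ => rfl) fun v => shift v ψ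
  rw [shift_zero] at h
  conv_rhs => rw [← h]
  refine congrArg List.sum (List.map_congr_left fun x hx => ?_)
  have : ind x = 0 ↔ x = [] := by
    constructor
    · intro h0
      rw [List.eq_nil_iff_forall_not_mem]
      intro w hw
      have := congrFun h0 w
      rw [ind_apply (hC.sublist (sublist_of_mem_subs hx)), if_pos hw] at this
      exact one_ne_zero this
    · rintro rfl
      rfl
  by_cases hx0 : x = []
  · simp [compCoeff, hx0]
  · simp [compCoeff, this, hx0]

theorem sum_smul_list {α : Type*} (L : List α) (f : α → ℝ) (ψ : Sta) :
    (((L.map f).sum : ℝ) : ℂ) • ψ = (L.map fun a => (f a : ℂ) • ψ).sum := by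
  induction L with
  | nil => simp
  | cons a L ih => simp [add_smul, ih]

-- For fixed `x'` each generator `q` of `C` leads to exactly one sublist, and `SignFree` ensures
-- that its sign can be read off from `x'`, whatever the other components contain.
open Classical in
theorem sum_compEntry {c : ℕ → ℝ} {σ : ℕ → ℕ → ℝ} (h1 : ∀ i j, σ i j * σ i j = 1) {C : List ℕ}
    (hC : C.Nodup) {ψ : Sta} (hψ : SignFree σ C ψ) {x' : List ℕ} (hx' : x' ∈ subs C) :
    ((subs C).map fun x => ((compEntry c σ C x x' : ℝ) : ℂ) • shift (ind x) ψ).sum =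
      compOp c σ C (shift (ind x') ψ) := by
  simp only [compEntry, sum_smul_list]
  rw [list_sum_comm, compOp_apply]
  refine congrArg List.sum (List.map_congr_left fun q hq => ?_)
  rw [hψ q hq, ← insSignList_eq h1]
  rw [← sum_subs_ite hC (ind x' + ev q) ?_
    fun v => ((c q * insSignList σ q x' : ℝ) : ℂ) • shift v ψ]
  · refine congrArg List.sum (List.map_congr_left fun x hx => ?_)
    have := toggles_iff hC hq (sublist_of_mem_subs hx) (sublist_of_mem_subs hx')
    by_cases h : Toggles C q x x'
    · rw [if_pos h, if_pos (this.1 h)]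
    · rw [if_neg h, if_neg (mt this.2 h), Complex.ofReal_zero, zero_smul]
  · intro w hw
    have h2 : w ∉ x' := fun h => hw ((sublist_of_mem_subs hx').subset h)
    rw [Pi.add_apply, ind_apply (hC.sublist (sublist_of_mem_subs hx')), if_neg h2,
      ev_of_ne (by rintro rfl; exact hw hq), add_zero]

theorem compSum_succ {c : ℕ → ℝ} {σ : ℕ → ℕ → ℝ} (h1 : ∀ i j, σ i j * σ i j = 1) {C : List ℕ}
    (hC : C.Nodup) {ψ : Sta} (hψ : SignFree σ C ψ) (u : ℕ) :
    ((u : ℂ) + 1) • compSum c σ C (u + 1) ψ = compOp c σ C (compSum c σ C u ψ) := by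
  have hu : (u : ℂ) + 1 ≠ 0 := by exact_mod_cast Nat.succ_ne_zero u
  have e1 : ((u : ℂ) + 1) • compSum c σ C (u + 1) ψ = ((subs C).map fun x =>
      ((subs C).map fun x' => (compCoeff c σ C u x' : ℂ) •
        ((compEntry c σ C x x' : ℝ) : ℂ) • shift (ind x) ψ).sum).sum := by
    rw [compSum, List.smul_sum, List.map_map]
    refine congrArg List.sum (List.map_congr_left fun x _ => ?_)
    rw [Function.comp_apply, compCoeff, smul_smul, Complex.ofReal_div, Complex.ofReal_add,
      Complex.ofReal_natCast, Complex.ofReal_one, mul_div_cancel₀ _ hu, sum_smul_list]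
    refine congrArg List.sum (List.map_congr_left fun x' _ => ?_)
    rw [smul_smul, Complex.ofReal_mul, mul_comm]
  rw [e1, list_sum_comm, compSum, map_list_sum_sta]
  refine congrArg List.sum (List.map_congr_left fun x' hx' => ?_)
  rw [map_smul, ← sum_compEntry h1 hC hψ hx', List.smul_sum, List.map_map]
  rfl

/-- The divisions by `u + 1` in the recursion accumulate to `u!`. Coefficients computed inside the
component thus describe its powers on any sign-free state. -/
theorem compSum_eq {c : ℕ → ℝ} {σ : ℕ → ℕ → ℝ} (h1 : ∀ i j, σ i j * σ i j = 1) {C : List ℕ}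
    (hC : C.Nodup) {ψ : Sta} (hψ : SignFree σ C ψ) (u : ℕ) :
    compSum c σ C u ψ = ((u.factorial : ℂ)⁻¹) • (compOp c σ C ^ u) ψ := by
  induction u with
  | zero => simp [compSum_zero hC]
  | succ u ih =>
    have hu : (u : ℂ) + 1 ≠ 0 := by exact_mod_cast Nat.succ_ne_zero u
    have h := compSum_succ (c := c) h1 hC hψ u
    rw [ih, map_smul, ← Module.End.mul_apply, ← pow_succ'] at h
    rw [Nat.factorial_succ, Nat.cast_mul, mul_inv, mul_smul, ← h, smul_smul, Nat.cast_succ,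
      inv_mul_cancel₀ hu, one_smul]

/-! ### Processing one component -/

/-- The gates that read off whether the particle is in one of the modes `h, …, 2 h - 1`, write the
result to wire `q`, and move the particle to the corresponding mode among `0, …, h - 1`. -/
def emitOne (b h q : ℕ) : List RawGate :=
  (List.range h).flatMap fun u =>
    [rX [b + (h + u)] q, rX [b + (h + u)] (b + u), rX [q, b + u] (b + (h + u))]

/-- The number of modes and the gates that write the subset of `C` encoded in the position of the
particle to the wires in `C`. -/
def emit (b d : ℕ) (C : List ℕ) : ℕ × List RawGate :=
  C.foldr (fun q s => (s.1 + s.1, emitOne b s.1 q ++ s.2)) (d, [])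

theorem emit_cons (b d q : ℕ) (C : List ℕ) : emit b d (q :: C) =
    ((emit b d C).1 + (emit b d C).1, emitOne b (emit b d C).1 q ++ (emit b d C).2) := rfl

theorem emit_fst (b d : ℕ) (C : List ℕ) : (emit b d C).1 = d * 2 ^ C.length := by
  induction C with
  | nil => simp [emit]
  | cons q C ih => rw [emit_cons, ih, List.length_cons, pow_succ]; ring

theorem act_ccx_of_zero {a a' t : ℕ} {x : Cfg} (h : x a = 0 ∨ x a' = 0) :
    act (rX [a, a'] t) (ket x) = ket x := by
  rw [act_rX]
  rcases h with h | h <;> simp [h]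

theorem act_ccx_of_one {a a' t : ℕ} {x : Cfg} (h : x a = 1) (h' : x a' = 1) :
    act (rX [a, a'] t) (ket x) = ket (x + ev t) := by
  rw [act_rX]
  simp [h, h']

theorem run_emitOne_lt {b h q v : ℕ} (hq : q < b) (hv : v < h) :
    run (emitOne b h q) (ket (ev (b + v))) = ket (ev (b + v)) := by
  have key : ∀ k, run ((List.range k).flatMap fun u =>
      [rX [b + (h + u)] q, rX [b + (h + u)] (b + u), rX [q, b + u] (b + (h + u))])
      (ket (ev (b + v))) = ket (ev (b + v)) := by
    intro k
    induction k with
    | zero => rfl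
    | succ k ih =>
      rw [List.range_succ, List.flatMap_append, run_append, ih]
      simp only [List.flatMap_cons, List.flatMap_nil, List.append_nil, run_cons, run_nil]
      rw [act_cx_of_zero (ev_of_ne (by omega)), act_cx_of_zero (ev_of_ne (by omega)),
        act_ccx_of_zero (.inl (ev_of_ne (by omega)))]
  exact key h

/-- In the round `u = v` the gates set `q`, copy the particle to mode `v` and delete the original;
the deletion is controlled by `q` and the copy, so that particles that started in the lower half
stay put. -/
theorem run_emitOne_ge {b h q v : ℕ} (hq : q < b) (hv : v < h) :
    run (emitOne b h q) (ket (ev (b + (h + v)))) = ket (ev (b + v) + ev q) := by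
  have key : ∀ k, run ((List.range k).flatMap fun u =>
      [rX [b + (h + u)] q, rX [b + (h + u)] (b + u), rX [q, b + u] (b + (h + u))])
      (ket (ev (b + (h + v)))) = if v < k then ket (ev (b + v) + ev q)
        else ket (ev (b + (h + v))) := by
    intro k
    induction k with
    | zero => rfl
    | succ k ih =>
      rw [List.range_succ, List.flatMap_append, run_append, ih]
      simp only [List.flatMap_cons, List.flatMap_nil, List.append_nil, run_cons, run_nil]
      split_ifs with h1 h2 h2
      -- After the move `q` is set, but in later rounds mode `k` differs from `v` and is empty, so
      -- nothing is triggered.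
      · have e1 : (ev (b + v) + ev q : Cfg) (b + (h + k)) = 0 := by
          rw [Pi.add_apply, ev_of_ne (by omega), ev_of_ne (by omega), add_zero]
        have e2 : (ev (b + v) + ev q : Cfg) (b + k) = 0 := by
          rw [Pi.add_apply, ev_of_ne (by omega), ev_of_ne (by omega), add_zero]
        rw [act_cx_of_zero e1, act_cx_of_zero e1, act_ccx_of_zero (.inr e2)]
      · omega
      · obtain rfl : v = k := by omega
        have e1 : (ev (b + (h + v)) + ev q : Cfg) (b + (h + v)) = 1 := by
          rw [Pi.add_apply, ev_self, ev_of_ne (by omega), add_zero]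
        have e2 : (ev (b + (h + v)) + ev q + ev (b + v) : Cfg) q = 1 := by
          rw [Pi.add_apply, Pi.add_apply, ev_of_ne (by omega), ev_self, ev_of_ne (by omega)]
          rfl
        have e3 : (ev (b + (h + v)) + ev q + ev (b + v) : Cfg) (b + v) = 1 := by
          rw [Pi.add_apply, Pi.add_apply, ev_of_ne (by omega), ev_of_ne (by omega), ev_self]
          rfl
        rw [act_cx_of_one (ev_self _), act_cx_of_one e1, act_ccx_of_one e2 e3]
        congr 1
        rw [add_comm (ev (b + (h + v))), add_right_comm, cfg_add_add_self, add_comm]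
      · rw [act_cx_of_zero (ev_of_ne (by omega)), act_cx_of_zero (ev_of_ne (by omega)),
          act_ccx_of_zero (.inl (ev_of_ne (by omega)))]
  rw [emitOne, key, if_pos hv]

theorem avoids_rX {cs : List ℕ} {t : ℕ} {v : Cfg} (h : ∀ c ∈ cs, v c = 0) (h' : v t = 0) :
    Avoids (rX cs t) v := ⟨h, h'⟩

theorem forall_mem_emit {Q : RawGate → Prop} {b d : ℕ} {C : List ℕ}
    (hQ : ∀ q ∈ C, ∀ u < d * 2 ^ C.length, ∀ u' < d * 2 ^ C.length, u ≠ u' →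
      Q (rX [b + u] q) ∧ Q (rX [b + u] (b + u')) ∧ Q (rX [q, b + u] (b + u'))) :
    ∀ g ∈ (emit b d C).2, Q g := by
  induction C with
  | nil => simp [emit]
  | cons q C ih =>
    have hlen : d * 2 ^ (q :: C).length = d * 2 ^ C.length + d * 2 ^ C.length := by
      rw [List.length_cons, pow_succ]
      ring
    rw [hlen] at hQ
    intro g hg
    rw [emit_cons, emit_fst] at hg
    rcases List.mem_append.1 hg with hg | hg
    · obtain ⟨u, hu, hg⟩ := List.mem_flatMap.1 hg
      have hu := List.mem_range.1 hu
      have hQ1 := hQ q (by simp) (d * 2 ^ C.length + u) (by omega) u (by omega) (by omega)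
      have hQ2 := hQ q (by simp) u (by omega) (d * 2 ^ C.length + u) (by omega) (by omega)
      simp only [List.mem_cons, List.not_mem_nil, or_false] at hg
      rcases hg with rfl | rfl | rfl
      · exact hQ1.1
      · exact hQ1.2.1
      · exact hQ2.2.2
    · exact ih (fun q hq u hu u' hu' => hQ q (by simp [hq]) u (by omega) u' (by omega)) g hg

theorem ent_append (L M : List (List ℝ)) (v t : ℕ) :
    ent (L ++ M) v t = if v < L.length then ent L v t else ent M (v - L.length) t := by
  unfold ent
  split_ifs with h
  · rw [List.getD_append _ _ _ _ h]
  · rw [List.getD_append_right _ _ _ _ (not_lt.1 h)]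

/-- The modes form one block of length `d` per sublist, in the order of `subs`, so the upper half of
the modes consists of the sublists containing the head `q`. Since `acc` does not use the wires of
`C`, the written bits pass through it as a translation. -/
theorem combo_emit {b d t : ℕ} {C : List ℕ} (hC : C.Nodup) (hb : ∀ q ∈ C, q < b)
    {acc : List RawGate} (hacc : ∀ q ∈ C, ∀ g ∈ acc, Avoids g (ev q))
    (φ : List ℕ → List (List ℝ)) (hφ : ∀ x, (φ x).length = d) :
    ((subs C).flatMap φ).length = d * 2 ^ C.length ∧
    combo b t ((subs C).flatMap φ) ((emit b d C).2 ++ acc) =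
      ((subs C).map fun x => shift (ind x) (combo b t (φ x) acc)).sum := by
  induction C generalizing φ with
  | nil => simp [subs, emit, hφ]
  | cons q C ih =>
    have hC' := List.nodup_cons.1 hC
    have ih := ih hC'.2 (fun q hq => hb q (by simp [hq])) (fun q hq => hacc q (by simp [hq]))
    obtain ⟨l1, c1⟩ := ih φ hφ
    obtain ⟨l2, c2⟩ := ih (fun x => φ (q :: x)) fun x => hφ _
    have hqb : q < b := hb q (by simp)
    have e : (subs (q :: C)).flatMap φ =
        (subs C).flatMap φ ++ (subs C).flatMap fun x => φ (q :: x) := by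
      rw [subs_cons, List.flatMap_append, List.flatMap_map]
    constructor
    · rw [e, List.length_append, l1, l2, List.length_cons, pow_succ]
      ring
    have hav : ∀ g ∈ (emit b d C).2 ++ acc, Avoids g (ev q) := by
      intro g hg
      rcases List.mem_append.1 hg with hg | hg
      · refine forall_mem_emit (Q := fun g => Avoids g (ev q)) (fun j hj u _ u' _ _ => ?_) g hg
        have hjq : j ≠ q := fun h => hC'.1 (h ▸ hj)
        have e1 : ev q j = 0 := ev_of_ne hjq
        have e2 : ∀ u, ev q (b + u) = 0 := fun u => ev_of_ne (by omega)
        exact ⟨avoids_rX (by simp [e2]) e1, avoids_rX (by simp [e2]) (e2 _),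
          avoids_rX (by simp [e1, e2]) (e2 _)⟩
      · exact hacc q (by simp) g hg
    rw [e, combo, List.length_append, Finset.sum_range_add, subs_cons, List.map_append,
      List.sum_append, List.map_map, ← c1]
    congr 1
    · refine Finset.sum_congr rfl fun v hv => ?_
      have hv := Finset.mem_range.1 hv
      rw [ent_append, if_pos hv, emit_cons, List.append_assoc, run_append,
        run_emitOne_lt hqb (by rw [emit_fst, ← l1]; exact hv)]
    · have : ((fun x => shift (ind x) (combo b t (φ x) acc)) ∘ fun x => q :: x) =
          fun x => shift (ev q) (shift (ind x) (combo b t (φ (q :: x)) acc)) := by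
        funext x
        rw [Function.comp_apply, ind_cons, shift_shift, add_comm]
      rw [this, ← map_list_sum_sta, ← c2, combo, map_sum]
      refine Finset.sum_congr rfl fun v hv => ?_
      have hv := Finset.mem_range.1 hv
      rw [ent_append, if_neg (by omega), Nat.add_sub_cancel_left, emit_cons, List.append_assoc,
        run_append, l1, ← emit_fst b d C, run_emitOne_ge hqb (by rw [emit_fst, ← l2]; exact hv),
        ← shift_ket, run_shift hav, map_smul]

/-- The product of two polynomials of degree `l`, up to degree `l`; the coefficients of the first
factor are given in reverse order. -/
def conv (l : ℕ) (f r : List ℝ) : List ℝ :=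
  (List.range (l + 1)).map fun t =>
    ∑ u ∈ Finset.range (t + 1), f.getD (l - u) 0 * r.getD (t - u) 0

/-- The columns after the component with the given table has been processed. -/
def expand (l : ℕ) (tab : List (List ℕ × List ℝ)) (cols : List (List ℝ)) : List (List ℝ) :=
  tab.flatMap fun p => cols.map (conv l p.2)

/-- The first `N` columns. -/
def truncCols (N : ℕ) (cols : List (List ℝ)) : List (List ℝ) :=
  (List.range N).map fun v => cols.getD v []

/-- The processing of one component. -/
def compStep (b l : ℕ) (c : ℕ → ℝ) (σ : ℕ → ℕ → ℝ) (S : ColState) (C : List ℕ) : ColState :=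
  let E := emit b (l + 1) C
  let S' := elim (l + 1) b E.1 (l + 1) (expand l (coeffTab c σ C l) S.1, E.2 ++ S.2)
  (truncCols (l + 1) S'.1, S'.2)

theorem combo_map_conv {b l t : ℕ} (ht : t ≤ l) (f : List ℝ) (cols : List (List ℝ))
    (acc : List RawGate) : combo b t (cols.map (conv l f)) acc =
      ∑ u ∈ Finset.range (t + 1), (f.getD (l - u) 0 : ℂ) • combo b (t - u) cols acc := by
  simp only [combo, List.length_map, Finset.smul_sum, smul_smul]
  rw [Finset.sum_comm]
  refine Finset.sum_congr rfl fun v hv => ?_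
  have hv := Finset.mem_range.1 hv
  rw [← Finset.sum_smul]
  congr 1
  rw [ent, List.getD_eq_getElem (cols.map (conv l f)) [] (by simpa using hv),
    List.getElem_map, conv, getD_map_range,
    if_pos (by omega), Complex.ofReal_sum]
  refine Finset.sum_congr rfl fun u _ => ?_
  rw [Complex.ofReal_mul, ent, List.getD_eq_getElem _ [] hv]

theorem combo_truncCols {b t N : ℕ} {cols : List (List ℝ)} {acc : List RawGate}
    (hN : N ≤ cols.length) (h : ∀ v < cols.length, N ≤ v → ent cols v t = 0) :
    combo b t (truncCols N cols) acc = combo b t cols acc := by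
  rw [combo, combo]
  have hl : (truncCols N cols).length = N := by simp [truncCols]
  rw [hl, ← Finset.sum_subset (Finset.range_subset_range.2 hN)]
  · refine Finset.sum_congr rfl fun v hv => ?_
    rw [ent, ent, truncCols, getD_map_range, if_pos (Finset.mem_range.1 hv)]
  · intro v hv hv'
    rw [h v (Finset.mem_range.1 hv) (not_lt.1 (mt Finset.mem_range.2 hv')), Complex.ofReal_zero,
      zero_smul]

/-- For divided powers of commuting operators the binomial theorem is a plain convolution, which is
what `expand` performs on the rows. After the elimination row `t` is supported on columns up to `t ≤
l`, so dropping the other columns changes no combination. -/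
theorem combo_compStep {b l : ℕ} {c : ℕ → ℝ} {σ : ℕ → ℕ → ℝ} (h1 : ∀ i j, σ i j * σ i j = 1)
    {C : List ℕ} (hC : C.Nodup) (hb : ∀ q ∈ C, q < b) {S : ColState}
    (hS : S.1.length = l + 1) (hacc : ∀ q ∈ C, ∀ g ∈ S.2, Avoids g (ev q)) (T : Sta →ₗ[ℂ] Sta)
    (hT : Commute (compOp c σ C) T) (hfree : ∀ t, SignFree σ C ((T ^ t) (ket 0)))
    (hcombo : ∀ t ≤ l, combo b t S.1 S.2 = ((t.factorial : ℂ)⁻¹) • (T ^ t) (ket 0)) :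
    (compStep b l c σ S C).1.length = l + 1 ∧
    ∀ t ≤ l, combo b t (compStep b l c σ S C).1 (compStep b l c σ S C).2 =
      ((t.factorial : ℂ)⁻¹) • ((compOp c σ C + T) ^ t) (ket 0) := by
  refine ⟨by simp [compStep, truncCols], fun t ht => ?_⟩
  have e : expand l (coeffTab c σ C l) S.1 =
      (subs C).flatMap fun x => S.1.map (conv l (coeffList c σ C x l)) := by
    rw [coeffTab_eq, expand, List.flatMap_map]
  obtain ⟨hlen, hem⟩ := combo_emit (b := b) (d := l + 1) (t := t) hC hb hacc
    (fun x => S.1.map (conv l (coeffList c σ C x l))) fun x => by simp [hS]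
  have hpow : 0 < 2 ^ C.length := Nat.pow_pos (by norm_num)
  have hle : l + 1 ≤ (l + 1) * 2 ^ C.length := Nat.le_mul_of_pos_right _ hpow
  have inv := ElimInv.elim (rows := l + 1) (b := b) (r := l + 1) (N := (emit b (l + 1) C).1)
    (S := (expand l (coeffTab c σ C l) S.1, (emit b (l + 1) C).2 ++ S.2))
    (by rw [e, hlen, emit_fst]) le_rfl
  rw [compStep]
  simp only
  rw [combo_truncCols, inv.combo_eq t (by omega), e, hem]
  · simp only [combo_map_conv ht]
    have e2 : ∀ x, (∑ u ∈ Finset.range (t + 1), ((coeffList c σ C x l).getD (l - u) 0 : ℂ) •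
        combo b (t - u) S.1 S.2) = ∑ u ∈ Finset.range (t + 1), (compCoeff c σ C u x : ℂ) •
        ((((t - u).factorial : ℂ)⁻¹) • (T ^ (t - u)) (ket 0)) := fun x =>
      Finset.sum_congr rfl fun u hu => by
        have := Finset.mem_range.1 hu
        rw [coeffList_getD _ _ _ _ (by omega), hcombo _ (by omega)]
    simp only [e2, map_sum, map_smul]
    have e3 : ∀ (L : List (List ℕ)) (F : ℕ → List ℕ → Sta),
        (L.map fun x => ∑ u ∈ Finset.range (t + 1), F u x).sum =
          ∑ u ∈ Finset.range (t + 1), (L.map (F u)).sum := by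
      intro L F
      induction L with
      | nil => simp
      | cons x L ih => simp [ih, Finset.sum_add_distrib]
    rw [e3, hT.add_pow, LinearMap.sum_apply, Finset.smul_sum]
    refine Finset.sum_congr rfl fun u hu => ?_
    have hu : u ≤ t := by have := Finset.mem_range.1 hu; omega
    have e4 := compSum_eq (c := c) h1 hC (hfree (t - u)) u
    rw [compSum] at e4
    have e5 : ((subs C).map fun x => (compCoeff c σ C u x : ℂ) •
        ((t - u).factorial : ℂ)⁻¹ • shift (ind x) ((T ^ (t - u)) (ket 0))).sum =
        ((t - u).factorial : ℂ)⁻¹ • ((subs C).map fun x => (compCoeff c σ C u x : ℂ) •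
          shift (ind x) ((T ^ (t - u)) (ket 0))).sum := by
      rw [List.smul_sum, List.map_map]
      refine congrArg List.sum (List.map_congr_left fun x _ => ?_)
      rw [Function.comp_apply, smul_comm]
    rw [e5, e4, smul_smul, Module.End.mul_apply, Module.End.mul_apply]
    have e6 : ((t.choose u : Module.End ℂ Sta)) (ket 0) = (t.choose u : ℂ) • ket 0 := by
      rw [← nsmul_one, LinearMap.smul_apply, Module.End.one_apply, Nat.cast_smul_eq_nsmul]
    rw [e6, map_smul, map_smul, smul_smul]
    congr 1
    have f1 : (t.factorial : ℂ) ≠ 0 := by exact_mod_cast t.factorial_ne_zero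
    have f2 : (u.factorial : ℂ) ≠ 0 := by exact_mod_cast u.factorial_ne_zero
    have f3 : ((t - u).factorial : ℂ) ≠ 0 := by exact_mod_cast (t - u).factorial_ne_zero
    have f4 : (t.choose u : ℂ) * u.factorial * (t - u).factorial = t.factorial := by
      exact_mod_cast Nat.choose_mul_factorial_mul_factorial hu
    field_simp
    rw [← f4]
    ring
  · rw [inv.len, emit_fst]
    exact hle
  · intro v hv hv'
    rw [inv.len] at hv
    exact inv.zero t (by omega) v hv (by omega)

/-! ### Connected components -/

/-- All pairs of vertices. -/
def allPairs (m : ℕ) : List (ℕ × ℕ) :=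
  (List.range m).flatMap fun i => (List.range m).map fun j => (i, j)

/-- Merging of the labels of two anticommuting vertices. -/
def labStep (σ : ℕ → ℕ → ℝ) (lab : List ℕ) (p : ℕ × ℕ) : List ℕ :=
  if σ p.1 p.2 < 0 then lab.map fun x => if x = lab.getD p.2 0 then lab.getD p.1 0 else x else lab

/-- Labels of the vertices that distinguish the connected components of the anticommutation graph. -/
def labels (σ : ℕ → ℕ → ℝ) (m : ℕ) : List ℕ := (allPairs m).foldl (labStep σ) (List.range m)

/-- The connected components; component `r` consists of the vertices with label `r`. -/
def comps (m : ℕ) (lab : List ℕ) : List (List ℕ) :=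
  (List.range m).map fun r => (List.range m).filter fun i => lab.getD i 0 = r

/-- The labels are defined on `0, …, m - 1`, and equal labels imply that the vertices are related. -/
structure LabInv (R : ℕ → ℕ → Prop) (m : ℕ) (lab : List ℕ) : Prop where
  len : lab.length = m
  lt : ∀ v < m, lab.getD v 0 < m
  rel : ∀ v < m, ∀ w < m, lab.getD v 0 = lab.getD w 0 → R v w

theorem getD_map_lt {α β : Type*} (f : α → β) {L : List α} {v : ℕ} (h : v < L.length) (d : α)
    (d' : β) : (L.map f).getD v d' = f (L.getD v d) := by
  rw [List.getD_eq_getElem _ _ (by simpa using h), List.getElem_map, List.getD_eq_getElem _ _ h]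

/-- Merging never separates equal labels, so a pair identified once stays identified. Conversely
every new coincidence of labels is explained by the edge just treated. -/
theorem LabInv.foldl {σ : ℕ → ℕ → ℝ} {R : ℕ → ℕ → Prop} (hR : Equivalence R) {m : ℕ}
    (hσ : ∀ i < m, ∀ j < m, σ i j < 0 → R i j) (L : List (ℕ × ℕ))
    (hL : ∀ p ∈ L, p.1 < m ∧ p.2 < m) {lab : List ℕ} (h : LabInv R m lab) :
    LabInv R m (L.foldl (labStep σ) lab) ∧
    (∀ v < m, ∀ w < m, lab.getD v 0 = lab.getD w 0 →
      (L.foldl (labStep σ) lab).getD v 0 = (L.foldl (labStep σ) lab).getD w 0) ∧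
    ∀ p ∈ L, σ p.1 p.2 < 0 →
      (L.foldl (labStep σ) lab).getD p.1 0 = (L.foldl (labStep σ) lab).getD p.2 0 := by
  induction L generalizing lab with
  | nil => exact ⟨h, fun _ _ _ _ h => h, by simp⟩
  | cons p L ih =>
    obtain ⟨h1, h2⟩ := hL p (by simp)
    have key : LabInv R m (labStep σ lab p) ∧ (∀ v < m, ∀ w < m, lab.getD v 0 = lab.getD w 0 →
        (labStep σ lab p).getD v 0 = (labStep σ lab p).getD w 0) ∧
        (σ p.1 p.2 < 0 → (labStep σ lab p).getD p.1 0 = (labStep σ lab p).getD p.2 0) := by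
      by_cases hs : σ p.1 p.2 < 0
      · have e : ∀ v < m, (labStep σ lab p).getD v 0 =
            if lab.getD v 0 = lab.getD p.2 0 then lab.getD p.1 0 else lab.getD v 0 := by
          intro v hv
          rw [labStep, if_pos hs, getD_map_lt _ (by rw [h.len]; exact hv) 0]
        refine ⟨⟨by simp [labStep, hs, h.len], fun v hv => ?_, fun v hv w hw hvw => ?_⟩,
          fun v hv w hw hvw => ?_, fun _ => ?_⟩
        · rw [e v hv]
          split_ifs
          · exact h.lt _ h1
          · exact h.lt v hv
        · rw [e v hv, e w hw] at hvw
          have h12 := hσ _ h1 _ h2 hs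
          -- In the two mixed cases exactly one of `v` and `w` was relabelled, and the chain between
          -- them runs through the edge `p`.
          split_ifs at hvw with ha hb hb
          · exact h.rel v hv w hw (ha.trans hb.symm)
          · exact hR.trans (h.rel v hv _ h2 ha) (hR.trans (hR.symm h12) (h.rel _ h1 w hw hvw))
          · exact hR.trans (h.rel v hv _ h1 hvw) (hR.trans h12 (h.rel _ h2 w hw hb.symm))
          · exact h.rel v hv w hw hvw
        · rw [e v hv, e w hw, hvw]
        · rw [e _ h1, e _ h2, if_pos rfl, ite_eq_left_iff]
          exact fun _ => rfl
      · have e : labStep σ lab p = lab := if_neg hs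
        rw [e]
        exact ⟨h, fun _ _ _ _ h => h, fun h => absurd h hs⟩
    obtain ⟨k1, k2, k3⟩ := ih (fun p hp => hL p (by simp [hp])) key.1
    refine ⟨k1, fun v hv w hw hvw => k2 v hv w hw (key.2.1 v hv w hw hvw), fun p' hp' hs => ?_⟩
    rcases List.mem_cons.1 hp' with rfl | hp'
    · exact k2 _ h1 _ h2 (key.2.2 hs)
    · exact k3 p' hp' hs

theorem labels_spec {σ : ℕ → ℕ → ℝ} {R : ℕ → ℕ → Prop} (hR : Equivalence R) {m : ℕ}
    (hσ : ∀ i < m, ∀ j < m, σ i j < 0 → R i j) :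
    LabInv R m (labels σ m) ∧
    ∀ i < m, ∀ j < m, σ i j < 0 → (labels σ m).getD i 0 = (labels σ m).getD j 0 := by
  have e : ∀ v < m, (List.range m).getD v 0 = v := fun v hv => by
    rw [List.getD_eq_getElem _ _ (by simpa using hv), List.getElem_range]
  have h := LabInv.foldl hR hσ (allPairs m) (fun p hp => by
    simp only [allPairs, List.mem_flatMap, List.mem_map, List.mem_range] at hp
    obtain ⟨i, hi, j, hj, rfl⟩ := hp
    exact ⟨hi, hj⟩) (lab := List.range m)
    ⟨by simp, fun v hv => by rw [e v hv]; exact hv, fun v hv w hw h => by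
      rw [e v hv, e w hw] at h
      exact h ▸ hR.refl v⟩
  refine ⟨h.1, fun i hi j hj hs => h.2.2 (i, j) ?_ hs⟩
  simp only [allPairs, List.mem_flatMap, List.mem_map, List.mem_range]
  exact ⟨i, hi, j, hj, rfl⟩

/-! ### The preparation circuit -/

/-- The single column that represents the state before any component is processed. -/
def initCols (l : ℕ) : List (List ℝ) := (List.range (l + 1)).map fun v => if v = 0 then [1] else []

/-- The amplitudes of the particle after all components have been processed, and an additional `0`. -/
def finalCols (l : ℕ) (a : ℕ → ℝ) (cols : List (List ℝ)) : List (List ℝ) :=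
  (List.range (l + 2)).map fun v =>
    [∑ s ∈ Finset.range (l + 1), a s * (∏ j ∈ Finset.range s, ((j : ℝ) + 1)) * ent cols v s]

/-- The circuit that prepares the reference state. -/
def prepCircuit (b l : ℕ) (c : ℕ → ℝ) (σ : ℕ → ℕ → ℝ) (a : ℕ → ℝ) (Cs : List (List ℕ)) :
    List RawGate :=
  let S := Cs.foldl (compStep b l c σ) (initCols l, [rX [] b])
  rX [] b :: (elim 1 b (l + 2) 1 (finalCols l a S.1, S.2)).2

/-- The operator that multiplies basis states by the signs of the insertions of the `q`-th generator. -/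
def signOp (σ : ℕ → ℕ → ℝ) (q : ℕ) : Sta →ₗ[ℂ] Sta :=
  Finsupp.linearCombination ℂ fun y => ((insSign σ q y : ℝ) : ℂ) • ket y

@[simp] theorem signOp_ket (σ : ℕ → ℕ → ℝ) (q : ℕ) (y : Cfg) :
    signOp σ q (ket y) = ((insSign σ q y : ℝ) : ℂ) • ket y := by
  simp [signOp, ket]

/-- By `insSign_add` the sign splits into a part for the translation and a part for the state, the
latter isolated in `signOp`. -/
theorem mulOp_shift {σ : ℕ → ℕ → ℝ} (h1 : ∀ i j, σ i j * σ i j = 1) (c : ℕ → ℝ) (q : ℕ) (v : Cfg)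
    (ψ : Sta) : mulOp c σ q (shift v ψ) =
      ((c q * insSign σ q v : ℝ) : ℂ) • shift (v + ev q) (signOp σ q ψ) := by
  have : mulOp c σ q ∘ₗ shift v =
      ((c q * insSign σ q v : ℝ) : ℂ) • shift (v + ev q) ∘ₗ signOp σ q := sta_hom_ext fun y => by
    simp only [LinearMap.comp_apply, shift_ket, mulOp_ket, LinearMap.smul_apply, signOp_ket,
      map_smul, smul_smul, insSign_add h1, add_assoc]
    congr 1
    push_cast
    ring
  exact LinearMap.congr_fun this ψ

theorem commute_signOp_mulOp {σ : ℕ → ℕ → ℝ} (h1 : ∀ i j, σ i j * σ i j = 1) (c : ℕ → ℝ) {q j : ℕ}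
    (h : σ q j = 1) : Commute (signOp σ q) (mulOp c σ j) := by
  refine sta_hom_ext fun y => ?_
  simp only [Module.End.mul_apply, mulOp_ket, map_smul, smul_smul, insSign_add h1, insSign_ev, h,
    ite_self, mul_one, signOp_ket]
  rw [mul_comm]

/-- `signOp` fixes the zero string; if it commutes with `T`, it fixes every `T^t |0⟩`. For `T` built
from other components the commutation holds because their generators commute with `q`. -/
theorem signFree_pow {σ : ℕ → ℕ → ℝ} (h1 : ∀ i j, σ i j * σ i j = 1) {C : List ℕ}
    {T : Sta →ₗ[ℂ] Sta} (hT : ∀ q ∈ C, Commute (signOp σ q) T) (t : ℕ) :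
    SignFree σ C ((T ^ t) (ket 0)) := by
  intro q hq c v
  have e : signOp σ q ((T ^ t) (ket 0)) = (T ^ t) (ket 0) := by
    rw [← Module.End.mul_apply, ((hT q hq).pow_right t).eq, Module.End.mul_apply, signOp_ket,
      insSign_zero, Complex.ofReal_one, one_smul]
  rw [mulOp_shift h1, e]

theorem compOp_filter (c : ℕ → ℝ) (σ : ℕ → ℕ → ℝ) (m : ℕ) (p : ℕ → Prop) [DecidablePred p] :
    compOp c σ ((List.range m).filter fun i => p i) =
      ∑ q ∈ (Finset.range m).filter p, mulOp c σ q := by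
  rw [compOp, ← List.sum_toFinset _ (List.nodup_range.filter _), List.toFinset_filter,
    List.toFinset_range]
  simp

theorem length_subs (C : List ℕ) : (subs C).length = 2 ^ C.length := by
  induction C with
  | nil => rfl
  | cons q C ih =>
    rw [subs_cons, List.length_append, List.length_map, ih, List.length_cons, pow_succ]
    ring

theorem length_expand (l : ℕ) (c : ℕ → ℝ) (σ : ℕ → ℕ → ℝ) (C : List ℕ) (cols : List (List ℝ)) :
    (expand l (coeffTab c σ C l) cols).length = cols.length * 2 ^ C.length := by
  rw [coeffTab_eq, expand, List.flatMap_map, List.length_flatMap]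
  simp [length_subs, mul_comm]

theorem forall_mem_compStep {Q : RawGate → Prop} {b l : ℕ} {c : ℕ → ℝ} {σ : ℕ → ℕ → ℝ}
    {S : ColState} {C : List ℕ} (hlen : S.1.length = l + 1) (hS : ∀ g ∈ S.2, Q g)
    (hE : ∀ g ∈ (emit b (l + 1) C).2, Q g)
    (hR : ∀ i < (l + 1) * 2 ^ C.length, ∀ j < (l + 1) * 2 ^ C.length, i ≠ j → ∀ c s : ℝ,
      c * c + s * s = 1 → ∀ g ∈ rotGates b i j c s, Q g) :
    ∀ g ∈ (compStep b l c σ S C).2, Q g := by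
  have e : (expand l (coeffTab c σ C l) S.1).length = (emit b (l + 1) C).1 := by
    rw [length_expand, emit_fst, hlen]
  refine (ElimInv.elim (rows := l + 1) (b := b) (r := l + 1)
    (S := (expand l (coeffTab c σ C l) S.1, (emit b (l + 1) C).2 ++ S.2)) e le_rfl).gates Q
    (fun g hg => (List.mem_append.1 hg).elim (hE g) (hS g)) ?_
  rw [emit_fst]
  exact hR

theorem avoids_rotGates {b q i j : ℕ} (hq : q < b) (c s : ℝ) :
    ∀ g ∈ rotGates b i j c s, Avoids g (ev q) := by
  have e : ∀ u, ev q (b + u) = 0 := fun u => ev_of_ne (by omega)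
  intro g hg
  simp only [rotGates, List.mem_cons, List.not_mem_nil, or_false] at hg
  rcases hg with rfl | rfl | rfl
  · exact avoids_rX (by simp [e]) (e _)
  · exact ⟨by simp [rRot, e], e _⟩
  · exact avoids_rX (by simp [e]) (e _)

theorem avoids_emit {b d q : ℕ} {C : List ℕ} (hq : q < b) (hC : ∀ j ∈ C, j ≠ q) :
    ∀ g ∈ (emit b d C).2, Avoids g (ev q) := by
  have e : ∀ u, ev q (b + u) = 0 := fun u => ev_of_ne (by omega)
  refine forall_mem_emit fun j hj u _ u' _ _ => ?_
  have e1 : ev q j = 0 := ev_of_ne (hC j hj)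
  exact ⟨avoids_rX (by simp [e]) e1, avoids_rX (by simp [e]) (e _),
    avoids_rX (by simp [e1, e]) (e _)⟩

/-- The state of the preparation after the components `0, …, r - 1` have been processed. -/
structure PrepInv (b l m : ℕ) (c : ℕ → ℝ) (σ : ℕ → ℕ → ℝ) (lab : List ℕ) (r : ℕ) (S : ColState) :
    Prop where
  len : S.1.length = l + 1
  avoids : ∀ q < m, r ≤ lab.getD q 0 → ∀ g ∈ S.2, Avoids g (ev q)
  combo_eq : ∀ t ≤ l, combo b t S.1 S.2 = ((t.factorial : ℂ)⁻¹) •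
    ((compOp c σ ((List.range m).filter fun q => lab.getD q 0 < r)) ^ t) (ket 0)

/-- Vertices with different labels commute, so each new component commutes with the earlier ones and
its signs do not interfere with theirs. This provides the hypotheses of `combo_compStep` in every
round. -/
theorem PrepInv.foldl {b l m : ℕ} {c : ℕ → ℝ} {σ : ℕ → ℕ → ℝ} {lab : List ℕ}
    (hσ : ∀ i j, σ i j = 1 ∨ σ i j = -1) (hb : m ≤ b)
    (hlab : ∀ i < m, ∀ j < m, σ i j < 0 → lab.getD i 0 = lab.getD j 0) (r : ℕ) :
    PrepInv b l m c σ lab r (((List.range r).map fun r =>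
      (List.range m).filter fun i => lab.getD i 0 = r).foldl (compStep b l c σ)
        (initCols l, [rX [] b])) := by
  have h1 : ∀ i j, σ i j * σ i j = 1 := fun i j => by rcases hσ i j with h | h <;> simp [h]
  have hne : ∀ i < m, ∀ j < m, lab.getD i 0 ≠ lab.getD j 0 → σ i j = 1 := fun i hi j hj h =>
    (hσ i j).resolve_right fun h' => h (hlab i hi j hj (by rw [h']; norm_num))
  induction r with
  | zero =>
    refine ⟨by simp [initCols], fun q hq _ g hg => ?_, fun t ht => ?_⟩
    · obtain rfl := List.mem_singleton.1 hg
      exact avoids_rX (by simp) (ev_of_ne (by omega))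
    · rw [combo]
      have hlen : (initCols l).length = l + 1 := by simp [initCols]
      simp only [List.map_nil, List.range_zero, List.foldl_nil, hlen]
      rw [Finset.sum_eq_single 0]
      -- Before any component is treated, `T = 0`: the circuit only removes the particle from mode
      -- `0`, and the matrix has its single nonzero entry in row `0`.
      · rw [run_cons, run_nil, act_rX]
        have : ev (b + 0) + Pi.single b (List.map (ev (b + 0)) []).prod = 0 := by
          simp only [add_zero, List.map_nil, List.prod_nil]
          exact cfg_add_self _
        rw [this, ent, initCols, getD_map_range, if_pos (by omega), if_pos rfl]
        cases t <;> simp [compOp]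
      · intro v hv hv0
        rw [ent, initCols, getD_map_range, if_pos (Finset.mem_range.1 hv), if_neg hv0]
        simp
      · intro h
        exact absurd (Finset.mem_range.2 (Nat.succ_pos l)) h
  | succ r ih =>
    rw [List.range_succ, List.map_append, List.foldl_append, List.map_singleton, List.foldl_cons,
      List.foldl_nil]
    generalize List.foldl _ _ _ = S at ih ⊢
    have hmem : ∀ q, (q ∈ (List.range m).filter fun i => lab.getD i 0 = r) ↔
        q < m ∧ lab.getD q 0 = r := fun q => by simp
    have hcomm : ∀ (f : Sta →ₗ[ℂ] Sta), (∀ j < m, lab.getD j 0 < r → Commute f (mulOp c σ j)) →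
        Commute f (compOp c σ ((List.range m).filter fun q => lab.getD q 0 < r)) := by
      intro f hf
      rw [compOp_filter]
      refine Commute.sum_right _ _ _ fun j hj => ?_
      obtain ⟨h2, h3⟩ := Finset.mem_filter.1 hj
      exact hf j (Finset.mem_range.1 h2) h3
    obtain ⟨k1, k2⟩ := combo_compStep (b := b) (l := l) (c := c) h1
      (C := (List.range m).filter fun i => lab.getD i 0 = r) (List.nodup_range.filter _)
      (fun q hq => ((hmem q).1 hq).1.trans_le hb) ih.len
      (fun q hq => ih.avoids q ((hmem q).1 hq).1 ((hmem q).1 hq).2.ge)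
      (compOp c σ ((List.range m).filter fun q => lab.getD q 0 < r)) (hcomm _ fun j hj hjr => by
        rw [compOp_filter]
        refine Commute.sum_left _ _ _ fun i hi => ?_
        obtain ⟨h2, h3⟩ := Finset.mem_filter.1 hi
        have h2 := Finset.mem_range.1 h2
        exact mulOp_commute h1 (hne i h2 j hj (by omega)) (hne j hj i h2 (by omega)))
      (signFree_pow h1 fun q hq => hcomm _ fun j hj hjr => commute_signOp_mulOp h1 c
        (hne q ((hmem q).1 hq).1 j hj (by have := ((hmem q).1 hq).2; omega))) ih.combo_eq
    refine ⟨k1, fun q hq hr => ?_, fun t ht => ?_⟩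
    · refine forall_mem_compStep ih.len (ih.avoids q hq (by omega))
        (avoids_emit (by omega) fun j hj hjq => ?_) fun i _ j _ _ c s _ =>
        avoids_rotGates (by omega) c s
      have := ((hmem j).1 hj).2
      rw [hjq] at this
      omega
    · rw [k2 t ht, compOp_filter, compOp_filter, compOp_filter, ← Finset.sum_union]
      · congr 4
        ext q
        simp only [Finset.mem_union, Finset.mem_filter, Finset.mem_range]
        omega
      · rw [Finset.disjoint_filter]
        intro q _ h
        omega

/-- A single row of coefficients can be rotated into mode `0` altogether, and `κ` is the entry left
there. The weights `s!` in `finalCols` undo the division in the stored powers. -/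
theorem prepCircuit_spec {b l m : ℕ} {c : ℕ → ℝ} {σ : ℕ → ℕ → ℝ} {lab : List ℕ}
    (hσ : ∀ i j, σ i j = 1 ∨ σ i j = -1) (hb : m ≤ b)
    (hlab : ∀ i < m, ∀ j < m, σ i j < 0 → lab.getD i 0 = lab.getD j 0)
    (hlt : ∀ i < m, lab.getD i 0 < m) (a : ℕ → ℝ) :
    ∃ κ : ℝ, 0 ≤ κ ∧ (κ : ℂ) • run (prepCircuit b l c σ a (comps m lab)) (ket 0) =
      ∑ s ∈ Finset.range (l + 1), (a s : ℂ) •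
        ((∑ q ∈ Finset.range m, mulOp c σ q) ^ s) (ket 0) := by
  have h := PrepInv.foldl (b := b) (l := l) (c := c) hσ hb hlab m
  have hT : compOp c σ ((List.range m).filter fun q => lab.getD q 0 < m) =
      ∑ q ∈ Finset.range m, mulOp c σ q := by
    rw [compOp_filter, Finset.filter_true_of_mem]
    exact fun q hq => hlt q (Finset.mem_range.1 hq)
  rw [prepCircuit, comps]
  generalize List.foldl _ _ _ = S at h ⊢
  have hc := h.combo_eq
  rw [hT] at hc
  have hlen : (finalCols l a S.1).length = l + 2 := by simp [finalCols]
  have inv := ElimInv.elimRow (rows := 1) (b := b) (i := 0) (S := (finalCols l a S.1, S.2))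
    one_pos (ElimInv.elim (rows := 1) (r := 0) hlen (by omega)) (le_refl (l + 2))
  have e2 : elimRow 1 b 0 (l + 2) (finalCols l a S.1, S.2) =
      elim 1 b (l + 2) 1 (finalCols l a S.1, S.2) := rfl
  rw [e2] at inv
  -- The extra zero column forces at least one rotation even for `l = 0`, where a lone entry could
  -- otherwise be negative.
  refine ⟨_, inv.pos (by omega), ?_⟩
  have h0 := inv.combo_eq 0 one_pos
  simp only at h0 ⊢
  generalize elim 1 b (l + 2) 1 (finalCols l a S.1, S.2) = S' at inv h0 ⊢
  rw [combo, inv.len, Finset.sum_eq_single 0] at h0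
  · rw [run_cons, act_rX]
    have : (0 : Cfg) + Pi.single b (List.map (0 : Cfg) []).prod = ev (b + 0) := by
      simp
    rw [this, h0, combo, hlen]
    have hent : ∀ v < l + 2, ent (finalCols l a S.1) v 0 = ∑ s ∈ Finset.range (l + 1),
        a s * (∏ j ∈ Finset.range s, ((j : ℝ) + 1)) * ent S.1 v s := fun v hv => by
      rw [ent, finalCols, getD_map_range, if_pos hv]
      rfl
    rw [Finset.sum_congr rfl fun v hv => by rw [hent v (Finset.mem_range.1 hv)]]
    simp only [Complex.ofReal_sum, Finset.sum_smul]
    rw [Finset.sum_comm]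
    refine Finset.sum_congr rfl fun s hs => ?_
    have hf : (∏ j ∈ Finset.range s, ((j : ℝ) + 1)) = s.factorial := by
      rw [← Finset.prod_range_add_one_eq_factorial]
      push_cast
      rfl
    have hf' : (s.factorial : ℂ) ≠ 0 := by exact_mod_cast s.factorial_ne_zero
    have h5 := hc s (by have := Finset.mem_range.1 hs; omega)
    rw [combo, h.len] at h5
    have h6 : ent S.1 (l + 1) s = 0 := by
      rw [ent, List.getD_eq_default _ _ h.len.le]
      rfl
    rw [Finset.sum_range_succ, h6, mul_zero, Complex.ofReal_zero, zero_smul, add_zero]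
    have h7 : (a s : ℂ) • ((∑ q ∈ Finset.range m, mulOp c σ q) ^ s) (ket 0) =
        ((a s * s.factorial : ℝ) : ℂ) • ((s.factorial : ℂ)⁻¹ •
          ((∑ q ∈ Finset.range m, mulOp c σ q) ^ s) (ket 0)) := by
      rw [smul_smul]
      push_cast
      rw [mul_assoc, mul_inv_cancel₀ hf', mul_one]
    rw [h7, ← h5, Finset.smul_sum]
    refine Finset.sum_congr rfl fun v _ => ?_
    rw [hf, smul_smul, ← Complex.ofReal_mul]
  · intro v hv hv0
    rw [inv.row v (Finset.mem_range.1 hv) (Nat.pos_of_ne_zero hv0), Complex.ofReal_zero, zero_smul]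
  · intro h
    exact absurd (Finset.mem_range.2 (Nat.succ_pos _)) h

/-! ### Well-formedness of the preparation circuit -/

theorem unitary_of_entries {g : RawGate}
    (h : ∀ a b, ∑ j, RawGate.U g a j * star (RawGate.U g b j) = if a = b then 1 else 0) :
    RawGate.U g ∈ Matrix.unitaryGroup (ZMod 2) ℂ := by
  rw [Matrix.mem_unitaryGroup_iff]
  ext a b
  rw [Matrix.mul_apply, Matrix.one_apply]
  exact h a b

theorem valid_rX {N t : ℕ} {cs : List ℕ} (h : cs.length ≤ 2) (hcs : ∀ c ∈ cs, c < N) (ht : t < N)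
    (h' : t ∉ cs) : Valid N (rX cs t) := by
  refine ⟨h, hcs, ht, h', unitary_of_entries fun a b => ?_⟩
  rw [sum_zmod_two]
  rcases zmod_two_cases a with rfl | rfl <;> rcases zmod_two_cases b with rfl | rfl <;>
    simp [RawGate.U, rX]

theorem valid_rRot {N i j : ℕ} {c s : ℝ} (hi : i < N) (hj : j < N) (hij : i ≠ j)
    (h : c * c + s * s = 1) : Valid N (rRot i j c s) := by
  refine ⟨by simp [rRot], by simpa [rRot] using hi, hj, by simpa [rRot] using hij.symm,
    unitary_of_entries fun a b => ?_⟩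
  have h' : (c : ℂ) * c + s * s = 1 := by exact_mod_cast h
  have h3 : decodeComplex (-s, 0) = -(s : ℂ) := by rw [decodeComplex_real, Complex.ofReal_neg]
  rw [sum_zmod_two]
  rcases zmod_two_cases a with rfl | rfl <;> rcases zmod_two_cases b with rfl | rfl <;>
    simp [RawGate.U, rRot, h3] <;> first | linear_combination h' | ring

theorem valid_rotGates {N b i j : ℕ} {c s : ℝ} (hi : b + i < N) (hj : b + j < N) (hij : i ≠ j)
    (h : c * c + s * s = 1) : ∀ g ∈ rotGates b i j c s, Valid N g := by
  intro g hg
  simp only [rotGates, List.mem_cons, List.not_mem_nil, or_false] at hg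
  rcases hg with rfl | rfl | rfl
  · exact valid_rX (by simp) (by simpa using hj) hi (by simpa using hij)
  · exact valid_rRot hi hj (by omega) h
  · exact valid_rX (by simp) (by simpa using hj) hi (by simpa using hij)

theorem length_compStep {b l : ℕ} {c : ℕ → ℝ} {σ : ℕ → ℕ → ℝ} {S : ColState} {C : List ℕ} :
    (compStep b l c σ S C).1.length = l + 1 := by
  simp [compStep, truncCols]

theorem valid_prepCircuit {N b l : ℕ} {c a : ℕ → ℝ} {σ : ℕ → ℕ → ℝ} {Cs : List (List ℕ)}
    (h0 : b + (l + 2) ≤ N) (hC : ∀ C ∈ Cs, b + (l + 1) * 2 ^ C.length ≤ N ∧ ∀ q ∈ C, q < b) :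
    ∀ g ∈ prepCircuit b l c σ a Cs, Valid N g := by
  have key : ∀ (Cs : List (List ℕ)) (S : ColState),
      (∀ C ∈ Cs, b + (l + 1) * 2 ^ C.length ≤ N ∧ ∀ q ∈ C, q < b) →
      S.1.length = l + 1 → (∀ g ∈ S.2, Valid N g) →
      ∀ g ∈ (Cs.foldl (compStep b l c σ) S).2, Valid N g := by
    intro Cs
    induction Cs with
    | nil => exact fun S _ _ h => h
    | cons C Cs ih =>
      intro S hC hlen hS
      obtain ⟨h1, h2⟩ := hC C (by simp)
      refine ih _ (fun C' h => hC C' (by simp [h])) length_compStep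
        (forall_mem_compStep hlen hS (forall_mem_emit fun q hq u hu u' hu' huu => ?_)
          fun i hi j hj hij c s h => valid_rotGates (by omega) (by omega) hij h)
      have := h2 q hq
      refine ⟨valid_rX (by simp) ?_ (by omega) ?_, valid_rX (by simp) ?_ (by omega) ?_,
        valid_rX (by simp) ?_ (by omega) ?_⟩ <;> simp <;> omega
  have hX : Valid N (rX [] b) := valid_rX (by simp) (by simp) (by omega) (by simp)
  intro g hg
  rw [prepCircuit] at hg
  rcases List.mem_cons.1 hg with rfl | hg
  · exact hX
  have hlen : ∀ S : ColState, (finalCols l a S.1, S.2).1.length = l + 2 := fun S => by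
    simp [finalCols]
  refine (ElimInv.elim (rows := 1) (r := 1) (b := b) (hlen _) le_rfl).gates _
    (key Cs (initCols l, [rX [] b]) hC (by simp [initCols]) ?_) ?_ g hg
  · simpa using hX
  · exact fun i hi j hj hij c s h => valid_rotGates (by omega) (by omega) hij h

/-! ### The components of the anticommutation graph -/

namespace PauliHamiltonian

variable {n m : ℕ} (H : PauliHamiltonian n m)

/-- Two vertices lie in the same component of the anticommutation graph. -/
def Conn (v w : ℕ) : Prop :=
  v = w ∨ ∃ (hv : v < m) (hw : w < m), H.anticommGraph.Reachable ⟨v, hv⟩ ⟨w, hw⟩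

theorem conn_equivalence : Equivalence H.Conn where
  refl _ := .inl rfl
  symm := by
    rintro x y (h | ⟨hv, hw, h⟩)
    · exact .inl h.symm
    · exact .inr ⟨hw, hv, h.symm⟩
  trans := by
    rintro x y z (rfl | ⟨hv, hw, h⟩) (rfl | ⟨hv', hw', h'⟩)
    · exact .inl rfl
    · exact .inr ⟨hv', hw', h'⟩
    · exact .inr ⟨hv, hw, h⟩
    · exact .inr ⟨hv, hw', h.trans h'⟩

theorem conn_of_sg_neg {i j : ℕ} (hi : i < m) (hj : j < m) (h : H.sg i j < 0) : H.Conn i j := by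
  refine .inr ⟨hi, hj, SimpleGraph.Adj.reachable ?_⟩
  have h1 : H.sg i j = -1 := (H.sg_eq i j).resolve_left fun h' => by rw [h'] at h; norm_num at h
  have h2 := H.z_mul_comm i j
  simp only [z, hi, hj, dite_true, h1, neg_smul, one_smul] at h2
  refine ⟨fun hij => ?_, h2⟩
  -- A vertex with negative sign against itself would make the square of its involution equal to its
  -- own negative.
  have h3 := H.z_mul_comm i j
  have hij' : i = j := congrArg Fin.val hij
  subst hij'
  rw [h1, z_mul_self] at h3
  have h4 := congrFun (congrFun h3 0) 0
  simp at h4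
  norm_num at h4

/-- The connected components, as computed by the algorithm. -/
def components : List (List ℕ) := comps m (labels H.sg m)

theorem labels_sg : LabInv H.Conn m (labels H.sg m) ∧ ∀ i < m, ∀ j < m, H.sg i j < 0 →
    (labels H.sg m).getD i 0 = (labels H.sg m).getD j 0 :=
  labels_spec H.conn_equivalence fun _ hi _ hj => H.conn_of_sg_neg hi hj

/-- Equal labels imply connectedness, so the vertices of one list all lie in the support of a single
connected component. -/
theorem mem_components {C : List ℕ} (hC : C ∈ H.components) :
    C.length ≤ H.maxComponent ∧ C.length ≤ m ∧ ∀ q ∈ C, q < m := by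
  obtain ⟨r, -, rfl⟩ := List.mem_map.1 hC
  have hlt : ∀ q ∈ (List.range m).filter fun i => (labels H.sg m).getD i 0 = r, q < m := fun q hq =>
    List.mem_range.1 (List.mem_filter.1 hq).1
  refine ⟨?_, (List.length_filter_le _ _).trans (by simp), hlt⟩
  -- Labels that were merged away leave empty lists.
  cases hL : (List.range m).filter fun i => (labels H.sg m).getD i 0 = r with
  | nil => simp
  | cons i0 L =>
    rw [← hL]
    have h0 : i0 ∈ (List.range m).filter fun i => (labels H.sg m).getD i 0 = r := by
      rw [hL]
      exact List.mem_cons_self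
    have h1 := hlt i0 h0
    refine le_trans ?_ (Finset.le_sup (f := fun i : Fin m =>
      (H.anticommGraph.connectedComponentMk i).supp.ncard) (Finset.mem_univ ⟨i0, h1⟩))
    rw [← List.toFinset_card_of_nodup (List.nodup_range.filter _), ← Set.ncard_coe_finset,
      ← Set.ncard_image_of_injective _ Fin.val_injective]
    refine Set.ncard_le_ncard (fun q hq => ?_) (Set.toFinite _)
    have hq : q ∈ (List.range m).filter fun i => (labels H.sg m).getD i 0 = r := by
      simpa using hq
    refine ⟨⟨q, hlt q hq⟩, ?_, rfl⟩
    rw [SimpleGraph.ConnectedComponent.mem_supp_iff, SimpleGraph.ConnectedComponent.eq]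
    have e : ∀ q ∈ (List.range m).filter fun i => (labels H.sg m).getD i 0 = r,
        (labels H.sg m).getD q 0 = r := fun q hq => by simpa using (List.mem_filter.1 hq).2
    rcases H.labels_sg.1.rel q (hlt q hq) i0 h1 ((e q hq).trans (e i0 h0).symm) with h | ⟨_, _, h⟩
    · subst h
      rfl
    · exact h

end PauliHamiltonian

/-! ### The prepared state -/

section

variable {n m k : ℕ}

theorem restrict_emb_inl (y : Fin m → ZMod 2) (i : Fin m) :
    (restrict (emb y) : Wire n m k → ZMod 2) (Sum.inl i) = y i := emb_val y i

theorem restrict_emb_inr (y : Fin m → ZMod 2) (w : (Fin n ⊕ Fin n) ⊕ Fin k) :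
    (restrict (emb y) : Wire n m k → ZMod 2) (Sum.inr w) = 0 := by
  rw [restrict, emb, dif_neg]
  rcases w with (i | i) | i <;> simp only [wireNum] <;> omega

theorem restrict_emb_injective :
    Function.Injective fun y : Fin m → ZMod 2 => (restrict (emb y) : Wire n m k → ZMod 2) := by
  intro y y' h
  funext i
  have := congrFun h (Sum.inl i)
  simpa only [restrict_emb_inl] using this

theorem eq_restrict_emb {x : Wire n m k → ZMod 2} (h : ∀ w, x (Sum.inr w) = 0) :
    x = restrict (emb fun i => x (Sum.inl i)) := by
  funext w
  rcases w with i | w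
  · rw [restrict_emb_inl]
  · rw [restrict_emb_inr, h]

theorem withZeros_restrict_emb (ψ : (Fin m → ZMod 2) → ℂ) (y : Fin m → ZMod 2) :
    (withZeros ψ : (Wire n m k → ZMod 2) → ℂ) (restrict (emb y)) = ψ y := by
  rw [withZeros, if_pos fun w => restrict_emb_inr y w]
  simp only [restrict_emb_inl]

theorem withZeros_of_notMem {ψ : (Fin m → ZMod 2) → ℂ} {x : Wire n m k → ZMod 2}
    (h : x ∉ Set.range fun y : Fin m → ZMod 2 => (restrict (emb y) : Wire n m k → ZMod 2)) :
    withZeros ψ x = 0 := by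
  rw [withZeros, if_neg]
  exact fun h' => h ⟨_, (eq_restrict_emb h').symm⟩

theorem withZeros_eq (ψ : (Fin m → ZMod 2) → ℂ) :
    (withZeros ψ : (Wire n m k → ZMod 2) → ℂ) = toState (∑ y, ψ y • ket (emb y)) := by
  funext x
  simp only [map_sum, map_smul, toState_ket, Finset.sum_apply, Pi.smul_apply, smul_eq_mul]
  by_cases hx : x ∈ Set.range fun y : Fin m → ZMod 2 => (restrict (emb y) : Wire n m k → ZMod 2)
  · obtain ⟨y, rfl⟩ := hx
    rw [withZeros_restrict_emb, Finset.sum_eq_single y]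
    · simp
    · intro y' _ h
      rw [Pi.single_eq_of_ne, mul_zero]
      exact fun h' => h (restrict_emb_injective h').symm
    · exact fun h => absurd (Finset.mem_univ y) h
  · rw [withZeros_of_notMem hx]
    refine (Finset.sum_eq_zero fun y _ => ?_).symm
    rw [Pi.single_eq_of_ne, mul_zero]
    exact fun h => hx ⟨y, h.symm⟩

theorem sum_normSq_withZeros (ψ : (Fin m → ZMod 2) → ℂ) :
    ∑ x, Complex.normSq ((withZeros ψ : (Wire n m k → ZMod 2) → ℂ) x) =
      ∑ y, Complex.normSq (ψ y) := by
  refine (Fintype.sum_of_injective _ (restrict_emb_injective (n := n) (k := k)) _ _ ?_ ?_).symm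
  · exact fun x hx => by rw [withZeros_of_notMem hx, map_zero]
  · exact fun y => by rw [withZeros_restrict_emb]

theorem zeroState_eq : zeroState n m k = toState (ket 0) := by
  rw [toState_ket]
  rfl

theorem sum_normSq_zeroState : ∑ x, Complex.normSq (zeroState n m k x) = 1 := by
  rw [Finset.sum_eq_single 0]
  · simp [zeroState]
  · intro x _ hx
    rw [zeroState, Pi.single_eq_of_ne hx, map_zero]
  · exact fun h => absurd (Finset.mem_univ _) h

namespace PauliHamiltonian

variable (H : PauliHamiltonian n m)

/-- If all amplitudes vanished, so would the operator, by `polyOp_eq`, and with it the trace. -/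
theorem sum_refAmplitude_pos {l : ℕ} {P : Polynomial ℝ} (hP : P.natDegree ≤ l)
    (htr : Matrix.trace (H.polyOp P ^ 2) ≠ 0) : 0 < ∑ y, H.refAmplitude l P y ^ 2 := by
  refine lt_of_le_of_ne (Finset.sum_nonneg fun _ _ => sq_nonneg _) fun h => htr ?_
  have h0 := (Finset.sum_eq_zero_iff_of_nonneg fun _ _ => sq_nonneg _).1 h.symm
  rw [H.polyOp_eq hP, Finset.sum_eq_zero, zero_pow two_ne_zero, Matrix.trace_zero]
  intro y hy
  rw [pow_eq_zero_iff two_ne_zero |>.1 (h0 y hy), Complex.ofReal_zero, zero_smul]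

/-- The circuit that prepares the reference state. -/
def prepGates (l : ℕ) (P : Polynomial ℝ) : List RawGate :=
  prepCircuit (m + n + n) l H.c H.sg P.coeff H.components

/-- The prepared state times `κ` is the unnormalized vector. Unitarity identifies `κ²` with the
squared norm of that vector, and `κ ≥ 0` removes the ambiguity of a global sign. -/
theorem prepGates_spec {l : ℕ} {P : Polynomial ℝ} (hP : P.natDegree ≤ l)
    (htr : Matrix.trace (H.polyOp P ^ 2) ≠ 0) {C : List (Gate (Wire n m k))}
    (hC : ∀ ψ, (circuitMatrix C).mulVec (toState ψ) = toState (run (H.prepGates l P) ψ)) :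
    (circuitMatrix C).mulVec (zeroState n m k) = withZeros (H.refState l P) := by
  obtain ⟨κ, hκ, h⟩ := prepCircuit_spec (b := m + n + n) (l := l) (c := H.c) H.sg_eq (by omega)
    H.labels_sg.2 H.labels_sg.1.lt P.coeff
  have hpos := H.sum_refAmplitude_pos hP htr
  have h1 : (κ : ℂ) • (circuitMatrix C).mulVec (zeroState n m k) =
      withZeros fun y => ((H.refAmplitude l P y : ℝ) : ℂ) := by
    rw [withZeros_eq, ← H.sum_totalOp_pow, totalOp, ← h, map_smul, zeroState_eq, hC]
    rfl
  have h2 : κ ^ 2 = ∑ y, H.refAmplitude l P y ^ 2 := by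
    have e := sum_normSq_mulVec (circuitMatrix_mem_unitaryGroup C) (zeroState n m k)
    rw [sum_normSq_zeroState] at e
    have e' := sum_normSq_withZeros (n := n) (k := k) fun y => ((H.refAmplitude l P y : ℝ) : ℂ)
    rw [← h1] at e'
    simp only [Pi.smul_apply, smul_eq_mul, map_mul, Complex.normSq_ofReal, ← Finset.mul_sum, e] at e'
    rw [sq, ← mul_one (κ * κ), e']
    exact Finset.sum_congr rfl fun y _ => (sq _).symm
  have h3 : Real.sqrt (∑ y, H.refAmplitude l P y ^ 2) = κ := by rw [← h2, Real.sqrt_sq hκ]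
  have h4 : κ ≠ 0 := fun h => by rw [← h2, h] at hpos; norm_num at hpos
  have h5 : (κ : ℂ) ≠ 0 := by exact_mod_cast h4
  have h6 : (withZeros (H.refState l P) : (Wire n m k → ZMod 2) → ℂ) =
      (κ : ℂ)⁻¹ • withZeros fun y => ((H.refAmplitude l P y : ℝ) : ℂ) := by
    funext x
    simp only [withZeros, refState, h3, Pi.smul_apply, smul_eq_mul]
    split_ifs
    · push_cast
      rw [div_eq_inv_mul]
    · rw [mul_zero]
  rw [h6, ← h1, smul_smul, inv_mul_cancel₀ h5, one_smul]

end PauliHamiltonian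

end

/-! ### Testing whether a register is in the state zero -/

/-- The gates that compute on the wires `F + 1, …, F + 1 + N` whether the wires `s, …` are zero. -/
def chain (F s N : ℕ) : List RawGate :=
  rX [] (F + 1) :: (List.range N).flatMap fun j =>
    [rX [F + 1 + j] (F + 1 + (j + 1)), rX [F + 1 + j, s + j] (F + 1 + (j + 1))]

/-- The gates that flip the wire `F` if the wires `s, …, s + N - 1` are zero. -/
def zeroTest (F s N : ℕ) : List RawGate :=
  chain F s N ++ (rX [F + 1 + N] F :: (chain F s N).reverse)

theorem forall_mem_chain {Q : RawGate → Prop} {F s N : ℕ} (h0 : Q (rX [] (F + 1)))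
    (h : ∀ j < N, Q (rX [F + 1 + j] (F + 1 + (j + 1))) ∧
      Q (rX [F + 1 + j, s + j] (F + 1 + (j + 1)))) : ∀ g ∈ chain F s N, Q g := by
  intro g hg
  rcases List.mem_cons.1 hg with rfl | hg
  · exact h0
  · obtain ⟨j, hj, hg⟩ := List.mem_flatMap.1 hg
    have h := h j (List.mem_range.1 hj)
    simp only [List.mem_cons, List.not_mem_nil, or_false] at hg
    rcases hg with rfl | rfl
    · exact h.1
    · exact h.2

theorem act_rX_self {cs : List ℕ} {t : ℕ} (h : t ∉ cs) (ψ : Sta) :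
    act (rX cs t) (act (rX cs t) ψ) = ψ := by
  have : act (rX cs t) ∘ₗ act (rX cs t) = LinearMap.id := sta_hom_ext fun x => by
    rw [LinearMap.comp_apply, act_rX, act_rX, LinearMap.id_apply]
    have : cs.map (x + Pi.single t (cs.map x).prod) = cs.map x :=
      List.map_congr_left fun c hc => by
        have hct : c ≠ t := fun h' => h (h' ▸ hc)
        simp [hct]
    rw [this, cfg_add_add_self]
  exact LinearMap.congr_fun this ψ

theorem run_reverse {L : List RawGate} (h : ∀ g ∈ L, ∃ cs t, g = rX cs t ∧ t ∉ cs) (ψ : Sta) :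
    run L.reverse (run L ψ) = ψ := by
  induction L generalizing ψ with
  | nil => rfl
  | cons g L ih =>
    obtain ⟨cs, t, rfl, ht⟩ := h g (by simp)
    rw [List.reverse_cons, run_append, run_cons (rX cs t) L, ih fun g hg => h g (by simp [hg])]
    exact act_rX_self ht ψ

/-- The two gates of round `j` realize `w' = w + w x = w (1 + x)` for the next chain bit, with `x`
the bit being tested. -/
theorem run_chain {F s N : ℕ} (hs : s + N ≤ F) {x : Cfg} (hx : ∀ j, F < j → x j = 0) :
    ∃ w : Cfg, run (chain F s N) (ket x) = ket (x + w) ∧ (∀ j ≤ F, w j = 0) ∧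
      (∀ j, F + 1 + N < j → w j = 0) ∧
      w (F + 1 + N) = ∏ j ∈ Finset.range N, (1 + x (s + j)) := by
  induction N with
  | zero =>
    refine ⟨ev (F + 1), ?_, fun j hj => ev_of_ne (by omega), fun j hj => ev_of_ne (by omega), ?_⟩
    · simp [chain, act_rX]
    · simp
  | succ N ih =>
    obtain ⟨w, h1, h2, h3, h4⟩ := ih (by omega)
    refine ⟨w + Pi.single (F + 1 + (N + 1)) (w (F + 1 + N) * (1 + x (s + N))), ?_,
      fun j hj => ?_, fun j hj => ?_, ?_⟩
    · have e : chain F s (N + 1) = chain F s N ++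
          [rX [F + 1 + N] (F + 1 + (N + 1)), rX [F + 1 + N, s + N] (F + 1 + (N + 1))] := by
        simp [chain, List.range_succ]
      rw [e, run_append, h1, run_cons, run_cons, run_nil, act_rX, act_rX]
      have e1 : F + 1 + N ≠ F + 1 + (N + 1) := by omega
      have e2 : s + N ≠ F + 1 + (N + 1) := by omega
      simp only [List.map_cons, List.map_nil, List.prod_cons, List.prod_nil, mul_one, Pi.add_apply,
        Pi.single_eq_of_ne e1, Pi.single_eq_of_ne e2, hx (F + 1 + N) (by omega), h2 (s + N) (by omega),
        zero_add, add_zero]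
      rw [mul_add, mul_one, Pi.single_add, add_assoc, add_assoc]
    · rw [Pi.add_apply, h2 j hj, Pi.single_eq_of_ne (by omega), add_zero]
    · rw [Pi.add_apply, h3 j (by omega), Pi.single_eq_of_ne (by omega), add_zero]
    · rw [Pi.add_apply, h3 _ (by omega), Pi.single_eq_same, zero_add, h4, Finset.prod_range_succ]

/-- Compute, copy, uncompute. The chain does not use wire `F`, so the copied bit passes through the
reversed chain as a translation. -/
theorem run_zeroTest {F s N : ℕ} (hs : s + N ≤ F) {x : Cfg} (hx : ∀ j, F < j → x j = 0) :
    run (zeroTest F s N) (ket x) =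
      ket (x + Pi.single F (∏ j ∈ Finset.range N, (1 + x (s + j)))) := by
  obtain ⟨w, h1, h2, h3, h4⟩ := run_chain hs hx
  have hX : ∀ g ∈ chain F s N, ∃ cs t, g = rX cs t ∧ t ∉ cs :=
    forall_mem_chain ⟨_, _, rfl, by simp⟩ fun j hj =>
      ⟨⟨_, _, rfl, by simp⟩, ⟨_, _, rfl, by simp; omega⟩⟩
  rw [zeroTest, run_append, run_cons, h1, act_rX]
  simp only [List.map_singleton, List.prod_singleton, Pi.add_apply, hx _ (show F < F + 1 + N by omega),
    zero_add, h4]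
  have hav : ∀ a : ZMod 2, ∀ g ∈ (chain F s N).reverse, Avoids g (Pi.single F a) := by
    intro a g hg
    have e : ∀ j, j ≠ F → (Pi.single F a : Cfg) j = 0 := fun j hj =>
      Pi.single_eq_of_ne (M := fun _ => ZMod 2) hj a
    refine forall_mem_chain (Q := fun g => Avoids g (Pi.single F a)) ?_ (fun j hj => ⟨?_, ?_⟩) g
      (List.mem_reverse.1 hg)
    · exact avoids_rX (by simp) (e _ (by omega))
    · exact avoids_rX (by simpa using e _ (by omega)) (e _ (by omega))
    · exact avoids_rX (by simpa using ⟨e _ (by omega), e _ (by omega)⟩) (e _ (by omega))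
  rw [← shift_ket, run_shift (hav _), ← h1, run_reverse hX, shift_ket]

theorem prod_one_add {N : ℕ} {f : ℕ → ZMod 2} :
    ∏ j ∈ Finset.range N, (1 + f j) = if ∀ j < N, f j = 0 then 1 else 0 := by
  have h11 : (1 : ZMod 2) + 1 = 0 := rfl
  split_ifs with h
  · exact Finset.prod_eq_one fun j hj => by rw [h j (Finset.mem_range.1 hj), add_zero]
  · push Not at h
    obtain ⟨j, hj, h⟩ := h
    refine Finset.prod_eq_zero (Finset.mem_range.2 hj) ?_
    rw [(zmod_two_cases (f j)).resolve_left h, h11]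

theorem valid_zeroTest {M F s N : ℕ} (hs : s + N ≤ F) (hM : F + 1 + N < M) :
    ∀ g ∈ zeroTest F s N, Valid M g := by
  have h : ∀ g ∈ chain F s N, Valid M g := by
    refine forall_mem_chain (valid_rX ?_ ?_ ?_ ?_) fun j hj =>
      ⟨valid_rX ?_ ?_ ?_ ?_, valid_rX ?_ ?_ ?_ ?_⟩ <;> first | omega | (simp; done) | (simp; omega)
  intro g hg
  rcases List.mem_append.1 hg with hg | hg
  · exact h g hg
  rcases List.mem_cons.1 hg with rfl | hg
  · refine valid_rX ?_ ?_ ?_ ?_ <;> first | omega | (simp; done) | (simp; omega)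
  · exact h g (List.mem_reverse.1 hg)

/-! ### Controlled Pauli operators on pairs of qubits -/

/-- The bit as an element of `ZMod 2`. -/
def bitVal (a : Bool) : ZMod 2 := bif a then 1 else 0

/-- The single-qubit operator `i ^ (-ab) X ^ a Z ^ b` on wire `t`, controlled by wire `c`. -/
def pGate (c t : ℕ) (a b : Bool) : RawGate :=
  ([c], t, ((bif a then 0 else 1, 0), bif a then bif b then (0, 1) else (1, 0) else (0, 0)),
    (bif a then bif b then (0, -1) else (1, 0) else (0, 0),
      (bif a then 0 else bif b then -1 else 1, 0)))

theorem pGate_U (c t : ℕ) (a b : Bool) (r s : ZMod 2) : RawGate.U (pGate c t a b) r s =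
    if r = s + bitVal a then pauliPhase (bitVal b) (bitVal a) s else 0 := by
  have h11 : (1 : ZMod 2) + 1 = 0 := rfl
  have h1 : decodeComplex (0, 1) = Complex.I := rfl
  have h2 : decodeComplex (0, -1) = -Complex.I := by
    apply Complex.ext <;> simp [decodeComplex]
  rcases zmod_two_cases r with rfl | rfl <;> rcases zmod_two_cases s with rfl | rfl <;>
    cases a <;> cases b <;>
    simp [RawGate.U, pGate, bitVal, pauliPhase, h11, val_one_zmod_two, h1, h2]

theorem valid_pGate {N c t : ℕ} (a b : Bool) (hc : c < N) (ht : t < N) (h : c ≠ t) :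
    Valid N (pGate c t a b) := by
  refine ⟨by simp [pGate], by simpa [pGate] using hc, ht, by simpa [pGate] using h.symm,
    unitary_of_entries fun r s => ?_⟩
  have h11 : (1 : ZMod 2) + 1 = 0 := rfl
  simp only [pGate_U, sum_zmod_two]
  rcases zmod_two_cases r with rfl | rfl <;> rcases zmod_two_cases s with rfl | rfl <;>
    cases a <;> cases b <;> simp [bitVal, pauliPhase, h11, val_one_zmod_two]

theorem act_pGate_of_zero {c t : ℕ} (a b : Bool) {x : Cfg} (h : x c = 0) :
    act (pGate c t a b) (ket x) = ket x := by
  rw [act_ket, if_neg]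
  simp [pGate, h]

theorem act_pGate_of_one {c t : ℕ} (a b : Bool) {x : Cfg} (h : x c = 1) :
    act (pGate c t a b) (ket x) =
      pauliPhase (bitVal b) (bitVal a) (x t) • ket (x + Pi.single t (bitVal a)) := by
  rw [act_ket, if_pos (by simpa [pGate] using h)]
  have ht : (pGate c t a b).2.1 = t := rfl
  rw [ht, Finset.sum_eq_single (x t + bitVal a), pGate_U, if_pos rfl]
  · congr 2
    funext w
    by_cases hw : w = t
    · subst hw
      simp
    · simp [hw]
  · intro r _ hr
    rw [pGate_U, if_neg hr, zero_smul]
  · exact fun h => absurd (Finset.mem_univ _) h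

/-- The gates that multiply the operator encoded on the wires `B, …` and `C, …` from the left by the
Pauli operator with the given symplectic representation, controlled by wire `c`. -/
def pauliGates (B C n c : ℕ) (v : ℕ → Bool × Bool) : List RawGate :=
  (List.range n).flatMap fun q =>
    pGate c (B + q) (v q).1 (v q).2 :: bif (v q).2 then [rX [c] (C + q)] else []

theorem run_pauliGates_of_zero {B C n c : ℕ} {v : ℕ → Bool × Bool} {x : Cfg} (h : x c = 0) :
    run (pauliGates B C n c v) (ket x) = ket x := by
  induction n with
  | zero => rfl
  | succ n ih =>
    rw [pauliGates, List.range_succ, List.flatMap_append, run_append, ← pauliGates, ih]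
    simp only [List.flatMap_cons, List.flatMap_nil, List.append_nil, run_cons,
      act_pGate_of_zero _ _ h]
    cases (v n).2
    · rfl
    · exact act_cx_of_zero h

theorem run_pauliGates_of_one {B C n c : ℕ} {v : ℕ → Bool × Bool} {x : Cfg} (h : x c = 1)
    (hB : c < B ∨ B + n ≤ c) (hC : c < C ∨ C + n ≤ c) (hBC : B + n ≤ C) :
    run (pauliGates B C n c v) (ket x) =
      (∏ q ∈ Finset.range n, pauliPhase (bitVal (v q).2) (bitVal (v q).1) (x (B + q))) •
        ket (x + ∑ q ∈ Finset.range n,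
          (Pi.single (B + q) (bitVal (v q).1) + Pi.single (C + q) (bitVal (v q).2))) := by
  induction n with
  | zero => simp [pauliGates]
  | succ n ih =>
    rw [pauliGates, List.range_succ, List.flatMap_append, run_append, ← pauliGates,
      ih (by omega) (by omega) (by omega)]
    have h0 : ∀ w, (w < B ∨ B + n ≤ w) → (w < C ∨ C + n ≤ w) → (∑ q ∈ Finset.range n,
        (Pi.single (B + q) (bitVal (v q).1) + Pi.single (C + q) (bitVal (v q).2)) : Cfg) w = 0 := by
      intro w h1 h2
      rw [Finset.sum_apply]
      refine Finset.sum_eq_zero fun q hq => ?_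
      have := Finset.mem_range.1 hq
      rw [Pi.add_apply, Pi.single_eq_of_ne (by omega), Pi.single_eq_of_ne (by omega), add_zero]
    generalize hw : (∑ q ∈ Finset.range n, _ : Cfg) = w at h0 ⊢
    have e1 : (x + w) c = 1 := by rw [Pi.add_apply, h, h0 c (by omega) (by omega), add_zero]
    have e2 : (x + w + Pi.single (B + n) (bitVal (v n).1) : Cfg) c = 1 := by
      rw [Pi.add_apply, e1, Pi.single_eq_of_ne (by omega), add_zero]
    rw [Finset.sum_range_succ, hw, Finset.prod_range_succ, ← smul_smul, map_smul]
    simp only [List.flatMap_cons, List.flatMap_nil, List.append_nil, run_cons,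
      act_pGate_of_one _ _ e1, map_smul]
    have e3 : (x + w) (B + n) = x (B + n) := by
      rw [Pi.add_apply, h0 _ (by omega) (by omega), add_zero]
    rw [e3]
    congr 2
    cases (v n).2
    · simp [bitVal, add_assoc]
    · rw [cond_true, run_cons, run_nil, act_cx_of_one e2, add_assoc, add_assoc]
      rfl

/-! ### Hadamard gates and Bell pairs -/

/-- The Hadamard gate. -/
def hGate (t : ℕ) : RawGate :=
  ([], t, ((1 / Real.sqrt (1 + 1), 0), (1 / Real.sqrt (1 + 1), 0)),
    ((1 / Real.sqrt (1 + 1), 0), (-(1 / Real.sqrt (1 + 1)), 0)))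

theorem hGate_U (t : ℕ) (r s : ZMod 2) :
    RawGate.U (hGate t) r s = ((1 / Real.sqrt (1 + 1) * chi (r * s) : ℝ) : ℂ) := by
  rcases zmod_two_cases r with rfl | rfl <;> rcases zmod_two_cases s with rfl | rfl <;>
    simp only [RawGate.U, hGate, Matrix.of_apply, if_true, one_ne_zero, if_false, decodeComplex_real,
      mul_zero, mul_one, chi_zero, chi_one, mul_neg]

theorem sqrt_half_mul_self : (1 / Real.sqrt (1 + 1)) * (1 / Real.sqrt (1 + 1)) = 1 / 2 := by
  rw [div_mul_div_comm, Real.mul_self_sqrt (by norm_num)]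
  norm_num

theorem valid_hGate {N t : ℕ} (ht : t < N) : Valid N (hGate t) := by
  refine ⟨by simp [hGate], by simp [hGate], ht, by simp [hGate], unitary_of_entries fun r s => ?_⟩
  have h : ((1 / Real.sqrt (1 + 1) : ℝ) : ℂ) * ((1 / Real.sqrt (1 + 1) : ℝ) : ℂ) = 1 / 2 := by
    rw [← Complex.ofReal_mul, sqrt_half_mul_self]
    norm_num
  simp only [hGate_U, sum_zmod_two, Complex.ofReal_mul, Complex.star_def, map_mul,
    Complex.conj_ofReal]
  generalize ((1 / Real.sqrt (1 + 1) : ℝ) : ℂ) = a at h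
  rcases zmod_two_cases r with rfl | rfl <;> rcases zmod_two_cases s with rfl | rfl <;>
    simp <;> first | done | linear_combination 2 * h

/-- Hadamard gates on the wires `s, …, s + r - 1`, followed by additions to the wires `t, …`. -/
def bellGates (s t r : ℕ) : List RawGate :=
  (List.range r).flatMap fun q => [hGate (s + q), rX [s + q] (t + q)]

/-- The contents `b` on the wires `s, s + 1, …`. -/
def blk {r : ℕ} (s : ℕ) (b : Fin r → ZMod 2) : Cfg := ∑ q : Fin r, Pi.single (s + q) (b q)

theorem blk_apply {r : ℕ} (s : ℕ) (b : Fin r → ZMod 2) (w : ℕ) :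
    blk s b w = if h : s ≤ w ∧ w - s < r then b ⟨w - s, h.2⟩ else 0 := by
  rw [blk, Finset.sum_apply]
  split_ifs with h
  · rw [Finset.sum_eq_single ⟨w - s, h.2⟩]
    · simp only
      rw [Nat.add_sub_cancel' h.1, Pi.single_eq_same]
    · intro q _ hq
      rw [Pi.single_eq_of_ne]
      intro h'
      exact hq (Fin.ext (by simp only; omega))
    · exact fun h => absurd (Finset.mem_univ _) h
  · refine Finset.sum_eq_zero fun q _ => ?_
    have := q.2
    rw [Pi.single_eq_of_ne (by omega)]

theorem act_hGate (t : ℕ) (x : Cfg) : act (hGate t) (ket x) =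
    ∑ b, ((1 / Real.sqrt (1 + 1) * chi (b * x t) : ℝ) : ℂ) • ket (x + Pi.single t (b + x t)) := by
  rw [act_ket, if_pos (by simp [hGate])]
  have ht : (hGate t).2.1 = t := rfl
  refine Finset.sum_congr rfl fun b _ => ?_
  rw [ht, hGate_U]
  congr 2
  funext w
  by_cases hw : w = t
  · subst hw
    simp only [Function.update_self, Pi.add_apply, Pi.single_eq_same]
    rw [add_comm b, ← add_assoc, CharTwo.add_self_eq_zero, zero_add]
  · simp [hw]

/-- Induction on `r` peels off the first pair of wires. The pairs do not overlap, so the later gates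
still see the original contents. -/
theorem run_bellGates {s t r : ℕ} (h : s + r ≤ t ∨ t + r ≤ s) (x : Cfg) :
    run (bellGates s t r) (ket x) = (((1 / Real.sqrt (1 + 1)) ^ r : ℝ) : ℂ) •
      ∑ b : Fin r → ZMod 2, ((∏ q, chi (b q * x (s + q)) : ℝ) : ℂ) •
        ket (x + blk s (fun q => b q + x (s + q)) + blk t b) := by
  induction r generalizing s t x with
  | zero => simp [bellGates, blk]
  | succ r ih =>
    have e : bellGates s t (r + 1) =
        hGate s :: rX [s] t :: bellGates (s + 1) (t + 1) r := by
      simp only [bellGates, List.range_succ_eq_map, List.flatMap_cons, List.flatMap_map]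
      simp [add_assoc, add_comm 1]
    rw [e, run_cons, run_cons, act_hGate, map_sum, map_sum, sum_fin_cons, Finset.smul_sum]
    refine Finset.sum_congr rfl fun b _ => ?_
    rw [map_smul, map_smul, act_rX]
    have e1 : List.map (x + Pi.single s (b + x s) : Cfg) [s] = [b] := by
      simp only [List.map_singleton, Pi.add_apply, Pi.single_eq_same]
      rw [add_comm b, ← add_assoc, CharTwo.add_self_eq_zero, zero_add]
    rw [e1, List.prod_singleton, ih (by omega), smul_smul, Finset.smul_sum, Finset.smul_sum]
    refine Finset.sum_congr rfl fun b' _ => ?_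
    have e2 : ∀ q : Fin r, (x + Pi.single s (b + x s) + Pi.single t b : Cfg) (s + 1 + q) =
        x (s + 1 + q) := fun q => by
      have := q.2
      rw [Pi.add_apply, Pi.add_apply, Pi.single_eq_of_ne (by omega), Pi.single_eq_of_ne (by omega),
        add_zero, add_zero]
    simp only [e2]
    have e3 : ∀ (u : ℕ) (f : Fin (r + 1) → ZMod 2),
        blk u f = Pi.single u (f 0) + blk (u + 1) fun q => f q.succ := by
      intro u f
      simp only [blk, Fin.sum_univ_succ, Fin.val_zero, add_zero, Fin.val_succ, add_assoc,
        add_comm 1]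
    have e4 : ∀ q : Fin r, s + 1 + (q : ℕ) = s + (q + 1) := fun q => by omega
    rw [smul_smul, smul_smul]
    congr 1
    · rw [Fin.prod_univ_succ]
      simp only [Fin.cons_zero, Fin.cons_succ, Fin.val_zero, add_zero, Fin.val_succ, e4]
      push_cast
      ring
    · rw [e3 s, e3 t]
      simp only [Fin.cons_zero, Fin.cons_succ, Fin.val_zero, add_zero, Fin.val_succ, e4]
      congr 1
      abel

theorem valid_bellGates {N s t r : ℕ} (h : s + r ≤ t ∨ t + r ≤ s) (hs : s + r ≤ N)
    (ht : t + r ≤ N) : ∀ g ∈ bellGates s t r, Valid N g := by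
  intro g hg
  obtain ⟨q, hq, hg⟩ := List.mem_flatMap.1 hg
  have hq := List.mem_range.1 hq
  simp only [List.mem_cons, List.not_mem_nil, or_false] at hg
  rcases hg with rfl | rfl
  · exact valid_hGate (by omega)
  · refine valid_rX ?_ ?_ ?_ ?_ <;> first | omega | (simp; done) | (simp; omega)

/-! ### Pauli operators as states of two registers -/

section

variable {n m k : ℕ}

/-- The operator `Z ^ α X ^ β`, where `w = (α, β)`. -/
def zx (w : Fin n ⊕ Fin n → ZMod 2) : Matrix (Fin n → ZMod 2) (Fin n → ZMod 2) ℂ :=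
  Matrix.of fun x y => if y = x + betaPart w then ∏ q, (chi (w (Sum.inl q) * x q) : ℂ) else 0

theorem zx_zero : zx (0 : Fin n ⊕ Fin n → ZMod 2) = 1 := by
  ext x y
  have : betaPart (0 : Fin n ⊕ Fin n → ZMod 2) = 0 := rfl
  simp [zx, this, Matrix.one_apply, eq_comm]

theorem pauliPhase_mul_chi (a b α x : ZMod 2) :
    pauliPhase a b x * chi (α * (x + b)) = pauliPhase b a α * chi ((α + a) * x) := by
  have h11 : (1 : ZMod 2) + 1 = 0 := rfl
  rcases zmod_two_cases a with rfl | rfl <;> rcases zmod_two_cases b with rfl | rfl <;>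
    rcases zmod_two_cases α with rfl | rfl <;> rcases zmod_two_cases x with rfl | rfl <;>
    simp [pauliPhase, val_one_zmod_two, h11]

/-- Left multiplication translates the label `w` and produces a phase depending on its `α`-part
only. This is the action of a Pauli operator with `α` and `β` exchanged on register `B` and a
translation of register `C`, which explains the gates in `pauliGates`. -/
theorem pauli_mul_zx (v w : Fin n ⊕ Fin n → ZMod 2) : pauli v * zx w =
    (∏ q, pauliPhase (v (Sum.inr q)) (v (Sum.inl q)) (w (Sum.inl q))) • zx (w + v) := by
  ext x y
  have hb : betaPart (w + v) = betaPart v + betaPart w := add_comm _ _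
  rw [pauli_mul_apply, Matrix.smul_apply, zx, zx, Matrix.of_apply, Matrix.of_apply, hb, ← add_assoc,
    smul_eq_mul, mul_ite, mul_ite, mul_zero, mul_zero]
  refine if_congr Iff.rfl ?_ rfl
  rw [phase, ← Finset.prod_mul_distrib, ← Finset.prod_mul_distrib]
  exact Finset.prod_congr rfl fun q _ => pauliPhase_mul_chi _ _ _ _

/-- The contents `w` on the registers `B` and `C`. -/
def bcv (m : ℕ) (w : Fin n ⊕ Fin n → ZMod 2) : Cfg :=
  blk m (fun q => w (Sum.inl q)) + blk (m + n) fun q => w (Sum.inr q)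

theorem blk_add {r : ℕ} (s : ℕ) (b b' : Fin r → ZMod 2) : blk s (b + b') = blk s b + blk s b' := by
  simp only [blk, Pi.add_apply, Pi.single_add, Finset.sum_add_distrib]

theorem bcv_add (w w' : Fin n ⊕ Fin n → ZMod 2) : bcv m (w + w') = bcv m w + bcv m w' := by
  have h1 := blk_add m (fun q => w (Sum.inl q)) fun q => w' (Sum.inl q)
  have h2 := blk_add (m + n) (fun q => w (Sum.inr q)) fun q => w' (Sum.inr q)
  rw [bcv, bcv, bcv, add_add_add_comm, ← h1, ← h2]
  rfl

theorem bcv_inl (w : Fin n ⊕ Fin n → ZMod 2) {q : ℕ} (hq : q < n) :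
    bcv m w (m + q) = w (Sum.inl ⟨q, hq⟩) := by
  rw [bcv, Pi.add_apply, blk_apply, blk_apply, dif_pos ⟨by omega, by omega⟩, dif_neg (by omega),
    add_zero]
  simp

theorem bcv_inr (w : Fin n ⊕ Fin n → ZMod 2) {q : ℕ} (hq : q < n) :
    bcv m w (m + n + q) = w (Sum.inr ⟨q, hq⟩) := by
  rw [bcv, Pi.add_apply, blk_apply, blk_apply, dif_neg (by omega), dif_pos ⟨by omega, by omega⟩,
    zero_add]
  simp

theorem bcv_of_notMem (w : Fin n ⊕ Fin n → ZMod 2) {j : ℕ} (hj : j < m ∨ m + n + n ≤ j) :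
    bcv m w j = 0 := by
  rw [bcv, Pi.add_apply, blk_apply, blk_apply, dif_neg (by omega), dif_neg (by omega), add_zero]

theorem restrict_bcv (w : Fin n ⊕ Fin n → ZMod 2) :
    (restrict (bcv m w) : Wire n m k → ZMod 2) = join 0 w 0 := by
  funext j
  rcases j with i | (i | i) | i
  · exact bcv_of_notMem w (.inl i.2)
  · exact bcv_inl w i.2
  · exact bcv_inr w i.2
  · exact bcv_of_notMem w (.inr (Nat.le_add_right _ _))

theorem emb_of_le {y : Fin m → ZMod 2} {j : ℕ} (h : m ≤ j) : emb y j = 0 := dif_neg (by omega)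

theorem restrict_add (x x' : Cfg) :
    (restrict (x + x') : Wire n m k → ZMod 2) = restrict x + restrict x' := rfl

theorem restrict_emb (y : Fin m → ZMod 2) :
    (restrict (emb y) : Wire n m k → ZMod 2) = join y 0 0 := by
  funext j
  rcases j with i | j
  · exact restrict_emb_inl y i
  · rw [restrict_emb_inr]
    rcases j with (i | i) | i <;> rfl

end

namespace PauliHamiltonian

variable {n m : ℕ} (H : PauliHamiltonian n m)

/-- The bits of the symplectic representations of the Pauli terms. -/
def bit (i q : ℕ) : Bool × Bool :=
  if h : i < m ∧ q < n then
    (decide (H.symp ⟨i, h.1⟩ (Sum.inl ⟨q, h.2⟩) = 1), decide (H.symp ⟨i, h.1⟩ (Sum.inr ⟨q, h.2⟩) = 1))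
  else (false, false)

theorem bitVal_decide (a : ZMod 2) : bitVal (decide (a = 1)) = a := by
  rcases zmod_two_cases a with rfl | rfl <;> simp [bitVal]

theorem bitVal_bit (i : Fin m) (q : Fin n) :
    bitVal (H.bit i q).1 = H.symp i (Sum.inl q) ∧ bitVal (H.bit i q).2 = H.symp i (Sum.inr q) := by
  simp [bit, bitVal_decide]

/-- The point is that the circuit and the matrix identity share the same `θ`; its value is never
needed afterwards. -/
theorem run_pauliGates_bcv (i : Fin m) {c : ℕ} (hc : c < m ∨ m + n + n ≤ c) {x : Cfg} (h : x c = 1)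
    (hx : ∀ j, m ≤ j → j < m + n + n → x j = 0) (w : Fin n ⊕ Fin n → ZMod 2) :
    ∃ θ : ℂ, run (pauliGates m (m + n) n c (H.bit i)) (ket (x + bcv m w)) =
      θ • ket (x + bcv m (w + H.symp i)) ∧ H.term i * zx w = θ • zx (w + H.symp i) := by
  refine ⟨_, ?_, pauli_mul_zx _ _⟩
  rw [run_pauliGates_of_one (by rw [Pi.add_apply, h, bcv_of_notMem w hc, add_zero]) (by omega)
    (by omega) le_rfl]
  congr 1
  · rw [Finset.prod_range]
    refine Finset.prod_congr rfl fun q _ => ?_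
    rw [(H.bitVal_bit i q).1, (H.bitVal_bit i q).2, Pi.add_apply, hx _ (by omega) (by omega), zero_add,
      bcv_inl w q.2]
  · rw [bcv_add, ← add_assoc, Finset.sum_range, Finset.sum_add_distrib]
    simp only [(H.bitVal_bit i _).1, (H.bitVal_bit i _).2]
    rfl

/-- The gates that write the syndrome of register `A` to the registers `B` and `C`. -/
def codeGates : List RawGate :=
  (List.range m).reverse.flatMap fun i => pauliGates m (m + n) n i (H.bit i)

/-- Every gate group multiplies from the left, so the operator product has the order opposite to the
list. This is why `codeGates` runs through the terms backwards: the result is the increasing ordered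
product. -/
theorem run_codeGates_aux (L : List (Fin m)) {x : Cfg} (hx : ∀ j, m ≤ j → j < m + n + n → x j = 0)
    (w : Fin n ⊕ Fin n → ZMod 2) :
    ∃ θ : ℂ, run (L.flatMap fun i : Fin m => pauliGates m (m + n) n i (H.bit i)) (ket (x + bcv m w)) =
      θ • ket (x + bcv m (w + (L.map fun i : Fin m => x i • H.symp i).sum)) ∧
      (L.reverse.map fun i : Fin m => H.term i ^ (x i).val).prod * zx w =
        θ • zx (w + (L.map fun i : Fin m => x i • H.symp i).sum) := by
  induction L generalizing w with
  | nil => exact ⟨1, by simp⟩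
  | cons i L ih =>
    have key : ∃ θ : ℂ, run (pauliGates m (m + n) n i (H.bit i)) (ket (x + bcv m w)) =
        θ • ket (x + bcv m (w + x i • H.symp i)) ∧
        H.term i ^ (x i).val * zx w = θ • zx (w + x i • H.symp i) := by
      rcases zmod_two_cases (x i) with h0 | h0
      · refine ⟨1, ?_, ?_⟩
        · rw [run_pauliGates_of_zero (by rw [Pi.add_apply, h0, bcv_of_notMem w (.inl i.2), add_zero]),
            h0, zero_smul, add_zero, one_smul]
        · rw [h0, zero_smul, add_zero, one_smul, ZMod.val_zero, pow_zero, one_mul]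
      · obtain ⟨θ, h1, h2⟩ := H.run_pauliGates_bcv i (.inl i.2) h0 hx w
        refine ⟨θ, ?_, ?_⟩
        · rw [h1, h0, one_smul]
        · rw [h0, one_smul, val_one_zmod_two, pow_one, h2]
    obtain ⟨θ, h1, h2⟩ := key
    obtain ⟨θ', h3, h4⟩ := ih (w + x i • H.symp i)
    refine ⟨θ * θ', ?_, ?_⟩
    · rw [List.flatMap_cons, run_append, h1, map_smul, h3, smul_smul, List.map_cons, List.sum_cons,
        ← add_assoc]
    · rw [List.reverse_cons, List.map_append, List.prod_append, List.map_singleton,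
        List.prod_singleton, mul_assoc, h2, mul_smul_comm, h4, smul_smul, List.map_cons,
        List.sum_cons, ← add_assoc]

theorem run_codeGates {x : Cfg} (y : Fin m → ZMod 2) (hxy : ∀ i : Fin m, x i = y i)
    (hx : ∀ j, m ≤ j → j < m + n + n → x j = 0) :
    ∃ θ : ℂ, run H.codeGates (ket x) = θ • ket (x + bcv m (H.symplecticCode.mulVec y)) ∧
      ordProd H.z m (emb y) = θ • zx (H.symplecticCode.mulVec y) := by
  obtain ⟨θ, h1, h2⟩ := H.run_codeGates_aux (List.finRange m).reverse hx 0
  have e1 : ((List.finRange m).reverse.map fun i : Fin m => y i • H.symp i).sum =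
      H.symplecticCode.mulVec y := by
    rw [List.map_reverse, List.sum_reverse, ← Fin.sum_univ_def]
    funext a
    simp only [Finset.sum_apply, Pi.smul_apply, smul_eq_mul, Matrix.mulVec, dotProduct,
      symplecticCode, Matrix.of_apply, mul_comm]
  have e2 : (List.finRange m).reverse.flatMap (fun i : Fin m => pauliGates m (m + n) n i (H.bit i)) =
      H.codeGates := by
    rw [codeGates, ← List.map_coe_finRange_eq_range, ← List.map_reverse, List.flatMap_map]
  have e3 : bcv m (0 : Fin n ⊕ Fin n → ZMod 2) = 0 := by simp [bcv, blk]
  simp only [e1, e2, zero_add, e3, add_zero, zx_zero, mul_one, List.reverse_reverse, hxy] at h1 h2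
  exact ⟨θ, h1, by rw [ordProd_emb, h2]⟩

/-- The circuit before the call of the oracle. -/
def beforeGates (l : ℕ) : List RawGate :=
  if l = 0 then bellGates (m + n + n) 0 (m + n + n)
  else zeroTest (m + n + n) 0 m ++ rX [m + n + n] 0 :: H.codeGates

/-- The circuit after the call of the oracle. -/
def afterGates (l : ℕ) : List RawGate :=
  if l = 0 then []
  else pauliGates m (m + n) n (m + n + n) (H.bit 0) ++
    (zeroTest (m + n + n) m (n + n) ++ bellGates m (m + n) n)

theorem valid_pauliGates {N c : ℕ} {v : ℕ → Bool × Bool} (hc : c < m ∨ m + n + n ≤ c) (hN : c < N)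
    (hN' : m + n + n ≤ N) : ∀ g ∈ pauliGates m (m + n) n c v, Valid N g := by
  intro g hg
  obtain ⟨q, hq, hg⟩ := List.mem_flatMap.1 hg
  have hq := List.mem_range.1 hq
  rcases List.mem_cons.1 hg with rfl | hg
  · exact valid_pGate _ _ hN (by omega) (by omega)
  · cases h : (v q).2
    · simp [h] at hg
    · rw [h, cond_true, List.mem_singleton] at hg
      subst hg
      refine valid_rX ?_ ?_ ?_ ?_ <;> first | omega | (simp; done) | (simp; omega)

theorem valid_beforeGates {k l : ℕ} (hm : 0 < m) (hk : m + n + n + 2 ≤ k) :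
    ∀ g ∈ H.beforeGates l, Valid (m + n + n + k) g := by
  intro g hg
  unfold beforeGates at hg
  split_ifs at hg
  · exact valid_bellGates (by omega) (by omega) (by omega) g hg
  rcases List.mem_append.1 hg with hg | hg
  · exact valid_zeroTest (by omega) (by omega) g hg
  rcases List.mem_cons.1 hg with rfl | hg
  · refine valid_rX ?_ ?_ ?_ ?_ <;> first | omega | (simp; done) | (simp; omega)
  · obtain ⟨i, hi, hg⟩ := List.mem_flatMap.1 hg
    have hi : i < m := by simpa using hi
    exact valid_pauliGates (.inl hi) (by omega) (by omega) g hg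

theorem valid_afterGates {k l : ℕ} (hk : m + n + n + 2 ≤ k) :
    ∀ g ∈ H.afterGates l, Valid (m + n + n + k) g := by
  intro g hg
  unfold afterGates at hg
  split_ifs at hg
  · simp at hg
  rcases List.mem_append.1 hg with hg | hg
  · exact valid_pauliGates (.inr le_rfl) (by omega) (by omega) g hg
  rcases List.mem_append.1 hg with hg | hg
  · exact valid_zeroTest (by omega) (by omega) g hg
  · exact valid_bellGates (by omega) (by omega) (by omega) g hg

theorem prod_emb (y : Fin m → ZMod 2) :
    ∏ j ∈ Finset.range m, (1 + emb y (0 + j)) = if y = 0 then 1 else 0 := by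
  rw [prod_one_add]
  refine if_congr ?_ rfl rfl
  simp only [zero_add]
  refine ⟨fun h => funext fun i => ?_, fun h j hj => ?_⟩
  · have := h i i.2
    rwa [emb_val] at this
  · rw [h]
    simp [emb]

theorem run_beforeGates_of_ne {l : ℕ} (hl : l ≠ 0) {y : Fin m → ZMod 2} (hy : y ≠ 0) :
    ∃ θ : ℂ, run (H.beforeGates l) (ket (emb y)) =
      θ • ket (emb y + bcv m (H.symplecticCode.mulVec y)) ∧
      ordProd H.z m (emb y) = θ • zx (H.symplecticCode.mulVec y) := by
  obtain ⟨θ, h1, h2⟩ := H.run_codeGates (x := emb y) y (emb_val y) fun j hj _ => emb_of_le hj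
  refine ⟨θ, ?_, h2⟩
  rw [beforeGates, if_neg hl, run_append, run_zeroTest (by omega) fun j hj => emb_of_le (by omega),
    prod_emb, if_neg hy, Pi.single_zero, add_zero, run_cons, act_cx_of_zero (emb_of_le (by omega)), h1]

theorem emb_single (hm : 0 < m) : emb (Pi.single ⟨0, hm⟩ 1 : Fin m → ZMod 2) = ev 0 := by
  funext j
  by_cases h : j < m
  · simp [emb, h, Pi.single_apply]
  · rw [emb_of_le (by omega), ev_of_ne (by omega)]

/-- The zero string has weight `0`, outside the promise of the oracle. It is traded for the first
unit vector, which is within the promise since `l ≠ 0`, and the flag on wire `m + n + n` remembers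
the exchange. -/
theorem run_beforeGates_zero {l : ℕ} (hl : l ≠ 0) (hm : 0 < m) :
    ∃ θ : ℂ, run (H.beforeGates l) (ket (emb (0 : Fin m → ZMod 2))) =
      θ • ket (emb (Pi.single ⟨0, hm⟩ 1 : Fin m → ZMod 2) + ev (m + n + n) +
        bcv m (H.symplecticCode.mulVec (Pi.single ⟨0, hm⟩ 1))) ∧
      H.term ⟨0, hm⟩ = θ • zx (H.symp ⟨0, hm⟩) := by
  obtain ⟨θ, h1, h2⟩ := H.run_codeGates (x := emb (Pi.single ⟨0, hm⟩ 1 : Fin m → ZMod 2) +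
    ev (m + n + n)) (Pi.single ⟨0, hm⟩ 1) (fun i => by
      rw [Pi.add_apply, emb_val, ev_of_ne (by omega), add_zero]) fun j hj hj' => by
      rw [Pi.add_apply, emb_of_le hj, ev_of_ne (by omega), add_zero]
  have e1 : H.symplecticCode.mulVec (Pi.single ⟨0, hm⟩ 1) = H.symp ⟨0, hm⟩ := by
    rw [Matrix.mulVec_single_one]
    rfl
  have e2 : ordProd H.z m (emb (Pi.single ⟨0, hm⟩ 1 : Fin m → ZMod 2)) = H.term ⟨0, hm⟩ := by
    have h3 := mul_ordProd H.z_mul_self H.z_mul_comm hm 0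
    have h4 : ordProd H.z m 0 = 1 := by simp [ordProd]
    rw [h4, mul_one, insSign_zero, one_smul, zero_add, ← emb_single hm] at h3
    rw [← h3, ← H.z_val]
  refine ⟨θ, ?_, by rw [← e2, h2, e1]⟩
  have h0 : emb (0 : Fin m → ZMod 2) = 0 := by funext j; simp [emb]
  rw [beforeGates, if_neg hl, run_append, run_zeroTest (by omega) fun j hj => emb_of_le (by omega),
    prod_emb, if_pos rfl, run_cons, h0, zero_add, act_cx_of_one (ev_self _), ← h1, emb_single, add_comm]

/-- The part of the circuit that turns the encoding of an operator into its matrix. -/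
theorem run_bellGates_bcv (w : Fin n ⊕ Fin n → ZMod 2) :
    run (bellGates m (m + n) n) (ket (bcv m w)) = (((1 / Real.sqrt (1 + 1)) ^ n : ℝ) : ℂ) •
      ∑ b : Fin n → ZMod 2, ∑ c, zx w b c • ket (bcv m (Sum.elim b c)) := by
  rw [run_bellGates (by omega)]
  congr 1
  refine Finset.sum_congr rfl fun b _ => ?_
  rw [Finset.sum_eq_single (b + betaPart w)]
  · rw [zx, Matrix.of_apply, if_pos rfl]
    congr 2
    · push_cast
      refine Finset.prod_congr rfl fun q _ => ?_
      rw [bcv_inl w q.2, mul_comm]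
    · have e1 : ∀ q : Fin n, bcv m w (m + q) = w (Sum.inl q) := fun q => bcv_inl w q.2
      have e2 : (blk m fun q : Fin n => b q + w (Sum.inl q)) =
          blk m b + blk m fun q => w (Sum.inl q) := blk_add m b _
      have e3 : (blk (m + n) fun q : Fin n => (b + betaPart w) q) =
          blk (m + n) b + blk (m + n) fun q => w (Sum.inr q) := blk_add (m + n) b _
      simp only [e1, e2]
      simp only [bcv, Sum.elim_inl, Sum.elim_inr, e3]
      have h := cfg_add_self (blk m fun q => w (Sum.inl q))
      calc _ = (blk m fun q => w (Sum.inl q)) + (blk m fun q => w (Sum.inl q)) + blk m b +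
          (blk (m + n) b + blk (m + n) fun q => w (Sum.inr q)) := by abel
        _ = _ := by rw [h, zero_add]
  · intro c _ hc
    rw [zx, Matrix.of_apply, if_neg hc, zero_smul]
  · exact fun h => absurd (Finset.mem_univ _) h

theorem prod_bcv (f : Cfg) (w : Fin n ⊕ Fin n → ZMod 2)
    (hf : ∀ j, m ≤ j → j < m + n + n → f j = 0) :
    ∏ j ∈ Finset.range (n + n), (1 + (f + bcv m w) (m + j)) = if w = 0 then 1 else 0 := by
  rw [prod_one_add]
  refine if_congr ?_ rfl rfl
  have e : ∀ j < n + n, (f + bcv m w) (m + j) = bcv m w (m + j) := fun j hj => by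
    rw [Pi.add_apply, hf _ (by omega) (by omega), zero_add]
  refine ⟨fun h => funext fun a => ?_, fun h j hj => ?_⟩
  · rcases a with q | q
    · rw [← bcv_inl (m := m) w q.2, ← e _ (by omega)]
      exact h q (by omega)
    · have h2 := bcv_inr (m := m) w q.2
      rw [add_assoc, ← e _ (by omega), h (n + q) (by omega)] at h2
      exact h2.symm
  · rw [e j hj, h]
    simp [bcv, blk]

/-- Without the flag no multiplication takes place, and a nonzero label keeps the zero test from
raising the flag. -/
theorem run_afterGates_of_ne {l : ℕ} (hl : l ≠ 0) {w : Fin n ⊕ Fin n → ZMod 2} (hw : w ≠ 0) :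
    run (H.afterGates l) (ket (bcv m w)) = (((1 / Real.sqrt (1 + 1)) ^ n : ℝ) : ℂ) •
      ∑ b : Fin n → ZMod 2, ∑ c, zx w b c • ket (bcv m (Sum.elim b c)) := by
  have h1 := prod_bcv (m := m) 0 w fun _ _ _ => rfl
  rw [zero_add, if_neg hw] at h1
  rw [afterGates, if_neg hl, run_append, run_pauliGates_of_zero (bcv_of_notMem w (.inr le_rfl)),
    run_append, run_zeroTest (by omega) fun j hj => bcv_of_notMem w (.inr hj.le), h1,
    Pi.single_zero, add_zero, run_bellGates_bcv]

/-- The flag triggers a second multiplication by the first term, whose square is the identity, so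
the label becomes `0`. The zero test now recognizes this branch from the label alone and clears the
flag. -/
theorem run_afterGates_flag {l : ℕ} (hl : l ≠ 0) (hm : 0 < m) :
    ∃ θ : ℂ, run (H.afterGates l) (ket (ev (m + n + n) + bcv m (H.symp ⟨0, hm⟩))) =
      θ • (((1 / Real.sqrt (1 + 1)) ^ n : ℝ) : ℂ) •
      ∑ b : Fin n → ZMod 2, ∑ c, (1 : Matrix (Fin n → ZMod 2) (Fin n → ZMod 2) ℂ) b c •
        ket (bcv m (Sum.elim b c)) ∧ H.term ⟨0, hm⟩ * zx (H.symp ⟨0, hm⟩) = θ • 1 := by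
  have h0 : ∀ j, m ≤ j → j < m + n + n → ev (m + n + n) j = 0 := fun j _ h => ev_of_ne (by omega)
  obtain ⟨θ, h1, h2⟩ := H.run_pauliGates_bcv ⟨0, hm⟩ (.inr le_rfl) (ev_self _) h0 (H.symp ⟨0, hm⟩)
  rw [add_self_cfg] at h1 h2
  refine ⟨θ, ?_, by rw [h2, zx_zero]⟩
  have e3 : bcv m (0 : Fin n ⊕ Fin n → ZMod 2) = 0 := by simp [bcv, blk]
  have h3 := prod_bcv (m := m) (ev (m + n + n)) (0 : Fin n ⊕ Fin n → ZMod 2) h0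
  rw [if_pos rfl, e3, add_zero] at h3
  rw [afterGates, if_neg hl, run_append, h1, map_smul, e3, add_zero, run_append,
    run_zeroTest (by omega) fun j hj => ev_of_ne (by omega), h3, cfg_add_self, ← zx_zero,
    ← run_bellGates_bcv, e3]

end PauliHamiltonian

/-! ### The call of the oracle and the reduced state -/

section

variable {n m k : ℕ}

/-- The contents of all qubits, split into the contents of `A`, `BC` and the ancillas. -/
def joinEquiv : ((Fin m → ZMod 2) × (Fin n ⊕ Fin n → ZMod 2)) × (Fin k → ZMod 2) ≃
    (Wire n m k → ZMod 2) where
  toFun p := join p.1.1 p.1.2 p.2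
  invFun x := ((fun i => x (Sum.inl i), fun a => x (Sum.inr (Sum.inl a))),
    fun e => x (Sum.inr (Sum.inr e)))
  left_inv _ := rfl
  right_inv x := by
    funext j
    rcases j with i | i | i <;> rfl

theorem sum_join {M : Type*} [AddCommMonoid M] (f : (Wire n m k → ZMod 2) → M) :
    ∑ x, f x = ∑ e : Fin k → ZMod 2,
      ∑ t : (Fin m → ZMod 2) × (Fin n ⊕ Fin n → ZMod 2), f (join t.1 t.2 e) := by
  rw [← joinEquiv.sum_comp, Fintype.sum_prod_type_right]
  rfl

theorem oracleMatrix_mulVec (D : Matrix ((Fin m → ZMod 2) × (Fin n ⊕ Fin n → ZMod 2))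
    ((Fin m → ZMod 2) × (Fin n ⊕ Fin n → ZMod 2)) ℂ) (ψ : (Wire n m k → ZMod 2) → ℂ)
    (a : Fin m → ZMod 2) (bc : Fin n ⊕ Fin n → ZMod 2) (e : Fin k → ZMod 2) :
    (oracleMatrix D).mulVec ψ (join a bc e) =
      D.mulVec (fun t => ψ (join t.1 t.2 e)) (a, bc) := by
  rw [Matrix.mulVec, dotProduct, sum_join, Finset.sum_eq_single e]
  · refine Finset.sum_congr rfl fun t _ => ?_
    have : oracleMatrix D (join a bc e) (join t.1 t.2 e) = D (a, bc) t := if_pos fun _ => rfl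
    exact congrArg (· * _) this
  · intro e' _ he
    refine Finset.sum_eq_zero fun t _ => ?_
    rw [oracleMatrix, Matrix.of_apply, if_neg, zero_mul]
    exact fun h => he (funext fun i => (h i).symm)
  · exact fun h => absurd (Finset.mem_univ _) h

theorem sum_normSq_oracleMatrix {D : Matrix ((Fin m → ZMod 2) × (Fin n ⊕ Fin n → ZMod 2))
    ((Fin m → ZMod 2) × (Fin n ⊕ Fin n → ZMod 2)) ℂ}
    (hD : D ∈ Matrix.unitaryGroup ((Fin m → ZMod 2) × (Fin n ⊕ Fin n → ZMod 2)) ℂ)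
    (ψ : (Wire n m k → ZMod 2) → ℂ) :
    ∑ x, Complex.normSq ((oracleMatrix D).mulVec ψ x) = ∑ x, Complex.normSq (ψ x) := by
  rw [sum_join, sum_join]
  refine Finset.sum_congr rfl fun e _ => ?_
  rw [← sum_normSq_mulVec hD fun t => ψ (join t.1 t.2 e)]
  exact Finset.sum_congr rfl fun t _ => by rw [oracleMatrix_mulVec]

theorem oracleMatrix_single {D : Matrix ((Fin m → ZMod 2) × (Fin n ⊕ Fin n → ZMod 2))
    ((Fin m → ZMod 2) × (Fin n ⊕ Fin n → ZMod 2)) ℂ} {a a' : Fin m → ZMod 2}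
    {bc : Fin n ⊕ Fin n → ZMod 2} (h : D.mulVec (Pi.single (a, bc) 1) = Pi.single (a', bc) 1)
    (e : Fin k → ZMod 2) :
    (oracleMatrix D).mulVec (Pi.single (join a bc e) 1) = Pi.single (join a' bc e) 1 := by
  have key : ∀ (a : Fin m → ZMod 2) (e' : Fin k → ZMod 2),
      (fun t : (Fin m → ZMod 2) × (Fin n ⊕ Fin n → ZMod 2) =>
        (Pi.single (join a bc e) 1 : (Wire n m k → ZMod 2) → ℂ) (join t.1 t.2 e')) =
      if e' = e then Pi.single (a, bc) 1 else 0 := by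
    intro a e'
    funext t
    have : (join t.1 t.2 e' : Wire n m k → ZMod 2) = join a bc e ↔ e' = e ∧ t = (a, bc) := by
      rw [show (join t.1 t.2 e' : Wire n m k → ZMod 2) = joinEquiv (t, e') from rfl,
        show (join a bc e : Wire n m k → ZMod 2) = joinEquiv ((a, bc), e) from rfl,
        joinEquiv.injective.eq_iff, Prod.mk.injEq, and_comm]
    rw [Pi.single_apply, if_congr this rfl rfl]
    by_cases h1 : e' = e <;> simp [h1, Pi.single_apply]
  funext x
  obtain ⟨⟨t, e'⟩, rfl⟩ := joinEquiv.surjective x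
  change (oracleMatrix D).mulVec _ (join t.1 t.2 e') = (Pi.single (join a' bc e) 1 : _ → ℂ)
    (join t.1 t.2 e')
  have h2 := congrFun (key a' e') t
  rw [oracleMatrix_mulVec, key, h2]
  split_ifs
  · rw [h]
  · rw [Matrix.mulVec_zero]

theorem trace_reducedB (ψ : (Wire n m k → ZMod 2) → ℂ) :
    Matrix.trace (reducedB ψ) = ((∑ x, Complex.normSq (ψ x) : ℝ) : ℂ) := by
  rw [sum_join]
  have e : ∀ x : Wire n m k → ZMod 2, ψ x * star (ψ x) = ((Complex.normSq (ψ x) : ℝ) : ℂ) :=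
    fun x => Complex.mul_conj _
  simp only [Matrix.trace, Matrix.diag_apply, reducedB, Matrix.of_apply, e, Complex.ofReal_sum]
  simp only [Fintype.sum_prod_type]
  have h : ∀ f : (Fin n ⊕ Fin n → ZMod 2) → ℂ, ∑ bc, f bc = ∑ b, ∑ c, f (Sum.elim b c) := by
    intro f
    rw [← (Equiv.sumArrowEquivProdArrow (Fin n) (Fin n) (ZMod 2)).symm.sum_comp,
      Fintype.sum_prod_type]
    rfl
  simp only [h]
  rw [Finset.sum_comm, Finset.sum_comm (s := (Finset.univ : Finset (Fin k → ZMod 2)))]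
  refine Finset.sum_congr rfl fun a _ => ?_
  rw [Finset.sum_comm (s := (Finset.univ : Finset (Fin k → ZMod 2)))]
  refine Finset.sum_congr rfl fun b _ => ?_
  rw [Finset.sum_comm]

/-- Tracing out `C` contracts the column indices. The registers `A` and the ancillas hold `0`
throughout and contribute one term each. -/
theorem reducedB_of_matrix (M : Matrix (Fin n → ZMod 2) (Fin n → ZMod 2) ℂ) :
    reducedB (toState (∑ b, ∑ c, M b c • ket (bcv m (Sum.elim b c))) :
      (Wire n m k → ZMod 2) → ℂ) = M * M.conjTranspose := by
  have h : ∀ a b c e, (toState (∑ b, ∑ c, M b c • ket (bcv m (Sum.elim b c))) :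
      (Wire n m k → ZMod 2) → ℂ) (join a (Sum.elim b c) e) = if a = 0 then if e = 0 then M b c
        else 0 else 0 := by
    intro a b c e
    simp only [map_sum, map_smul, toState_ket, restrict_bcv, Finset.sum_apply, Pi.smul_apply,
      smul_eq_mul]
    have : ∀ b' c', (Pi.single (join 0 (Sum.elim b' c') 0) 1 : (Wire n m k → ZMod 2) → ℂ)
        (join a (Sum.elim b c) e) = if b = b' then if c = c' then if a = 0 then if e = 0 then 1
          else 0 else 0 else 0 else 0 := by
      intro b' c'
      have e1 : (join a (Sum.elim b c) e : Wire n m k → ZMod 2) = join 0 (Sum.elim b' c') 0 ↔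
          b = b' ∧ c = c' ∧ a = 0 ∧ e = 0 := by
        rw [show (join a (Sum.elim b c) e : Wire n m k → ZMod 2) =
            joinEquiv ((a, Sum.elim b c), e) from rfl,
          show (join 0 (Sum.elim b' c') 0 : Wire n m k → ZMod 2) =
            joinEquiv ((0, Sum.elim b' c'), 0) from rfl, joinEquiv.injective.eq_iff, Prod.mk.injEq,
          Prod.mk.injEq, Sum.elim_eq_iff]
        tauto
      rw [Pi.single_apply, if_congr e1 rfl rfl]
      simp only [ite_and]
    simp only [this]
    rw [Finset.sum_eq_single b, Finset.sum_eq_single c]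
    · simp
    · intro c' _ hc
      rw [if_pos rfl, if_neg hc.symm, mul_zero]
    · exact fun h => absurd (Finset.mem_univ _) h
    · intro b' _ hb
      exact Finset.sum_eq_zero fun c' _ => by rw [if_neg hb.symm, mul_zero]
    · exact fun h => absurd (Finset.mem_univ _) h
  ext b b'
  simp only [reducedB, Matrix.of_apply, h, Matrix.mul_apply, Matrix.conjTranspose_apply]
  rw [Finset.sum_eq_single 0]
  · refine Finset.sum_congr rfl fun c _ => ?_
    rw [Finset.sum_eq_single 0]
    · simp
    · intro e _ he
      simp [he]
    · exact fun h => absurd (Finset.mem_univ _) h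
  · intro a _ ha
    simp [ha]
  · exact fun h => absurd (Finset.mem_univ _) h

end

namespace PauliHamiltonian

variable {n m k : ℕ} (H : PauliHamiltonian n m)

/-- If `y` had syndrome `0` and `y i = 1`, then `y + e_i` and `e_i` would share a syndrome. Either
`y = e_i`, and then `Pᵢ` is the identity, or both strings satisfy the promise and the unitary oracle
maps two different basis states to the same one. -/
theorem syndrome_ne_zero {l : ℕ} {D} (hD : H.IsDecodingOracle l D) (hI : ∀ i, H.term i ≠ 1)
    {y : Fin m → ZMod 2} (hy : y ≠ 0) (hl : hammingNorm y ≤ l) :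
    H.symplecticCode.mulVec y ≠ 0 := by
  intro h0
  obtain ⟨i, hi⟩ : ∃ i, y i ≠ 0 := Function.ne_iff.1 hy
  have hi1 : y i = 1 := (zmod_two_cases (y i)).resolve_left hi
  have hs : H.symplecticCode.mulVec (Pi.single i 1) = H.symp i := by
    rw [Matrix.mulVec_single_one]
    rfl
  have hsi : H.symp i ≠ 0 := fun h => hI i (by
    rw [term, h, ← zx_zero]
    ext x y
    simp [pauli_apply, zx, phase, pauliPhase])
  have hy' : H.symplecticCode.mulVec (y + Pi.single i 1) = H.symp i := by
    rw [Matrix.mulVec_add, h0, hs, zero_add]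
  have hne : y + Pi.single i 1 ≠ 0 := fun h => hsi (by rw [← hy', h, Matrix.mulVec_zero])
  have hle : hammingNorm (y + Pi.single i 1) ≤ hammingNorm y := by
    refine Finset.card_le_card fun j hj => ?_
    simp only [Finset.mem_filter, Finset.mem_univ, true_and] at hj ⊢
    by_cases hji : j = i
    · rw [hji]
      exact hi
    · simpa [hji] using hj
  have pos : ∀ z : Fin m → ZMod 2, z ≠ 0 → 1 ≤ hammingNorm z := fun z hz =>
    Nat.one_le_iff_ne_zero.2 (hammingNorm_ne_zero_iff.2 hz)
  have hsingle : hammingNorm (Pi.single i 1 : Fin m → ZMod 2) ≤ l := by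
    refine le_trans (Finset.card_le_card (t := {i}) fun j hj => ?_)
      ((Finset.card_singleton i).le.trans ((pos y hy).trans hl))
    by_contra hji
    simp [Finset.mem_singleton.not.1 hji] at hj
  have hd1 := hD.2 _ (pos _ hne) (hle.trans hl)
  have hd2 := hD.2 (Pi.single i 1) (pos _ fun h => by
    have := congrFun h i
    simp at this) hsingle
  rw [hy'] at hd1
  rw [hs, ← hd1] at hd2
  -- Applying the adjoint of the oracle recovers the two inputs, which must therefore coincide.
  have hd3 := congrArg (star D).mulVec hd2
  rw [Matrix.mulVec_mulVec, Matrix.mulVec_mulVec, Matrix.mem_unitaryGroup_iff'.1 hD.1,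
    Matrix.one_mulVec, Matrix.one_mulVec] at hd3
  have h4 := congrFun hd3 (Pi.single i 1, H.symp i)
  rw [Pi.single_eq_same, Pi.single_apply] at h4
  split_ifs at h4 with h5
  · have h6 := congrFun (Prod.ext_iff.1 h5).1 i
    simp only [Pi.add_apply, Pi.single_eq_same, hi1] at h6
    exact absurd h6 (by decide)
  · exact one_ne_zero h4

theorem oracle_toState {l : ℕ} {D} (hD : H.IsDecodingOracle l D) {y : Fin m → ZMod 2} (hy : y ≠ 0)
    (hl : hammingNorm y ≤ l) {f : Cfg} (hf : ∀ j < m + n + n, f j = 0) :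
    (oracleMatrix D).mulVec (toState (ket (emb y + f + bcv m (H.symplecticCode.mulVec y))) :
      (Wire n m k → ZMod 2) → ℂ) = toState (ket (f + bcv m (H.symplecticCode.mulVec y))) := by
  have hr : (restrict f : Wire n m k → ZMod 2) = join 0 0 fun i => f (m + n + n + i) := by
    funext j
    rcases j with i | (i | i) | i
    · exact hf _ (by simp only [wireNum]; omega)
    · exact hf _ (by simp only [wireNum]; omega)
    · exact hf _ (by simp only [wireNum]; omega)
    · rfl
  have hadd : ∀ (a a' : Fin m → ZMod 2) (b b' : Fin n ⊕ Fin n → ZMod 2) (e e' : Fin k → ZMod 2),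
      (join a b e + join a' b' e' : Wire n m k → ZMod 2) = join (a + a') (b + b') (e + e') := by
    intro a a' b b' e e'
    funext j
    rcases j with i | i | i <;> rfl
  rw [toState_ket, toState_ket]
  simp only [restrict_add, restrict_emb, restrict_bcv, hr, hadd, add_zero, zero_add]
  exact oracleMatrix_single (hD.2 y (Nat.one_le_iff_ne_zero.2 (hammingNorm_ne_zero_iff.2 hy)) hl) _

/-- The effect of the algorithm on one term of the reference state. -/
theorem circuit_term {l : ℕ} (hl0 : l ≠ 0) (hm : 0 < m) (hI : ∀ i, H.term i ≠ 1) {D}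
    (hD : H.IsDecodingOracle l D) {before after : List (Gate (Wire n m k))}
    (hb : ∀ ψ, (circuitMatrix before).mulVec (toState ψ) = toState (run (H.beforeGates l) ψ))
    (ha : ∀ ψ, (circuitMatrix after).mulVec (toState ψ) = toState (run (H.afterGates l) ψ))
    {y : Fin m → ZMod 2} (hl : hammingNorm y ≤ l) :
    (circuitMatrix after).mulVec ((oracleMatrix D).mulVec
      ((circuitMatrix before).mulVec (toState (ket (emb y))))) =
    toState ((((1 / Real.sqrt (1 + 1)) ^ n : ℝ) : ℂ) •
      ∑ b : Fin n → ZMod 2, ∑ c, (ordProd H.z m (emb y)) b c • ket (bcv m (Sum.elim b c))) := by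
  by_cases hy : y = 0
  · subst hy
    obtain ⟨θ, h1, h2⟩ := H.run_beforeGates_zero hl0 hm
    obtain ⟨θ', h3, h4⟩ := H.run_afterGates_flag hl0 hm
    have hs : H.symplecticCode.mulVec (Pi.single ⟨0, hm⟩ 1) = H.symp ⟨0, hm⟩ := by
      rw [Matrix.mulVec_single_one]
      rfl
    have hne : (Pi.single ⟨0, hm⟩ 1 : Fin m → ZMod 2) ≠ 0 := fun h => by
      have := congrFun h ⟨0, hm⟩
      simp at this
    have hle : hammingNorm (Pi.single ⟨0, hm⟩ 1 : Fin m → ZMod 2) ≤ l := by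
      refine le_trans (Finset.card_le_card (t := {⟨0, hm⟩}) fun j hj => ?_)
        ((Finset.card_singleton _).le.trans (Nat.one_le_iff_ne_zero.2 hl0))
      by_contra hji
      simp [Finset.mem_singleton.not.1 hji] at hj
    -- The phases come from encoding the first term and from multiplying by it again; they cancel
    -- because it is an involution.
    have hθ : θ * θ' = 1 := by
      have h5 : H.term ⟨0, hm⟩ * H.term ⟨0, hm⟩ = 1 := pauli_mul_self _
      nth_rw 2 [h2] at h5
      rw [mul_smul_comm, h4, smul_smul] at h5
      have := congrFun (congrFun h5 0) 0
      simpa using this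
    have h0 : ordProd H.z m (emb (0 : Fin m → ZMod 2)) = 1 := by
      have : emb (0 : Fin m → ZMod 2) = 0 := by funext j; simp [emb]
      simp [ordProd, this]
    rw [hb, h1, map_smul, Matrix.mulVec_smul, H.oracle_toState hD hne hle
      fun j hj => ev_of_ne (by omega), hs, Matrix.mulVec_smul, ha, h3, map_smul, smul_smul, hθ,
      one_smul, h0]
  · obtain ⟨θ, h1, h2⟩ := H.run_beforeGates_of_ne hl0 hy
    have h3 := H.oracle_toState (k := k) hD hy hl (f := 0) fun _ _ => rfl
    rw [add_zero, zero_add] at h3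
    rw [hb, h1, map_smul, Matrix.mulVec_smul, h3, Matrix.mulVec_smul, ha,
      H.run_afterGates_of_ne hl0 (H.syndrome_ne_zero hD hI hy hl), h2, ← map_smul, smul_comm,
      Finset.smul_sum]
    simp only [Finset.smul_sum, Matrix.smul_apply, smul_smul, smul_eq_mul]

end PauliHamiltonian

/-! ### The output state for positive degree bound. -/

namespace PauliHamiltonian

variable {n m k : ℕ} (H : PauliHamiltonian n m)

theorem sum_normSq_refState {l : ℕ} {P : Polynomial ℝ} (hP : P.natDegree ≤ l)
    (htr : Matrix.trace (H.polyOp P ^ 2) ≠ 0) : ∑ y, Complex.normSq (H.refState l P y) = 1 := by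
  have hpos := H.sum_refAmplitude_pos hP htr
  simp only [refState, Complex.normSq_ofReal, ← sq, div_pow, Real.sq_sqrt hpos.le]
  rw [← Finset.sum_div, div_self hpos.ne']

/-- Every stage preserves the norm. Knowing the trace replaces the computation of the normalizing
factors and of traces of Pauli products. -/
theorem trace_final {l : ℕ} {P : Polynomial ℝ} (hP : P.natDegree ≤ l)
    (htr : Matrix.trace (H.polyOp P ^ 2) ≠ 0) {D} (hD : H.IsDecodingOracle l D)
    (before after : List (Gate (Wire n m k))) :
    Matrix.trace (reducedB ((circuitMatrix after).mulVec ((oracleMatrix D).mulVec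
      ((circuitMatrix before).mulVec (withZeros (H.refState l P)))))) = 1 := by
  rw [trace_reducedB, sum_normSq_mulVec (circuitMatrix_mem_unitaryGroup _),
    sum_normSq_oracleMatrix hD.1, sum_normSq_mulVec (circuitMatrix_mem_unitaryGroup _),
    sum_normSq_withZeros, H.sum_normSq_refState hP htr, Complex.ofReal_one]

/-- By linearity the final state is the superposition of the encoded ordered products, that is, the
vectorization of a real multiple of `P(H)`. That matrix is Hermitian, so the reduced state is a
multiple of its square, and trace one fixes the multiple. -/
theorem reducedB_of_ne_zero {l : ℕ} (hl : l ≠ 0) (hm : 0 < m) (hI : ∀ i, H.term i ≠ 1)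
    {P : Polynomial ℝ} (hP : P.natDegree ≤ l) (htr : Matrix.trace (H.polyOp P ^ 2) ≠ 0) {D}
    (hD : H.IsDecodingOracle l D) {before after : List (Gate (Wire n m k))}
    (hb : ∀ ψ, (circuitMatrix before).mulVec (toState ψ) = toState (run (H.beforeGates l) ψ))
    (ha : ∀ ψ, (circuitMatrix after).mulVec (toState ψ) = toState (run (H.afterGates l) ψ)) :
    reducedB ((circuitMatrix after).mulVec ((oracleMatrix D).mulVec
      ((circuitMatrix before).mulVec (withZeros (H.refState l P))))) = H.rho P := by
  have htrace := H.trace_final hP htr hD before after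
  have h1 : (circuitMatrix after).mulVec ((oracleMatrix D).mulVec
      ((circuitMatrix before).mulVec (withZeros (H.refState l P)))) =
      toState (∑ b, ∑ c, (((((1 / Real.sqrt (1 + 1)) ^ n /
        Real.sqrt (∑ y, H.refAmplitude l P y ^ 2) : ℝ) : ℂ) • H.polyOp P) b c) •
          ket (bcv m (Sum.elim b c))) := by
    rw [withZeros_eq, map_sum, Matrix.mulVec_sum, Matrix.mulVec_sum, Matrix.mulVec_sum]
    have h2 : ∀ y, (circuitMatrix after).mulVec ((oracleMatrix D).mulVec
        ((circuitMatrix before).mulVec (toState (H.refState l P y • ket (emb y))))) =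
        toState (∑ b, ∑ c, ((((1 / Real.sqrt (1 + 1)) ^ n /
          Real.sqrt (∑ y, H.refAmplitude l P y ^ 2) : ℝ) : ℂ) *
          (((H.refAmplitude l P y : ℝ) : ℂ) * ordProd H.z m (emb y) b c)) •
          ket (bcv m (Sum.elim b c))) := by
      intro y
      rw [map_smul, Matrix.mulVec_smul, Matrix.mulVec_smul, Matrix.mulVec_smul]
      by_cases hy : hammingNorm y ≤ l
      · rw [H.circuit_term hl hm hI hD hb ha hy, ← map_smul, smul_smul, Finset.smul_sum]
        simp only [Finset.smul_sum, smul_smul, refState]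
        congr 1
        refine Finset.sum_congr rfl fun b _ => Finset.sum_congr rfl fun c _ => ?_
        congr 1
        push_cast
        ring
      -- Heavier strings are outside the promise, but they have amplitude zero.
      · have h3 := H.refAmplitude_eq_zero P (not_le.1 hy)
        simp [refState, h3]
    simp only [h2]
    rw [← map_sum, Finset.sum_comm]
    congr 1
    refine Finset.sum_congr rfl fun b _ => ?_
    rw [Finset.sum_comm]
    refine Finset.sum_congr rfl fun c _ => ?_
    rw [← Finset.sum_smul, ← Finset.mul_sum, H.polyOp_eq hP, Matrix.smul_apply, Matrix.sum_apply]
    rfl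
  rw [h1, reducedB_of_matrix] at htrace ⊢
  rw [Matrix.conjTranspose_smul, (H.polyOp_isHermitian P).eq, smul_mul_assoc, mul_smul_comm, smul_smul,
    ← sq (H.polyOp P)] at htrace ⊢
  rw [Matrix.trace_smul, smul_eq_mul] at htrace
  rw [rho, eq_inv_of_mul_eq_one_left htrace]

end PauliHamiltonian

/-! ### Degree bound zero: registers maximally entangled with the ancillas. -/

section

variable {n m k : ℕ}

/-- The contents of the registers `A`, `B` and `C` as a function of the number of the qubit. -/
def numberEquiv : ((Fin m → ZMod 2) × (Fin n ⊕ Fin n → ZMod 2)) ≃ (Fin (m + n + n) → ZMod 2) :=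
  ((Equiv.prodUnique _ (Fin 0 → ZMod 2)).symm.trans joinEquiv).trans
    ((Equiv.ofBijective (fun w : Wire n m 0 => (⟨wireNum w, wireNum_lt w⟩ : Fin (m + n + n)))
      ⟨fun _ _ h => wireNum_injective (congrArg Fin.val h), fun j =>
        let ⟨w, hw⟩ := exists_wireNum (k := 0) j.2
        ⟨w, Fin.ext hw⟩⟩).arrowCongr (Equiv.refl _))

theorem numberEquiv_apply (t : (Fin m → ZMod 2) × (Fin n ⊕ Fin n → ZMod 2)) (w : Wire n m 0)
    (h : wireNum w < m + n + n) : numberEquiv t ⟨wireNum w, h⟩ = join t.1 t.2 0 w := by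
  have : (⟨wireNum w, h⟩ : Fin (m + n + n)) =
    Equiv.ofBijective (fun w : Wire n m 0 => (⟨wireNum w, wireNum_lt w⟩ : Fin (m + n + n)))
      ⟨fun _ _ h => wireNum_injective (congrArg Fin.val h), fun j =>
        let ⟨w, hw⟩ := exists_wireNum (k := 0) j.2
        ⟨w, Fin.ext hw⟩⟩ w := rfl
  rw [this]
  simp only [numberEquiv, Equiv.trans_apply, Equiv.arrowCongr_apply, Function.comp_apply,
    Equiv.symm_apply_apply]
  rcases w with i | i | i
  · rfl
  · rfl
  · exact i.elim0

/-- The contents of the ancillas that are entangled with the contents `t` of the registers. -/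
def copy (k : ℕ) (t : (Fin m → ZMod 2) × (Fin n ⊕ Fin n → ZMod 2)) : Fin k → ZMod 2 :=
  fun e => if h : e < m + n + n then numberEquiv t ⟨e, h⟩ else 0

theorem copy_injective (hk : m + n + n ≤ k) :
    Function.Injective (copy k : (Fin m → ZMod 2) × (Fin n ⊕ Fin n → ZMod 2) → _) := by
  intro t t' h
  refine numberEquiv.injective (funext fun j => ?_)
  have := congrFun h ⟨j, j.2.trans_le hk⟩
  simpa [copy] using this

theorem restrict_numberEquiv (t : (Fin m → ZMod 2) × (Fin n ⊕ Fin n → ZMod 2)) :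
    (restrict (blk (m + n + n) (numberEquiv t) + blk 0 (numberEquiv t)) : Wire n m k → ZMod 2) =
      join t.1 t.2 (copy k t) := by
  have key : ∀ w : Wire n m 0, (blk (m + n + n) (numberEquiv t) + blk 0 (numberEquiv t)) (wireNum w) =
      join t.1 t.2 0 w := by
    intro w
    have hw : wireNum w < m + n + n := wireNum_lt w
    rw [Pi.add_apply, blk_apply, blk_apply, dif_neg (by omega), dif_pos ⟨by omega, by omega⟩, zero_add]
    exact numberEquiv_apply t w hw
  funext j
  rcases j with i | i | i
  · exact key (Sum.inl i)
  · rcases i with i | i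
    · exact key (Sum.inr (Sum.inl (Sum.inl i)))
    · exact key (Sum.inr (Sum.inl (Sum.inr i)))
  · change (blk (m + n + n) (numberEquiv t) + blk 0 (numberEquiv t)) (m + n + n + i) = copy k t i
    rw [Pi.add_apply, blk_apply, blk_apply, dif_neg (c := 0 ≤ _ ∧ _) (by omega), add_zero, copy]
    by_cases h : (i : ℕ) < m + n + n
    · rw [dif_pos ⟨by omega, by omega⟩, dif_pos h]
      exact congrArg (numberEquiv t) (Fin.ext (Nat.add_sub_cancel_left _ _))
    · rw [dif_neg (by omega), dif_neg h]

/-- The state of the registers and the ancillas that are entangled with them. -/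
theorem toState_bell (κ : ℂ)
    (t : (Fin m → ZMod 2) × (Fin n ⊕ Fin n → ZMod 2)) (e : Fin k → ZMod 2) :
    (toState (κ • ∑ b : Fin (m + n + n) → ZMod 2, ket (blk (m + n + n) b + blk 0 b)) :
      (Wire n m k → ZMod 2) → ℂ) (join t.1 t.2 e) = if e = copy k t then κ else 0 := by
  rw [← numberEquiv.sum_comp, map_smul, map_sum, Pi.smul_apply, Finset.sum_apply]
  simp only [toState_ket, restrict_numberEquiv]
  have h : ∀ t', (Pi.single (join t'.1 t'.2 (copy k t')) 1 : (Wire n m k → ZMod 2) → ℂ)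
      (join t.1 t.2 e) = if t = t' then if e = copy k t' then 1 else 0 else 0 := by
    intro t'
    have e1 : (join t.1 t.2 e : Wire n m k → ZMod 2) = join t'.1 t'.2 (copy k t') ↔
        t = t' ∧ e = copy k t' := by
      rw [show (join t.1 t.2 e : Wire n m k → ZMod 2) = joinEquiv (t, e) from rfl,
        show (join t'.1 t'.2 (copy k t') : Wire n m k → ZMod 2) = joinEquiv (t', copy k t') from rfl,
        joinEquiv.injective.eq_iff, Prod.mk.injEq]
    rw [Pi.single_apply, if_congr e1 rfl rfl, ite_and]
  simp [h]

/-- The ancillas hold a copy of the register contents `t`, so tracing them out adds up the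
contributions of the columns of `D` incoherently. The orthonormality of the rows of `D` leaves a
multiple of the identity. -/
theorem reducedB_bell {D : Matrix ((Fin m → ZMod 2) × (Fin n ⊕ Fin n → ZMod 2))
    ((Fin m → ZMod 2) × (Fin n ⊕ Fin n → ZMod 2)) ℂ}
    (hD : D ∈ Matrix.unitaryGroup ((Fin m → ZMod 2) × (Fin n ⊕ Fin n → ZMod 2)) ℂ) (κ : ℂ)
    (hk : m + n + n ≤ k) : ∃ r : ℂ, reducedB ((oracleMatrix D).mulVec
      (toState (κ • ∑ b : Fin (m + n + n) → ZMod 2, ket (blk (m + n + n) b + blk 0 b)) :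
        (Wire n m k → ZMod 2) → ℂ)) = r • 1 := by
  refine ⟨∑ _ : Fin m → ZMod 2, ∑ _ : Fin n → ZMod 2, κ * star κ, ?_⟩
  ext b b'
  simp only [reducedB, Matrix.of_apply, oracleMatrix_mulVec, toState_bell κ, Matrix.smul_apply,
    smul_eq_mul, Finset.sum_mul]
  refine Finset.sum_congr rfl fun a _ => Finset.sum_congr rfl fun c _ => ?_
  have h : ∀ x t, D.mulVec (fun t' => if copy k t = copy k t' then κ else 0) x = D x t * κ := by
    intro x t
    simp only [(copy_injective hk).eq_iff, Matrix.mulVec, dotProduct]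
    simp
  rw [← Fintype.sum_of_injective (copy k) (copy_injective hk)
    (fun t => κ * star κ * (D (a, Sum.elim b c) t * star (D (a, Sum.elim b' c) t)))]
  · rw [← Finset.mul_sum]
    congr 1
    have h2 := congrFun (congrFun (Matrix.mem_unitaryGroup_iff.1 hD) (a, Sum.elim b c))
      (a, Sum.elim b' c)
    rw [Matrix.mul_apply] at h2
    simp only [Matrix.star_apply] at h2
    rw [h2, Matrix.one_apply, Matrix.one_apply]
    refine if_congr ?_ rfl rfl
    simp [Sum.elim_eq_iff]
  · intro e he
    have : (fun t => if e = copy k t then κ else 0) =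
        (0 : (Fin m → ZMod 2) × (Fin n ⊕ Fin n → ZMod 2) → ℂ) :=
      funext fun t => if_neg fun h => he ⟨t, h.symm⟩
    rw [this, Matrix.mulVec_zero]
    simp
  · intro t
    rw [h, h, star_mul']
    ring

end

namespace PauliHamiltonian

variable {n m k : ℕ} (H : PauliHamiltonian n m)

/-- Here the oracle is an arbitrary unitary, the reference state lives on the zero string, and
`P(H)` is a scalar. Both sides are multiples of the identity of trace one. -/
theorem reducedB_zero {P : Polynomial ℝ} (hP : P.natDegree ≤ 0)
    (htr : Matrix.trace (H.polyOp P ^ 2) ≠ 0) {D} (hD : H.IsDecodingOracle 0 D)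
    (hk : m + n + n ≤ k) {before after : List (Gate (Wire n m k))}
    (hb : ∀ ψ, (circuitMatrix before).mulVec (toState ψ) = toState (run (H.beforeGates 0) ψ))
    (ha : after.map encodeGate = H.afterGates 0) :
    reducedB ((circuitMatrix after).mulVec ((oracleMatrix D).mulVec
      ((circuitMatrix before).mulVec (withZeros (H.refState 0 P))))) = H.rho P := by
  have htrace := H.trace_final hP htr hD before after
  have hy : ∀ y : Fin m → ZMod 2, y ≠ 0 → H.refState 0 P y = 0 := fun y hy => by
    have := H.refAmplitude_eq_zero P (l := 0) (Nat.pos_of_ne_zero (hammingNorm_ne_zero_iff.2 hy))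
    simp [refState, this]
  have h0 : emb (0 : Fin m → ZMod 2) = 0 := by funext j; simp [emb]
  have hafter : after = [] := List.map_eq_nil_iff.1 ha
  have h1 : ∃ κ : ℂ, (circuitMatrix before).mulVec (withZeros (H.refState 0 P)) =
      (toState (κ • ∑ b : Fin (m + n + n) → ZMod 2, ket (blk (m + n + n) b + blk 0 b)) :
        (Wire n m k → ZMod 2) → ℂ) := by
    refine ⟨H.refState 0 P 0 * (((1 / Real.sqrt (1 + 1)) ^ (m + n + n) : ℝ) : ℂ), ?_⟩
    rw [withZeros_eq, Finset.sum_eq_single 0 (fun y _ h => by rw [hy y h, zero_smul])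
      (fun h => absurd (Finset.mem_univ _) h), h0, hb, map_smul, beforeGates, if_pos rfl,
      run_bellGates (by omega)]
    simp only [Pi.zero_apply, mul_zero, chi_zero, Finset.prod_const_one, Complex.ofReal_one, one_smul,
      add_zero, zero_add, smul_smul]
  obtain ⟨κ, h1⟩ := h1
  obtain ⟨r, h2⟩ := reducedB_bell (k := k) hD.1 κ hk
  rw [hafter, circuitMatrix, List.foldl_nil, Matrix.one_mulVec, h1, h2] at htrace ⊢
  have h3 : H.polyOp P ^ 2 = ((P.coeff 0 ^ 2 : ℝ) : ℂ) • 1 := by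
    rw [polyOp, Polynomial.eq_C_of_natDegree_le_zero hP, Polynomial.aeval_C, ← map_pow,
      Algebra.algebraMap_eq_smul_one, Polynomial.coeff_C_zero, Complex.coe_smul]
  rw [h3, Matrix.trace_smul, smul_eq_mul] at htr
  rw [Matrix.trace_smul, smul_eq_mul] at htrace
  rw [rho, h3, Matrix.trace_smul, smul_eq_mul, smul_smul, mul_inv, mul_comm, ← mul_assoc,
    mul_inv_cancel₀ (left_ne_zero_of_mul htr), one_mul, eq_inv_of_mul_eq_one_left htrace]

theorem reducedB_eq {l : ℕ} (hm : 0 < m) (hI : ∀ i, H.term i ≠ 1)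
    {P : Polynomial ℝ} (hP : P.natDegree ≤ l) (htr : Matrix.trace (H.polyOp P ^ 2) ≠ 0) {D}
    (hD : H.IsDecodingOracle l D) (hk : m + n + n ≤ k) {before after : List (Gate (Wire n m k))}
    (hb : ∀ ψ, (circuitMatrix before).mulVec (toState ψ) = toState (run (H.beforeGates l) ψ))
    (ha' : after.map encodeGate = H.afterGates l)
    (ha : ∀ ψ, (circuitMatrix after).mulVec (toState ψ) = toState (run (H.afterGates l) ψ)) :
    reducedB ((circuitMatrix after).mulVec ((oracleMatrix D).mulVec
      ((circuitMatrix before).mulVec (withZeros (H.refState l P))))) = H.rho P := by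
  rcases Nat.eq_zero_or_pos l with rfl | hl
  · exact H.reducedB_zero hP htr hD hk hb ha'
  · exact H.reducedB_of_ne_zero hl.ne' hm hI hP htr hD hb ha

end PauliHamiltonian

/-! ### Computability of the component data and of single elimination steps. -/

/-- The function given by a list. -/
def cOf (L : List ℝ) : ℕ → ℝ := fun q => L.getD q 0

/-- The function given by a table. -/
def sOf (T : List (List ℝ)) : ℕ → ℕ → ℝ := fun p q => (T.getD p []).getD q 1

/-- Without the recursion the circuit is a concatenation of independent blocks, to which the
combinator `flatMap` applies directly. -/
theorem emit_snd (b d : ℕ) (C : List ℕ) : (emit b d C).2 =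
    (List.range C.length).flatMap fun j => emitOne b (d * 2 ^ (C.length - (j + 1))) (C.getD j 0) := by
  induction C with
  | nil => rfl
  | cons q C ih =>
    rw [emit_cons, ih, emit_fst, List.length_cons, List.range_succ_eq_map, List.flatMap_cons,
      List.flatMap_map]
    simp

theorem labStep_bdd {σ : ℕ → ℕ → ℝ} {m : ℕ} {lab : List ℕ} {p : ℕ × ℕ}
    (h : lab.length = m ∧ ∀ x ∈ lab, x < m) (hp : p.1 < m) :
    (labStep σ lab p).length = m ∧ ∀ x ∈ labStep σ lab p, x < m := by
  rw [labStep]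
  split_ifs
  · refine ⟨by simp [h.1], fun x hx => ?_⟩
    obtain ⟨y, hy, rfl⟩ := List.mem_map.1 hx
    split_ifs
    · rw [List.getD_eq_getElem _ _ (by rw [h.1]; exact hp)]
      exact h.2 _ (List.getElem_mem _)
    · exact h.2 y hy
  · exact h

namespace Cpt

variable {ι κ : Type} {sz : ι → ℕ} {E : Ty} {e : ι → E.Val}

theorem cOf {L : ι → List ℝ} {q : ι → ℕ} (hL : Cpt sz e (.list .real) L) (hq : Cpt sz e .nat q) :
    Cpt sz e .real fun i => HDQI.cOf (L i) (q i) := hL.getD hq zero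

theorem sOf {T : ι → List (List ℝ)} {p q : ι → ℕ} (hT : Cpt sz e (.list (.list .real)) T)
    (hp : Cpt sz e .nat p) (hq : Cpt sz e .nat q) :
    Cpt sz e .real fun i => HDQI.sOf (T i) (p i) (q i) :=
  (hT.getD (A := .list .real) hp (nil .real)).getD hq one

theorem allPairs {m : ι → ℕ} (hm : Cpt sz e .nat m) :
    Cpt sz e (.list (.prod .nat .nat)) fun i => HDQI.allPairs (m i) :=
  hm.range.flatMap (A := .nat) (B := .prod .nat .nat) _ fun hi =>
    hm.up.range.map (A := .nat) (B := .prod .nat .nat) _ fun hj => hi.up.pair hj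

open Classical in
theorem labStep {T : ι → List (List ℝ)} {lab : ι → List ℕ} {p : ι → ℕ × ℕ}
    (hT : Cpt sz e (.list (.list .real)) T) (hl : Cpt sz e (.list .nat) lab)
    (hp : Cpt sz e (.prod .nat .nat) p) :
    Cpt sz e (.list .nat) fun i => HDQI.labStep (HDQI.sOf (T i)) (lab i) (p i) := by
  have h1 : Cpt sz e .nat fun i => (p i).1 := hp.fst
  have h2 : Cpt sz e .nat fun i => (p i).2 := hp.snd
  refine (ite ((hT.sOf h1 h2).rlt zero) (hl.map (A := .nat) (B := .nat)
    (fun i x => if x = (lab i).getD (p i).2 0 then (lab i).getD (p i).1 0 else x) fun hx =>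
      ite (hx.eq (hl.up.getD (A := .nat) h2.up (nat 0))) (hl.up.getD (A := .nat) h1.up (nat 0)) hx)
    hl).congr fun i => ?_
  rw [HDQI.labStep]

theorem labels {T : ι → List (List ℝ)} {m : ι → ℕ} (hT : Cpt sz e (.list (.list .real)) T)
    (hm : Cpt sz e .nat m) :
    Cpt sz e (.list .nat) fun i => HDQI.labels (HDQI.sOf (T i)) (m i) := by
  refine hm.range.foldl (S := .list .nat) (A := .prod .nat .nat)
    (L := fun i => HDQI.allPairs (m i)) (fun i => HDQI.labStep (HDQI.sOf (T i)))
    (fun i _ lab => lab.length = m i ∧ ∀ x ∈ lab, x < m i) hm.allPairs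
    (fun i => by simp) (fun i j s a _ ha h => labStep_bdd h ?_) hm.nat_bdd
    (fun i j s _ h => ⟨h.1.le, fun x hx => (h.2 x hx).le⟩) fun hs ha => hT.up.labStep hs ha
  simp only [HDQI.allPairs, List.mem_flatMap, List.mem_map, List.mem_range] at ha
  obtain ⟨i, hi, j, -, rfl⟩ := ha
  exact hi

theorem comps {lab : ι → List ℕ} {m : ι → ℕ} (hm : Cpt sz e .nat m)
    (hl : Cpt sz e (.list .nat) lab) :
    Cpt sz e (.list (.list .nat)) fun i => HDQI.comps (m i) (lab i) :=
  hm.range.map (A := .nat) (B := .list .nat) _ fun hr =>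
    (hm.up.range.filter (A := .nat) _ fun hi =>
      (hl.up.up.getD (A := .nat) hi (nat 0)).eq hr.up)

/-- The list of sublists is exponential in the length of `C`; `hb` is what makes this polynomial in
the size. -/
theorem subs {C : ι → List ℕ} (hC : Cpt sz e (.list .nat) C)
    (hb : PolyBdd sz fun i => 2 ^ (C i).length) :
    Cpt sz e (.list (.list .nat)) fun i => HDQI.subs (C i) := by
  obtain ⟨U, hU, hbC⟩ := hC.bdd
  have h1 : Cpt sz e (.list (.list .nat)) fun _ => ([[]] : List (List ℕ)) :=
    cons (A := .list .nat) (nil .nat) (nil _)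
  refine (foldl (S := .list (.list .nat)) (A := .nat)
    (fun _ s q => s ++ s.map (q :: ·)) (fun i j s => s.length = 2 ^ j ∧ ∀ x ∈ s, x.length ≤ j ∧
      ∀ y ∈ x, y ≤ U i) h1 hC.reverse (fun i => by simp) ?_ (hb.add hU) ?_
    fun hs ha => hs.append (A := .list .nat) (hs.map (A := .list .nat) (B := .list .nat) _ fun hx =>
      ha.up.cons hx)).congr fun i => ?_
  · rintro i j s q - hq ⟨h1, h2⟩
    refine ⟨by simp [h1, pow_succ]; ring, fun x hx => ?_⟩
    rcases List.mem_append.1 hx with hx | hx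
    · exact ⟨(h2 x hx).1.trans (Nat.le_succ j), (h2 x hx).2⟩
    · obtain ⟨y, hy, rfl⟩ := List.mem_map.1 hx
      refine ⟨Nat.succ_le_succ (h2 y hy).1, fun z hz => ?_⟩
      rcases List.mem_cons.1 hz with rfl | hz
      · exact (hbC i).2 _ (List.mem_reverse.1 hq)
      · exact (h2 y hy).2 z hz
  · rintro i j s hj ⟨h1, h2⟩
    rw [List.length_reverse] at hj
    have h3 := (hbC i).1
    refine ⟨?_, fun x hx => ⟨?_, fun y hy => ?_⟩⟩
    · rw [h1]
      exact (Nat.pow_le_pow_right (by omega) hj).trans (Nat.le_add_right _ _)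
    · exact ((h2 x hx).1.trans (hj.trans h3)).trans (Nat.le_add_left _ _)
    · exact ((h2 x hx).2 y hy).trans (Nat.le_add_left _ _)
  · rw [List.foldl_reverse]
    rfl

theorem toggles {C x x' : ι → List ℕ} {q : ι → ℕ} (hC : Cpt sz e (.list .nat) C)
    (hq : Cpt sz e .nat q) (hx : Cpt sz e (.list .nat) x) (hx' : Cpt sz e (.list .nat) x') :
    Cpt sz e .bool fun i => decide (Toggles (C i) (q i) (x i) (x' i)) :=
  hC.all (A := .nat) (fun i j => ((j ∈ x i) ↔ ¬ (j ∈ x' i)) ↔ j = q i) fun hj =>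
    ((hx.up.mem hj).iff (hx'.up.mem hj).not).iff (hj.eq hq.up)

theorem insSignList {T : ι → List (List ℝ)} {q : ι → ℕ} {x : ι → List ℕ}
    (hT : Cpt sz e (.list (.list .real)) T) (hq : Cpt sz e .nat q) (hx : Cpt sz e (.list .nat) x) :
    Cpt sz e .real fun i => HDQI.insSignList (HDQI.sOf (T i)) (q i) (x i) :=
  (hx.map (A := .nat) (B := .real) _ fun hj =>
    ite (hj.lt hq.up) (hT.up.sOf hq.up hj) one).listProd

theorem compEntry {c : ι → List ℝ} {T : ι → List (List ℝ)} {C x x' : ι → List ℕ}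
    (hc : Cpt sz e (.list .real) c) (hT : Cpt sz e (.list (.list .real)) T)
    (hC : Cpt sz e (.list .nat) C) (hx : Cpt sz e (.list .nat) x) (hx' : Cpt sz e (.list .nat) x') :
    Cpt sz e .real fun i =>
      HDQI.compEntry (HDQI.cOf (c i)) (HDQI.sOf (T i)) (C i) (x i) (x' i) :=
  (hC.map (A := .nat) (B := .real) _ fun hq =>
    ite (hC.up.toggles hq hx.up hx'.up) ((hc.up.cOf hq).rmul (hT.up.insSignList hq hx'.up))
      zero).listSum

/-- The type of the table of coefficients. -/
abbrev tabTy : Ty := .list (.prod (.list .nat) (.list .real))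

theorem tabStep {c : ι → List ℝ} {T : ι → List (List ℝ)} {C : ι → List ℕ}
    {tab : ι → List (List ℕ × List ℝ)} {u : ι → ℕ}
    (hc : Cpt sz e (.list .real) c) (hT : Cpt sz e (.list (.list .real)) T)
    (hC : Cpt sz e (.list .nat) C) (htab : Cpt sz e tabTy tab) (hu : Cpt sz e .nat u) :
    Cpt sz e tabTy fun i =>
      HDQI.tabStep (HDQI.cOf (c i)) (HDQI.sOf (T i)) (C i) (tab i) (u i) :=
  htab.map (A := .prod (.list .nat) (.list .real)) (B := .prod (.list .nat) (.list .real)) _ fun hp =>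
    hp.fst.pair (cons (A := .real) (((htab.up.map (A := .prod (.list .nat) (.list .real)) (B := .real) _
      fun hp' => (hc.up.up.compEntry hT.up.up hC.up.up hp.up.fst hp'.fst).rmul
        (hp'.snd.getD (A := .real) (nat 0) zero)).listSum).rdiv (hu.up.natCast.radd one)) hp.snd)

theorem coeffTab {c : ι → List ℝ} {T : ι → List (List ℝ)} {C : ι → List ℕ} {l : ι → ℕ}
    (hc : Cpt sz e (.list .real) c) (hT : Cpt sz e (.list (.list .real)) T)
    (hC : Cpt sz e (.list .nat) C) (hl : Cpt sz e .nat l)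
    (hb : PolyBdd sz fun i => 2 ^ (C i).length) :
    Cpt sz e tabTy fun i => HDQI.coeffTab (HDQI.cOf (c i)) (HDQI.sOf (T i)) (C i) (l i) := by
  have hs := hC.subs hb
  obtain ⟨U, hU, hbs⟩ := hs.bdd
  have h0 : Cpt sz e tabTy fun i => (HDQI.subs (C i)).map fun x =>
      (x, [if x.length = 0 then (1 : ℝ) else 0]) :=
    hs.map (A := .list .nat) (B := .prod (.list .nat) (.list .real)) _ fun hx =>
      hx.pair (cons (A := .real) (ite (hx.length.eq (nat 0)) one zero) (nil .real))
  refine h0.foldl (S := tabTy) (A := .nat) (L := fun i => List.range (l i))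
    (fun i => HDQI.tabStep (HDQI.cOf (c i)) (HDQI.sOf (T i)) (C i))
    (fun i j tab => tab.length = (HDQI.subs (C i)).length ∧
      ∀ p ∈ tab, p.1 ∈ HDQI.subs (C i) ∧ p.2.length = j + 1) hl.range (fun i => ⟨by simp, ?_⟩) ?_
    (hU.add (hl.nat_bdd.add (.const 1))) ?_ fun hs ha => hc.up.tabStep hT.up hC.up hs ha
  · intro p hp
    obtain ⟨x, hx, rfl⟩ := List.mem_map.1 hp
    exact ⟨hx, rfl⟩
  · rintro i j tab u - - ⟨h1, h2⟩
    refine ⟨by simp [HDQI.tabStep, h1], fun p hp => ?_⟩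
    obtain ⟨p', hp', rfl⟩ := List.mem_map.1 hp
    exact ⟨(h2 p' hp').1, congrArg (· + 1) (h2 p' hp').2⟩
  · rintro i j tab hj ⟨h1, h2⟩
    rw [List.length_range] at hj
    refine ⟨?_, fun p hp => ⟨?_, ?_, fun _ _ => trivial⟩⟩
    · have := (hbs i).1
      omega
    · exact ((hbs i).2 _ (h2 p hp).1).mono (by omega)
    · rw [(h2 p hp).2]
      omega

/-- The type of a circuit. -/
abbrev circTy : Ty := .list gateTy

/-- The type of the state of the computation of the preparation circuit. -/
abbrev colTy : Ty := .prod (.list (.list .real)) circTy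

theorem gate {cs : ι → List ℕ} {t : ι → ℕ} {a₁ a₂ b₁ b₂ c₁ c₂ d₁ d₂ : ι → ℝ}
    (hcs : Cpt sz e (.list .nat) cs) (ht : Cpt sz e .nat t) (ha₁ : Cpt sz e .real a₁)
    (ha₂ : Cpt sz e .real a₂) (hb₁ : Cpt sz e .real b₁) (hb₂ : Cpt sz e .real b₂)
    (hc₁ : Cpt sz e .real c₁) (hc₂ : Cpt sz e .real c₂) (hd₁ : Cpt sz e .real d₁)
    (hd₂ : Cpt sz e .real d₂) : Cpt sz e gateTy fun i =>
      (cs i, t i, ((a₁ i, a₂ i), (b₁ i, b₂ i)), ((c₁ i, c₂ i), (d₁ i, d₂ i))) :=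
  hcs.pair (ht.pair (((ha₁.pair ha₂).pair (hb₁.pair hb₂)).pair ((hc₁.pair hc₂).pair (hd₁.pair hd₂))))

theorem rX {cs : ι → List ℕ} {t : ι → ℕ} (hcs : Cpt sz e (.list .nat) cs) (ht : Cpt sz e .nat t) :
    Cpt sz e gateTy fun i => HDQI.rX (cs i) (t i) :=
  gate hcs ht zero zero one zero one zero zero zero

theorem cX {a t : ι → ℕ} (ha : Cpt sz e .nat a) (ht : Cpt sz e .nat t) :
    Cpt sz e gateTy fun i => HDQI.rX [a i] (t i) :=
  rX (ha.cons (nil .nat)) ht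

theorem ccX {a a' t : ι → ℕ} (ha : Cpt sz e .nat a) (ha' : Cpt sz e .nat a')
    (ht : Cpt sz e .nat t) : Cpt sz e gateTy fun i => HDQI.rX [a i, a' i] (t i) :=
  rX (ha.cons (ha'.cons (nil .nat))) ht

theorem emitOne {b h q : ι → ℕ} (hb : Cpt sz e .nat b) (hh : Cpt sz e .nat h)
    (hq : Cpt sz e .nat q) : Cpt sz e circTy fun i => HDQI.emitOne (b i) (h i) (q i) :=
  hh.range.flatMap (A := .nat) (B := gateTy) _ fun hu =>
    have h1 := hb.up.add (hh.up.add hu)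
    have h2 := hb.up.add hu
    (h1.cX hq.up).cons ((h1.cX h2).cons ((hq.up.ccX h2 h1).cons (nil gateTy)))

theorem emit_fst {d : ι → ℕ} {C : ι → List ℕ} (hd : Cpt sz e .nat d)
    (hC : Cpt sz e (.list .nat) C) (h2 : PolyBdd sz fun i => 2 ^ (C i).length) :
    Cpt sz e .nat fun i => d i * 2 ^ (C i).length :=
  hd.mul (hC.length.two_pow h2)

theorem emit_snd {b d : ι → ℕ} {C : ι → List ℕ} (hb : Cpt sz e .nat b) (hd : Cpt sz e .nat d)
    (hC : Cpt sz e (.list .nat) C) (h2 : PolyBdd sz fun i => 2 ^ (C i).length) :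
    Cpt sz e circTy fun i => (HDQI.emit (b i) (d i) (C i)).2 :=
  (hC.length.range.flatMap (A := .nat) (B := gateTy) (fun i j => HDQI.emitOne (b i)
    (d i * 2 ^ ((C i).length - (j + 1))) ((C i).getD j 0)) fun hj =>
    hb.up.emitOne (hd.up.mul ((hC.up.length.sub (hj.add (nat 1))).two_pow
      ((h2.comap MapIdx.i).mono fun _ => Nat.pow_le_pow_right (by omega) (Nat.sub_le _ _))))
      (hC.up.getD (A := .nat) hj (nat 0))).congr fun i => (HDQI.emit_snd _ _ _).symm

theorem conv {l : ι → ℕ} {f r : ι → List ℝ} (hl : Cpt sz e .nat l) (hf : Cpt sz e (.list .real) f)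
    (hr : Cpt sz e (.list .real) r) : Cpt sz e (.list .real) fun i => HDQI.conv (l i) (f i) (r i) :=
  (hl.add (nat 1)).range.map (A := .nat) (B := .real) _ fun ht =>
    (ht.add (nat 1)).sumRange _ fun hu =>
      (hf.up.up.getD (A := .real) (hl.up.up.sub hu) zero).rmul
        (hr.up.up.getD (A := .real) (ht.up.sub hu) zero)

theorem expand {l : ι → ℕ} {tab : ι → List (List ℕ × List ℝ)} {cols : ι → List (List ℝ)}
    (hl : Cpt sz e .nat l) (htab : Cpt sz e tabTy tab)
    (hc : Cpt sz e (.list (.list .real)) cols) :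
    Cpt sz e (.list (.list .real)) fun i => HDQI.expand (l i) (tab i) (cols i) :=
  htab.flatMap (A := .prod (.list .nat) (.list .real)) (B := .list .real) _ fun hp =>
    hc.up.map (A := .list .real) (B := .list .real) _ fun hr => hl.up.up.conv hp.up.snd hr

theorem truncCols {N : ι → ℕ} {cols : ι → List (List ℝ)} (hN : Cpt sz e .nat N)
    (hc : Cpt sz e (.list (.list .real)) cols) :
    Cpt sz e (.list (.list .real)) fun i => HDQI.truncCols (N i) (cols i) :=
  hN.range.map (A := .nat) (B := .list .real) _ fun hv =>
    hc.up.getD (A := .list .real) hv (nil .real)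

theorem ent {cols : ι → List (List ℝ)} {v t : ι → ℕ} (hc : Cpt sz e (.list (.list .real)) cols)
    (hv : Cpt sz e .nat v) (ht : Cpt sz e .nat t) :
    Cpt sz e .real fun i => HDQI.ent (cols i) (v i) (t i) :=
  (hc.getD (A := .list .real) hv (nil .real)).getD ht zero

theorem rotNorm {a a' : ι → ℝ} (ha : Cpt sz e .real a) (ha' : Cpt sz e .real a') :
    Cpt sz e .real fun i => Real.sqrt (a i * a i + a' i * a' i) :=
  ((ha.rmul ha).radd (ha'.rmul ha')).sqrt

open Classical in
theorem rotCos {a a' : ι → ℝ} (ha : Cpt sz e .real a) (ha' : Cpt sz e .real a') :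
    Cpt sz e .real fun i => HDQI.rotCos (a i) (a' i) := by
  refine (ite (zero.rlt (ha.rotNorm ha')) (ha.rdiv (ha.rotNorm ha')) one).congr fun i => ?_
  rw [HDQI.rotCos]

open Classical in
theorem rotSin {a a' : ι → ℝ} (ha : Cpt sz e .real a) (ha' : Cpt sz e .real a') :
    Cpt sz e .real fun i => HDQI.rotSin (a i) (a' i) := by
  refine (ite (zero.rlt (ha.rotNorm ha')) (ha'.rdiv (ha.rotNorm ha')) zero).congr fun i => ?_
  rw [HDQI.rotSin]

theorem rotGates {b i' j : ι → ℕ} {c s : ι → ℝ} (hb : Cpt sz e .nat b) (hi : Cpt sz e .nat i')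
    (hj : Cpt sz e .nat j) (hc : Cpt sz e .real c) (hs : Cpt sz e .real s) :
    Cpt sz e circTy fun i => HDQI.rotGates (b i) (i' i) (j i) (c i) (s i) :=
  have h1 := hb.add hi
  have h2 := hb.add hj
  (h2.cX h1).cons ((gate (h1.cons (nil .nat)) h2 hc zero hs.rneg zero hs zero hc zero).cons
    ((h2.cX h1).cons (nil gateTy)))

theorem rotStep {rows b i' j : ι → ℕ} {S : ι → ColState} (hr : Cpt sz e .nat rows)
    (hb : Cpt sz e .nat b) (hi : Cpt sz e .nat i') (hj : Cpt sz e .nat j) (hS : Cpt sz e colTy S) :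
    Cpt sz e colTy fun i => HDQI.rotStep (rows i) (b i) (i' i) (j i) (S i) := by
  have hcol : Cpt sz e (.list (.list .real)) fun i => (S i).1 := hS.fst
  have hc := (hcol.ent hi hi).rotCos (hcol.ent hj hi)
  have hs := (hcol.ent hi hi).rotSin (hcol.ent hj hi)
  refine pair (hcol.length.range.map (A := .nat) (B := .list .real) _ fun hv =>
    ite (hv.eq hi.up) (hr.up.range.map (A := .nat) (B := .real) _ fun ht =>
      ((hc.up.up.rmul (hcol.up.up.ent hi.up.up ht)).radd
        (hs.up.up.rmul (hcol.up.up.ent hj.up.up ht))))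
    (ite (hv.eq hj.up) (hr.up.range.map (A := .nat) (B := .real) _ fun ht =>
      ((hc.up.up.rmul (hcol.up.up.ent hj.up.up ht)).rsub
        (hs.up.up.rmul (hcol.up.up.ent hi.up.up ht))))
    (hcol.up.getD (A := .list .real) hv (nil .real))))
    ((hb.rotGates hi hj hc hs).append (A := gateTy) hS.snd)

end Cpt

/-! ### Size bounds for the elimination. -/

theorem gate_bdd {V : ℕ} {g : RawGate} (h1 : g.1.length ≤ V) (h2 : ∀ c ∈ g.1, c ≤ V)
    (h3 : g.2.1 ≤ V) : gateTy.Bdd V g :=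
  ⟨⟨h1, h2⟩, h3, ⟨⟨trivial, trivial⟩, trivial, trivial⟩, ⟨trivial, trivial⟩, trivial, trivial⟩

/-- Bounds on the sizes of columns and a circuit. -/
structure ColBdd (N R G V : ℕ) (S : ColState) : Prop where
  len : S.1.length = N
  col : ∀ c ∈ S.1, c.length ≤ R
  glen : S.2.length ≤ G
  gate : ∀ g ∈ S.2, gateTy.Bdd V g

namespace ColBdd

variable {N R G V : ℕ} {S : ColState}

theorem bdd (h : ColBdd N R G V S) {T : ℕ} (hN : N ≤ T) (hR : R ≤ T) (hG : G ≤ T) (hV : V ≤ T) :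
    Cpt.colTy.Bdd T S :=
  ⟨⟨h.len.le.trans hN, fun c hc => ⟨(h.col c hc).trans hR, fun _ _ => trivial⟩⟩,
    h.glen.trans hG, fun g hg => (h.gate g hg).mono hV⟩

theorem length_getD_le (h : ∀ c ∈ S.1, c.length ≤ R) (v : ℕ) : (S.1.getD v []).length ≤ R := by
  rw [List.getD_eq_getElem?_getD]
  cases hv : S.1[v]? with
  | none => exact Nat.zero_le _
  | some c => exact h c (List.mem_of_getElem? hv)

theorem rotStep {rows b i j : ℕ} (hr : rows ≤ R) (hV : b + i + j + 2 ≤ V) (h : ColBdd N R G V S) :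
    ColBdd N R (G + 3) V (rotStep rows b i j S) := by
  refine ⟨by simp [HDQI.rotStep, h.len], fun c hc => ?_, ?_, fun g hg => ?_⟩
  · obtain ⟨v, -, rfl⟩ := List.mem_map.1 hc
    split_ifs
    · simpa using hr
    · simpa using hr
    · exact length_getD_le h.col v
  · have := h.glen
    simp only [HDQI.rotStep, List.length_append, rotGates, List.length_cons, List.length_nil]
    omega
  · rcases List.mem_append.1 hg with hg | hg
    · simp only [rotGates, List.mem_cons, List.not_mem_nil, or_false] at hg
      rcases hg with rfl | rfl | rfl <;>
        refine gate_bdd ?_ ?_ ?_ <;> simp only [HDQI.rX, rRot, List.length_cons, List.length_nil,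
          List.mem_singleton, forall_eq] <;> omega
    · exact h.gate g hg

theorem elimRow {rows b i j : ℕ} (hr : rows ≤ R) (hV : b + i + j + 2 ≤ V) (h : ColBdd N R G V S) :
    ColBdd N R (G + 3 * j) V (elimRow rows b i j S) := by
  induction j with
  | zero => simpa [HDQI.elimRow] using h
  | succ j ih =>
    rw [HDQI.elimRow, List.range_succ, List.foldl_append, List.foldl_cons, List.foldl_nil,
      ← HDQI.elimRow]
    have h := ih (by omega)
    split_ifs
    · exact h.rotStep hr (by omega)
    · exact ⟨h.len, h.col, h.glen.trans (by omega), h.gate⟩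

theorem elim {rows b M r : ℕ} (hr : rows ≤ R) (hV : b + r + M + 2 ≤ V) (h : ColBdd N R G V S) :
    ColBdd N R (G + 3 * M * r) V (elim rows b M r S) := by
  induction r with
  | zero => simpa [HDQI.elim] using h
  | succ r ih =>
    rw [HDQI.elim, List.range_succ, List.foldl_append, List.foldl_cons, List.foldl_nil, ← HDQI.elim,
      Nat.mul_succ, ← Nat.add_assoc]
    exact (ih (by omega)).elimRow hr (by omega)

theorem length_emit (b d : ℕ) (C : List ℕ) : (emit b d C).2.length ≤ 3 * (d * 2 ^ C.length) := by
  induction C with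
  | nil => simp [emit]
  | cons q C ih =>
    have h : ∀ h : ℕ, (emitOne b h q).length = h * 3 := fun h => by
      simp [emitOne, List.length_flatMap]
    rw [emit_cons, List.length_append, emit_fst, h, List.length_cons, pow_succ]
    nlinarith

/-- Truncation restores `l + 1` columns of bounded length, so only the circuit grows, and by an
amount that does not depend on `S`. Over all components the growth is therefore additive. -/
theorem compStep {b l : ℕ} {c : ℕ → ℝ} {σ : ℕ → ℕ → ℝ} {C : List ℕ} {W : ℕ}
    (hW : 2 ^ C.length ≤ W) (hC : ∀ q ∈ C, q ≤ V) (hV : b + (l + 1) + (l + 1) * W + 2 ≤ V)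
    (h : ColBdd (l + 1) R G V S) : ColBdd (l + 1) (l + 1)
      (G + (3 * ((l + 1) * W) + 3 * ((l + 1) * W) * (l + 1))) V (compStep b l c σ S C) := by
  have hle : (l + 1) * 2 ^ C.length ≤ (l + 1) * W := Nat.mul_le_mul_left _ hW
  have h0 : ColBdd ((l + 1) * 2 ^ C.length) (l + 1) (G + 3 * ((l + 1) * W)) V
      (expand l (coeffTab c σ C l) S.1, (emit b (l + 1) C).2 ++ S.2) := by
    refine ⟨by rw [length_expand, h.len], fun col hcol => ?_, ?_, fun g hg => ?_⟩
    · obtain ⟨p, -, hcol⟩ := List.mem_flatMap.1 hcol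
      obtain ⟨r, -, rfl⟩ := List.mem_map.1 hcol
      simp [conv]
    · have h1 := length_emit b (l + 1) C
      have h2 := h.glen
      rw [List.length_append]
      omega
    · rcases List.mem_append.1 hg with hg | hg
      · refine forall_mem_emit (Q := fun g => gateTy.Bdd V g) (fun q hq u hu u' hu' _ => ?_) g hg
        have := hC q hq
        refine ⟨gate_bdd ?_ ?_ ?_, gate_bdd ?_ ?_ ?_, gate_bdd ?_ ?_ ?_⟩ <;>
          simp only [HDQI.rX, List.length_cons, List.length_nil, List.mem_cons, forall_eq_or_imp, List.not_mem_nil, false_imp_iff, implies_true,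
            and_true] <;> omega
      · exact h.gate g hg
  have h1 := h0.elim (b := b) (M := (l + 1) * 2 ^ C.length) (r := l + 1) le_rfl (by omega)
  rw [← emit_fst b (l + 1) C] at h1
  refine ⟨length_compStep, fun col hcol => ?_, h1.glen.trans ?_, h1.gate⟩
  · obtain ⟨v, -, rfl⟩ := List.mem_map.1 hcol
    exact length_getD_le h1.col v
  · rw [emit_fst, ← Nat.add_assoc]
    exact Nat.add_le_add_left (Nat.mul_le_mul_right _ (Nat.mul_le_mul_left _ hle)) _

end ColBdd

/-! ### Computability of the preparation circuit and of the circuits around the oracle. -/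

/-- The bits given by a list. -/
def vOf (r : List (Bool × Bool)) : ℕ → Bool × Bool := fun q => r.getD q (false, false)

namespace Cpt

variable {ι κ : Type} {sz : ι → ℕ} {E : Ty} {e : ι → E.Val}

theorem elimRow {rows b i' j : ι → ℕ} {S : ι → ColState} (hr : Cpt sz e .nat rows)
    (hb : Cpt sz e .nat b) (hi : Cpt sz e .nat i') (hj : Cpt sz e .nat j) (hS : Cpt sz e colTy S) :
    Cpt sz e colTy fun i => HDQI.elimRow (rows i) (b i) (i' i) (j i) (S i) := by
  obtain ⟨U, hU, hbS⟩ := hS.bdd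
  refine hS.foldl (S := colTy) (A := .nat) (L := fun i => List.range (j i))
    (fun i S k => if i' i < k then HDQI.rotStep (rows i) (b i) (i' i) k S else S)
    (fun i k s => ColBdd (S i).1.length (U i + rows i) (U i + 3 * k)
      (U i + (b i + i' i + j i + 2)) s) hj.range (fun i => ?_) ?_
    (T := fun i => U i + rows i + 3 * j i + (b i + i' i + j i + 2))
    ((((hU.add hr.nat_bdd).add ((PolyBdd.const 3).mul hj.nat_bdd))).add
      ((((hb.nat_bdd.add hi.nat_bdd).add hj.nat_bdd).add (.const 2)))) ?_
    fun hs ha => ite (hi.up.lt ha) (hr.up.rotStep hb.up hi.up ha hs) hs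
  · have h := hbS i
    exact ⟨rfl, fun c hc => (h.1.2 c hc).1.trans (Nat.le_add_right _ _), h.2.1,
      fun g hg => (h.2.2 g hg).mono (Nat.le_add_right _ _)⟩
  · intro i k s a _ ha h
    have ha := List.mem_range.1 ha
    split_ifs
    · exact h.rotStep (by omega) (by omega)
    · exact ⟨h.len, h.col, h.glen.trans (by omega), h.gate⟩
  · intro i k s hk h
    rw [List.length_range] at hk
    have := (hbS i).1.1
    exact h.bdd (by omega) (by omega) (by omega) (by omega)

theorem elim {rows b N r : ι → ℕ} {S : ι → ColState} (hrows : Cpt sz e .nat rows)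
    (hb : Cpt sz e .nat b) (hN : Cpt sz e .nat N) (hr : Cpt sz e .nat r) (hS : Cpt sz e colTy S) :
    Cpt sz e colTy fun i => HDQI.elim (rows i) (b i) (N i) (r i) (S i) := by
  obtain ⟨U, hU, hbS⟩ := hS.bdd
  refine hS.foldl (S := colTy) (A := .nat) (L := fun i => List.range (r i))
    (fun i S k => HDQI.elimRow (rows i) (b i) k (N i) S)
    (fun i k s => ColBdd (S i).1.length (U i + rows i) (U i + 3 * N i * k)
      (U i + (b i + r i + N i + 2)) s) hr.range (fun i => ?_) ?_
    (T := fun i => U i + rows i + 3 * N i * r i + (b i + r i + N i + 2))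
    ((((hU.add hrows.nat_bdd).add (((PolyBdd.const 3).mul hN.nat_bdd).mul hr.nat_bdd))).add
      ((((hb.nat_bdd.add hr.nat_bdd).add hN.nat_bdd).add (.const 2)))) ?_
    fun hs ha => hrows.up.elimRow hb.up ha hN.up hs
  · have h := hbS i
    exact ⟨rfl, fun c hc => (h.1.2 c hc).1.trans (Nat.le_add_right _ _), h.2.1,
      fun g hg => (h.2.2 g hg).mono (Nat.le_add_right _ _)⟩
  · intro i k s a _ ha h
    have ha := List.mem_range.1 ha
    rw [Nat.mul_succ, ← Nat.add_assoc]
    exact h.elimRow (by omega) (by omega)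
  · intro i k s hk h
    rw [List.length_range] at hk
    have := (hbS i).1.1
    have := Nat.mul_le_mul_left (3 * N i) hk
    exact h.bdd (by omega) (by omega) (by omega) (by omega)

theorem compStep {b l : ι → ℕ} {c : ι → List ℝ} {T : ι → List (List ℝ)} {S : ι → ColState}
    {C : ι → List ℕ} (hb : Cpt sz e .nat b) (hl : Cpt sz e .nat l) (hc : Cpt sz e (.list .real) c)
    (hT : Cpt sz e (.list (.list .real)) T) (hS : Cpt sz e colTy S) (hC : Cpt sz e (.list .nat) C)
    (h2 : PolyBdd sz fun i => 2 ^ (C i).length) :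
    Cpt sz e colTy fun i =>
      HDQI.compStep (b i) (l i) (HDQI.cOf (c i)) (HDQI.sOf (T i)) (S i) (C i) := by
  have hl1 := hl.add (nat 1)
  have hE := hl1.emit_fst hC h2
  have hcol : Cpt sz e (.list (.list .real)) fun i => (S i).1 := hS.fst
  have hacc : Cpt sz e circTy fun i => (S i).2 := hS.snd
  have h := hl1.elim hb hE hl1 (pair (hl.expand (hc.coeffTab hT hC hl h2) hcol)
    ((hb.emit_snd hl1 hC h2).append (A := gateTy) hacc))
  refine ((hl1.truncCols h.fst).pair h.snd).congr fun i => ?_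
  simp only [HDQI.compStep, HDQI.emit_fst]

theorem prepCircuit {b l : ι → ℕ} {c a : ι → List ℝ} {T : ι → List (List ℝ)}
    {Cs : ι → List (List ℕ)} {W : ι → ℕ} (hb : Cpt sz e .nat b) (hl : Cpt sz e .nat l)
    (hc : Cpt sz e (.list .real) c) (hT : Cpt sz e (.list (.list .real)) T)
    (ha : Cpt sz e (.list .real) a) (hCs : Cpt sz e (.list (.list .nat)) Cs)
    (hW : PolyBdd sz W) (hCW : ∀ i, ∀ C ∈ Cs i, 2 ^ C.length ≤ W i) :
    Cpt sz e circTy fun i => HDQI.prepCircuit (b i) (l i) (HDQI.cOf (c i)) (HDQI.sOf (T i))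
      (HDQI.cOf (a i)) (Cs i) := by
  obtain ⟨U, hU, hbC⟩ := hCs.bdd
  have hl1 := hl.add (nat 1)
  have hl2 := hl.add (nat 2)
  have hX : Cpt sz e gateTy fun i => HDQI.rX [] (b i) := rX (nil .nat) hb
  have h0 : Cpt sz e colTy fun i => (initCols (l i), [HDQI.rX [] (b i)]) :=
    pair (hl1.range.map (A := .nat) (B := .list .real) _ fun hv =>
      ite (hv.eq (nat 0)) (one.cons (nil .real)) (nil .real)) (hX.cons (nil gateTy))
  have hfold : Cpt sz e colTy fun i => (Cs i).foldl
      (HDQI.compStep (b i) (l i) (HDQI.cOf (c i)) (HDQI.sOf (T i)))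
      (initCols (l i), [HDQI.rX [] (b i)]) := by
    -- Gates added by one component: those of `emit`, and three for each possible rotation.
    let G : ι → ℕ := fun i =>
      3 * ((l i + 1) * W i) + 3 * ((l i + 1) * W i) * (l i + 1)
    let V : ι → ℕ := fun i => U i + (b i + (l i + 1) + (l i + 1) * W i + 2)
    have hlW := hl1.nat_bdd.mul hW
    have hG : PolyBdd sz G := ((PolyBdd.const 3).mul hlW).add
      (((PolyBdd.const 3).mul hlW).mul hl1.nat_bdd)
    have hV : PolyBdd sz V := hU.add (((hb.nat_bdd.add hl1.nat_bdd).add hlW).add (.const 2))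
    refine h0.foldl (S := colTy) (A := .list .nat)
      (fun i => HDQI.compStep (b i) (l i) (HDQI.cOf (c i)) (HDQI.sOf (T i)))
      (fun i j s => ColBdd (l i + 1) (l i + 1) (1 + G i * j) (V i) s) hCs (fun i => ?_) ?_
      (T := fun i => (l i + 1) + (1 + G i * (Cs i).length) + V i)
      ((hl1.nat_bdd.add ((PolyBdd.const 1).add (hG.mul hCs.length_bdd))).add hV) ?_
      fun hs hC => hb.up.compStep hl.up hc.up hT.up hs hC
        ((hW.comap FoldIdx.i).mono fun t => hCW t.i t.a t.mem)
    · refine ⟨by simp [initCols], fun col hcol => ?_, by simp, fun g hg => ?_⟩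
      · obtain ⟨v, -, rfl⟩ := List.mem_map.1 hcol
        split_ifs <;> simp
      · rw [List.mem_singleton] at hg
        subst hg
        refine gate_bdd ?_ ?_ ?_ <;> simp [HDQI.rX, V]
        omega
    · intro i j s C _ hC h
      have := h.compStep (c := HDQI.cOf (c i)) (σ := HDQI.sOf (T i)) (b := b i) (hCW i C hC)
        (fun q hq => (((hbC i).2 C hC).2 q hq).trans (Nat.le_add_right _ _)) (Nat.le_add_left _ _)
      rw [Nat.mul_succ, ← Nat.add_assoc]
      exact this
    · intro i j s hj h
      have := Nat.mul_le_mul_left (G i) hj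
      exact h.bdd (by omega) (by omega) (by omega) (by omega)
  have hcol := hfold.fst
  have hfin : Cpt sz e (.list (.list .real)) fun i => finalCols (l i) (HDQI.cOf (a i)) ((Cs i).foldl
      (HDQI.compStep (b i) (l i) (HDQI.cOf (c i)) (HDQI.sOf (T i)))
      (initCols (l i), [HDQI.rX [] (b i)])).1 :=
    hl2.range.map (A := .nat) (B := .list .real) _ fun hv => cons (A := .real)
      (hl1.up.sumRange _ fun hs => (((ha.up.up.cOf hs).rmul (hs.prodRange _ fun hj =>
        hj.natCast.radd one)).rmul (hcol.up.up.ent hv.up hs))) (nil .real)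
  exact hX.cons ((nat 1).elim hb hl2 (nat 1) (hfin.pair hfold.snd)).snd

theorem chain {F s N : ι → ℕ} (hF : Cpt sz e .nat F) (hs : Cpt sz e .nat s) (hN : Cpt sz e .nat N) :
    Cpt sz e circTy fun i => HDQI.chain (F i) (s i) (N i) :=
  (rX (nil .nat) (hF.add (nat 1))).cons (hN.range.flatMap (A := .nat) (B := gateTy) _ fun hj =>
    have h1 := (hF.up.add (nat 1)).add hj
    have h2 := (hF.up.add (nat 1)).add (hj.add (nat 1))
    (h1.cX h2).cons ((h1.ccX (hs.up.add hj) h2).cons (nil gateTy)))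

theorem zeroTest {F s N : ι → ℕ} (hF : Cpt sz e .nat F) (hs : Cpt sz e .nat s)
    (hN : Cpt sz e .nat N) : Cpt sz e circTy fun i => HDQI.zeroTest (F i) (s i) (N i) :=
  (hF.chain hs hN).append (A := gateTy) ((((hF.add (nat 1)).add hN).cX hF).cons
    ((hF.chain hs hN).reverse (A := gateTy)))

theorem hGate {t : ι → ℕ} (ht : Cpt sz e .nat t) : Cpt sz e gateTy fun i => HDQI.hGate (t i) :=
  have h : Cpt sz e .real fun _ => 1 / Real.sqrt (1 + 1) := one.rdiv (one.radd one).sqrt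
  gate (nil .nat) ht h zero h zero h zero h.rneg zero

theorem bellGates {s t r : ι → ℕ} (hs : Cpt sz e .nat s) (ht : Cpt sz e .nat t)
    (hr : Cpt sz e .nat r) : Cpt sz e circTy fun i => HDQI.bellGates (s i) (t i) (r i) :=
  hr.range.flatMap (A := .nat) (B := gateTy) _ fun hq =>
    (hs.up.add hq).hGate.cons (((hs.up.add hq).cX (ht.up.add hq)).cons (nil gateTy))

theorem pGate {c t : ι → ℕ} {a b : ι → Bool} (hc : Cpt sz e .nat c) (ht : Cpt sz e .nat t)
    (ha : Cpt sz e .bool a) (hb : Cpt sz e .bool b) :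
    Cpt sz e gateTy fun i => HDQI.pGate (c i) (t i) (a i) (b i) :=
  have h0 := zero.pair zero
  have h1 := one.pair zero
  (hc.cons (nil .nat)).pair (ht.pair ((((ha.cond zero one).pair zero).pair
    (ha.cond (hb.cond (zero.pair one) h1) h0)).pair
    ((ha.cond (hb.cond (zero.pair one.rneg) h1) h0).pair
      ((ha.cond zero (hb.cond one.rneg one)).pair zero))))

theorem vOf {v : ι → List (Bool × Bool)} {q : ι → ℕ} (hv : Cpt sz e (.list (.prod .bool .bool)) v)
    (hq : Cpt sz e .nat q) : Cpt sz e (.prod .bool .bool) fun i => HDQI.vOf (v i) (q i) :=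
  hv.getD (A := .prod .bool .bool) hq ((bool false).pair (bool false))

theorem pauliGates {B C n c : ι → ℕ} {v : ι → List (Bool × Bool)} (hB : Cpt sz e .nat B)
    (hC : Cpt sz e .nat C) (hn : Cpt sz e .nat n) (hc : Cpt sz e .nat c)
    (hv : Cpt sz e (.list (.prod .bool .bool)) v) :
    Cpt sz e circTy fun i => HDQI.pauliGates (B i) (C i) (n i) (c i) (HDQI.vOf (v i)) :=
  hn.range.flatMap (A := .nat) (B := gateTy) _ fun hq =>
    have h := hv.up.vOf hq
    (hc.up.pGate (hB.up.add hq) h.fst h.snd).cons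
      (h.snd.cond ((hc.up.cX (hC.up.add hq)).cons (nil gateTy)) (nil gateTy))

end Cpt

/-! ### The classical program -/

theorem cOf_ofFn {N : ℕ} (f : Fin N → ℝ) (q : ℕ) :
    cOf (List.ofFn f) q = if h : q < N then f ⟨q, h⟩ else 0 := by
  rw [cOf, List.getD_eq_getElem?_getD, List.getElem?_ofFn]
  split_ifs <;> rfl

/-- The table of the commutation signs of the Pauli operators with the given bits. -/
def signTable (n : ℕ) (rows : List (List (Bool × Bool))) : List (List ℝ) :=
  rows.map fun r => rows.map fun r' => ∏ q ∈ Finset.range n,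
    if ((vOf r q).1 = true ∧ (vOf r' q).2 = true ↔ (vOf r' q).1 = true ∧ (vOf r q).2 = true) then 1
    else -1

namespace PauliHamiltonian

variable {n m : ℕ} (H : PauliHamiltonian n m)

/-- The bits of the symplectic representations, as lists. -/
def rows : List (List (Bool × Bool)) :=
  List.ofFn fun i : Fin m => List.ofFn fun q : Fin n =>
    (decide (H.symp i (Sum.inl q) = 1), decide (H.symp i (Sum.inr q) = 1))

theorem vOf_rows (i : ℕ) : vOf (H.rows.getD i []) = H.bit i := by
  funext q
  by_cases hi : i < m
  · by_cases hq : q < n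
    · simp [vOf, rows, bit, List.getD_eq_getElem?_getD, hi, hq]
    · simp [vOf, rows, bit, List.getD_eq_getElem?_getD, hi, hq]
  · simp [vOf, rows, bit, List.getD_eq_getElem?_getD, hi]

/-- On one qubit two Pauli operators commute precisely if the two crosswise conjunctions of bits
have equal truth value. The defaults of `sOf` agree with the extension of the signs by `1`. -/
theorem sOf_signTable : sOf (signTable n H.rows) = H.sg := by
  funext i j
  by_cases hi : i < m
  · by_cases hj : j < m
    · have h : sOf (signTable n H.rows) i j = ∏ q ∈ Finset.range n,
          if ((H.bit i q).1 = true ∧ (H.bit j q).2 = true ↔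
            (H.bit j q).1 = true ∧ (H.bit i q).2 = true) then (1 : ℝ) else -1 := by
        simp only [← vOf_rows]
        simp [sOf, signTable, List.getD_eq_getElem?_getD, rows, hi, hj]
      rw [h, sg, dif_pos ⟨hi, hj⟩, sympSign, Finset.prod_range]
      refine Finset.prod_congr rfl fun q _ => ?_
      simp only [bit, hi, hj, q.2, and_self, dite_true, decide_eq_true_eq]
      generalize H.symp ⟨i, hi⟩ (Sum.inl q) = a
      generalize H.symp ⟨i, hi⟩ (Sum.inr q) = b
      generalize H.symp ⟨j, hj⟩ (Sum.inl q) = c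
      generalize H.symp ⟨j, hj⟩ (Sum.inr q) = d
      have h11 : (1 : ZMod 2) + 1 = 0 := rfl
      rcases zmod_two_cases a with rfl | rfl <;> rcases zmod_two_cases b with rfl | rfl <;>
        rcases zmod_two_cases c with rfl | rfl <;> rcases zmod_two_cases d with rfl | rfl <;>
        simp [h11]
    · simp [sOf, signTable, List.getD_eq_getElem?_getD, rows, sg, hi, hj]
  · simp [sOf, signTable, List.getD_eq_getElem?_getD, rows, sg, hi]

/-- The number of ancillas. -/
def ancillas (l : ℕ) : ℕ :=
  (H.components.flatMap fun C => List.range ((l + 1) * 2 ^ C.length)).length + (l + (m + n + n + 2))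

theorem le_ancillas (l : ℕ) {C : List ℕ} (hC : C ∈ H.components) :
    (l + 1) * 2 ^ C.length ≤ H.ancillas l := by
  refine le_trans ?_ (Nat.le_add_right _ _)
  rw [List.length_flatMap]
  exact List.le_sum_of_mem (List.mem_map.2 ⟨C, hC, List.length_range⟩)

theorem one_le_maxComponent (hm : 0 < m) : 1 ≤ H.maxComponent := by
  refine le_trans ?_ (Finset.le_sup (f := fun i : Fin m =>
    (H.anticommGraph.connectedComponentMk i).supp.ncard) (Finset.mem_univ ⟨0, hm⟩))
  exact (Set.ncard_pos (Set.toFinite _)).2 ⟨⟨0, hm⟩, rfl⟩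

end PauliHamiltonian

/-! ### Instances, their size, and the complete program. -/

/-- The instances of the problem. -/
structure Inst where
  n : ℕ
  m : ℕ
  l : ℕ
  H : PauliHamiltonian n m
  P : Polynomial ℝ
  natDegree_le : P.natDegree ≤ l

namespace Inst

/-- The size of an instance. -/
def sz (t : Inst) : ℕ := t.n + t.m + (t.l + 1) * 2 ^ t.H.maxComponent

/-- The input that describes an instance. -/
def input (t : Inst) : inputTy.Val := encodeInput t.H t.l t.P

theorem l_le (t : Inst) : t.l + 1 ≤ t.sz :=
  (Nat.le_mul_of_pos_right _ (by positivity)).trans (Nat.le_add_left _ _)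

theorem cpt_input : Cpt sz input inputTy input := by
  refine ⟨.id, fun t => t.sz + 1, PolyBdd.self.add (.const 1), fun t => ⟨rfl, by simp [Prog.steps], ?_⟩⟩
  have h1 := t.l_le
  have h2 : t.n + t.m ≤ t.sz := Nat.le_add_right _ _
  refine ⟨show t.n ≤ t.sz + 1 by omega, ⟨?_, fun y hy => ⟨trivial, ?_, fun _ _ => ⟨trivial, trivial⟩⟩⟩, ?_,
    fun _ _ => trivial⟩
  · simp only [input, encodeInput, List.length_ofFn]
    omega
  · obtain ⟨i, rfl⟩ := (List.mem_ofFn' _ _).1 hy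
    simp only [List.length_ofFn]
    omega
  · simp only [input, encodeInput, List.length_ofFn]
    omega

theorem cpt_n : Cpt sz input .nat n := cpt_input.fst

theorem cpt_terms : Cpt sz input (.list (.prod .real (.list (.prod .bool .bool))))
    fun t => (input t).2.1 := cpt_input.snd.fst

theorem cpt_m : Cpt sz input .nat m :=
  cpt_terms.length.congr fun t => by simp [input, encodeInput]

theorem cpt_l : Cpt sz input .nat l :=
  (cpt_input.snd.snd.length.sub (Cpt.nat 1)).congr fun t => by simp [input, encodeInput]

theorem cpt_rows : Cpt sz input (.list (.list (.prod .bool .bool))) fun t => t.H.rows :=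
  (cpt_terms.map (A := .prod .real (.list (.prod .bool .bool))) (B := .list (.prod .bool .bool))
    (fun _ p => p.2) fun h => h.snd).congr fun t => by
      simp [input, encodeInput, PauliHamiltonian.rows, List.map_ofFn, Function.comp_def]

theorem cpt_signTable : Cpt sz input (.list (.list .real)) fun t => signTable t.n t.H.rows :=
  cpt_rows.map (A := .list (.prod .bool .bool)) (B := .list .real) _ fun hr =>
    cpt_rows.up.map (A := .list (.prod .bool .bool)) (B := .real) _ fun hr' =>
      cpt_n.up.up.prodRange _ fun hq =>
        have h := hr.up.up.vOf hq
        have h' := hr'.up.vOf hq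
        Cpt.ite ((h.fst.isTrue.and h'.snd.isTrue).iff (h'.fst.isTrue.and h.snd.isTrue)) Cpt.one
          Cpt.one.rneg

theorem cpt_components : Cpt sz input (.list (.list .nat)) fun t => t.H.components :=
  (cpt_m.comps (cpt_signTable.labels cpt_m)).congr fun t => by
    rw [PauliHamiltonian.components, PauliHamiltonian.sOf_signTable]

/-- The program never computes the maximal component size; it enters only the size by which the work
is measured. -/
theorem two_pow_le (t : Inst) {C : List ℕ} (hC : C ∈ t.H.components) : 2 ^ C.length ≤ t.sz :=
  (Nat.pow_le_pow_right (by omega) (t.H.mem_components hC).1).trans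
    ((Nat.le_mul_of_pos_left _ (Nat.succ_pos _)).trans (Nat.le_add_left _ _))

/-- `ancillas` expresses the sum of the mode numbers as the length of a concatenation, so that list
operations suffice to compute it. -/
theorem cpt_ancillas : Cpt sz input .nat fun t => t.H.ancillas t.l :=
  ((cpt_components.flatMap (A := .list .nat) (B := .nat) _ fun hC =>
    ((cpt_l.up.add (Cpt.nat 1)).mul (hC.length.two_pow
      ((PolyBdd.self.comap MapIdx.i).mono fun t => t.i.two_pow_le t.mem))).range).length).add
    (cpt_l.add (((cpt_m.add cpt_n).add cpt_n).add (Cpt.nat 2)))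

theorem cpt_prepGates : Cpt sz input Cpt.circTy fun t => t.H.prepGates t.l t.P := by
  have hc : Cpt sz input (.list .real) fun t => (input t).2.1.map fun p => p.1 :=
    cpt_terms.map (A := .prod .real (.list (.prod .bool .bool))) (B := .real) _ fun h => h.fst
  have ha : Cpt sz input (.list .real) fun t => (input t).2.2 := cpt_input.snd.snd
  refine (((cpt_m.add cpt_n).add cpt_n).prepCircuit cpt_l hc cpt_signTable ha cpt_components
    PolyBdd.self fun t C hC => t.two_pow_le hC).congr fun t => ?_
  rw [PauliHamiltonian.prepGates, PauliHamiltonian.sOf_signTable]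
  congr 1
  · funext q
    simp only [input, encodeInput, List.map_ofFn]
    rw [cOf_ofFn]
    rfl
  · funext q
    simp only [input, encodeInput]
    rw [cOf_ofFn]
    split_ifs with h
    · rfl
    -- The input lists the coefficients up to `l` only; beyond that both sides vanish by the degree
    -- bound.
    · exact (Polynomial.coeff_eq_zero_of_natDegree_lt (by have := t.natDegree_le; omega)).symm

theorem cpt_beforeGates : Cpt sz input Cpt.circTy fun t => t.H.beforeGates t.l := by
  have hb := (cpt_m.add cpt_n).add cpt_n
  have hX : Cpt sz input gateTy fun t => rX [t.m + t.n + t.n] 0 := hb.cX (Cpt.nat 0)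
  have hcode : Cpt sz input Cpt.circTy fun t => (List.range t.m).reverse.flatMap fun i =>
      pauliGates t.m (t.m + t.n) t.n i (vOf (t.H.rows.getD i [])) :=
    cpt_m.range.reverse.flatMap (A := .nat) (B := gateTy) _ fun hi =>
      cpt_m.up.pauliGates (cpt_m.add cpt_n).up cpt_n.up hi
        (cpt_rows.up.getD (A := .list (.prod .bool .bool)) hi (Cpt.nil _))
  refine (Cpt.ite (B := Cpt.circTy) (cpt_l.eq (Cpt.nat 0)) (hb.bellGates (Cpt.nat 0) hb)
    ((hb.zeroTest (Cpt.nat 0) cpt_m).append (A := gateTy) (hX.cons hcode))).congr fun t => ?_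
  simp only [PauliHamiltonian.beforeGates, PauliHamiltonian.codeGates, PauliHamiltonian.vOf_rows]

theorem cpt_afterGates : Cpt sz input Cpt.circTy fun t => t.H.afterGates t.l := by
  have hmn := cpt_m.add cpt_n
  have hb := hmn.add cpt_n
  refine (Cpt.ite (B := Cpt.circTy) (cpt_l.eq (Cpt.nat 0)) (Cpt.nil gateTy)
    ((cpt_m.pauliGates hmn cpt_n hb (cpt_rows.getD (A := .list (.prod .bool .bool)) (Cpt.nat 0)
      (Cpt.nil _))).append (A := gateTy) ((hb.zeroTest cpt_m (cpt_n.add cpt_n)).append (A := gateTy)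
        (cpt_m.bellGates hmn cpt_n)))).congr fun t => ?_
  simp only [PauliHamiltonian.afterGates, PauliHamiltonian.vOf_rows]

theorem cpt_output : Cpt sz input outputTy fun t =>
    (t.H.ancillas t.l, t.H.prepGates t.l t.P, t.H.beforeGates t.l, t.H.afterGates t.l) :=
  cpt_ancillas.pair (cpt_prepGates.pair (cpt_beforeGates.pair cpt_afterGates))

end Inst

/-! ### The running time. -/

theorem time_bound (K : ℕ) : ∃ K', ∀ a l M : ℕ, 1 ≤ a → 1 ≤ M →
    (a + (l + 1) * 2 ^ M + 2) ^ K ≤ K' * ((l + M) ^ (K' * M) + a ^ K') := by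
  -- The summand `6 ^ K` absorbs the numerical factor, and `2 * K` the exponents.
  refine ⟨6 ^ K + 2 * K, fun a l M ha hM => ?_⟩
  have hx : 1 ≤ l + M := by omega
  have hb : (l + 1) * 2 ^ M ≤ 2 * (l + M) ^ (2 * M) := by
    -- If `l + M = 1`, powers of `l + M` cannot absorb `2 ^ M`; the factor `2` in `hb` takes care of
    -- this case.
    rcases Nat.lt_or_ge (l + M) 2 with h | h
    · obtain rfl : l = 0 := by omega
      obtain rfl : M = 1 := by omega
      norm_num
    · calc (l + 1) * 2 ^ M ≤ (l + M) ^ 1 * (l + M) ^ M :=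
            Nat.mul_le_mul (by rw [pow_one]; omega) (Nat.pow_le_pow_left h M)
        _ = (l + M) ^ (1 + M) := (pow_add _ _ _).symm
        _ ≤ (l + M) ^ (2 * M) := Nat.pow_le_pow_right hx (by omega)
        _ ≤ _ := by omega
  have h1 : a + (l + 1) * 2 ^ M + 2 ≤ 6 * max a ((l + M) ^ (2 * M)) := by
    have := le_max_left a ((l + M) ^ (2 * M))
    have := le_max_right a ((l + M) ^ (2 * M))
    omega
  have h2 : max a ((l + M) ^ (2 * M)) ^ K ≤
      (l + M) ^ ((6 ^ K + 2 * K) * M) + a ^ (6 ^ K + 2 * K) := by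
    rcases max_choice a ((l + M) ^ (2 * M)) with h | h <;> rw [h]
    · exact (Nat.pow_le_pow_right ha ((show K ≤ 2 * K by omega).trans (Nat.le_add_left _ _))).trans
        (Nat.le_add_left _ _)
    · rw [← pow_mul]
      refine (Nat.pow_le_pow_right hx ?_).trans (Nat.le_add_right _ _)
      rw [Nat.add_mul]
      exact (Nat.mul_right_comm 2 M K).le.trans (Nat.le_add_left _ _)
  calc _ ≤ (6 * max a ((l + M) ^ (2 * M))) ^ K := Nat.pow_le_pow_left h1 K
    _ = 6 ^ K * max a ((l + M) ^ (2 * M)) ^ K := mul_pow _ _ _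
    _ ≤ _ := Nat.mul_le_mul (Nat.le_add_right _ _) h2

end HDQI

end

theorem mainTheorem2 :
    ∃ (p : HDQI.Prog HDQI.inputTy HDQI.outputTy) (K : ℕ),
      ∀ (n m l : ℕ) (H : HDQI.PauliHamiltonian n m) (P : Polynomial ℝ),
        0 < m → (∀ i, H.term i ≠ 1) → P.natDegree ≤ l → Matrix.trace (H.polyOp P ^ 2) ≠ 0 →
          ∃ (k : ℕ) (prep before after : List (HDQI.Gate (HDQI.Wire n m k))),
            p.eval (HDQI.encodeInput H l P) = HDQI.encodeOutput prep before after ∧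
            HDQI.totalTime p H l P prep before after ≤
              K * ((l + H.maxComponent) ^ (K * H.maxComponent) + (m + n) ^ K) ∧
            (HDQI.circuitMatrix prep).mulVec (HDQI.zeroState n m k) =
              HDQI.withZeros (H.refState l P) ∧
            ∀ D, H.IsDecodingOracle l D →
              HDQI.reducedB
                ((HDQI.circuitMatrix after).mulVec
                  ((HDQI.oracleMatrix D).mulVec
                    ((HDQI.circuitMatrix before).mulVec
                      (HDQI.withZeros (H.refState l P))))) =
                H.rho P := by
  obtain ⟨p, S, hS, hp⟩ := HDQI.Inst.cpt_output
  -- Five quantities are bounded by `S`: program steps, ancillas and three circuit lengths. Twice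
  -- the size accounts for the `m + 2n` register qubits, and `1` for the oracle call.
  obtain ⟨K₀, hK₀⟩ := ((((HDQI.PolyBdd.const 5).mul hS).add
    ((HDQI.PolyBdd.const 2).mul .self)).add (.const 1))
  obtain ⟨K, hK⟩ := HDQI.time_bound K₀
  refine ⟨p, K, fun n m l H P hm hI hP htr => ?_⟩
  have hk : m + n + n + 2 ≤ H.ancillas l := (Nat.le_add_left _ _).trans (Nat.le_add_left _ _)
  have hl : l + (m + n + n + 2) ≤ H.ancillas l := Nat.le_add_left _ _
  obtain ⟨prep, hprep, hprep'⟩ := HDQI.exists_circuit (n := n) (m := m) (k := H.ancillas l)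
    (H.prepGates l P) (HDQI.valid_prepCircuit (by omega) fun C hC => by
      have h1 := H.le_ancillas l hC
      exact ⟨by omega, fun q hq => ((H.mem_components hC).2.2 q hq).trans_le (by omega)⟩)
  obtain ⟨before, hbefore, hbefore'⟩ := HDQI.exists_circuit (n := n) (m := m) (k := H.ancillas l)
    (H.beforeGates l) (H.valid_beforeGates hm hk)
  obtain ⟨after, hafter, hafter'⟩ := HDQI.exists_circuit (n := n) (m := m) (k := H.ancillas l)
    (H.afterGates l) (H.valid_afterGates hk)
  have h := hp ⟨n, m, l, H, P, hP⟩
  refine ⟨H.ancillas l, prep, before, after, ?_, ?_, H.prepGates_spec hP htr hprep', fun D hD =>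
    H.reducedB_eq hm hI hP htr hD (by omega) hbefore' hafter hafter'⟩
  · rw [HDQI.encodeOutput, hprep, hbefore, hafter]
    exact h.1
  · have h1 := hK₀ ⟨n, m, l, H, P, hP⟩
    have h2 := hK (m + n) l H.maxComponent (by omega) (H.one_le_maxComponent hm)
    have hsteps : p.steps (HDQI.encodeInput H l P) ≤ S ⟨n, m, l, H, P, hP⟩ := h.2.1
    -- Computability includes a size bound on the output, so ancillas and gates need no separate
    -- count.
    obtain ⟨hk', ⟨hg0, -⟩, ⟨hg1, -⟩, hg2, -⟩ := h.2.2
    have hk' : H.ancillas l ≤ S ⟨n, m, l, H, P, hP⟩ := hk'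
    simp only [← hprep, ← hbefore, ← hafter, List.length_map, HDQI.Inst.sz] at h1 hg0 hg1 hg2
    rw [Nat.add_comm n m] at h1
    refine le_trans ?_ (h1.trans h2)
    simp only [HDQI.totalTime, HDQI.Wire, Fintype.card_sum, Fintype.card_fin]
    omega
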